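/- **Setting.** Let $(V,Q)$ be a finite-dimensional positive definite quadratic space over $\mathbb{Q}$, with orthogonal group $O(V)$, $O^+(V)=O(V)\cap \mathrm{SL}(V)$ and $O^-(V)=O(V)\setminus O^+(V)$. For a $\mathbb{Z}$-lattice $L$ on $V$ (of full rank) and $m\ge 1$ let $a_m^+(L)$, resp. $a_m(L)$, be the number of sublattices $K\subseteq L$ of index $m$ up to $K\sim\sigma(K)$ with $\sigma\in O^+(V)$, resp. $\sigma\in O(V)$. Put $$\zeta^+_L(s)=\sum_{m\ge1}a_m^+(L)m^{-s},\qquad \zeta_L(s)=\sum_{m\ge1}a_m(L)m^{-s},$$ and write $\zeta^+_f,\zeta_f$ for $\zeta^+_L,\zeta_L$ when $f$ is the quadratic form of $L$ in some $\mathbb{Z}$-basis. For $\rho\in O^-(V)$ put $$Z_{L,\rho}(s)=\sum_{K\subseteq L,\ \rho(K)=K}\frac{|L:K|^{-s}}{\#\{\sigma\in O(V):\sigma(K)\subseteq L\}},\qquad \mathrm{Refl}_L(s)=\sum_{\rho\in O^-(V)}Z_{L,\rho}(s),$$ where $K$ runs over the sublattices of finite index. An imaginary quadratic field $F$ is a quadratic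 space with $Q=N_{F/\mathbb{Q}}$, and its ring of integers is a lattice on it. Below $p$ and $q$ denote primes, $\omega=\frac{-1+\sqrt{-3}}2$, and $\zeta_F$ is the Dedekind zeta function of $F$. For $\Re(s)>1$ all the products over primes below converge absolutely. **Reflection terms.** For $\Re(s)>1$ the double series $\mathrm{Refl}_R(s)$ over $(\rho,K)$ converges absolutely for $R=\mathbb{Z}[\omega]$, the ring of integers of $\mathbb{Q}(\sqrt{-3})$, and for $R=\mathbb{Z}[i]$, the ring of integers of $\mathbb{Q}(\sqrt{-1})$, and $$\mathrm{Refl}_{\mathbb{Z}[\omega]}(s)=\tfrac12\,(1-2^{-s}+2\cdot2^{-2s})\,\zeta(s)^2\prod_{p\equiv1\,(3)}(1+p^{-s}),$$ $$\mathrm{Refl}_{\mathbb{Z}[i]}(s)=\tfrac12\,(1+2^{-2s})\,\zeta(s)^2\prod_{p\equiv1\,(4)}(1+p^{-s}).$$ **Hexagonal lattice.** Let $f=x^2+xy+y^2$ and $F=\mathbb{Q}(\sqrt{-3})$. For $\Re(s)>2$ the series $\zeta^+_f(s)$ and $\zeta_f(s)$ converge absolutely, and $$\begin{aligned}\zeta^+_f(s)&=\tfrac13\zeta(s)\zeta(s-1)\prod_{p\equiv1\,(3)}(1-p^{-s})+\tfrac23\zeta_F(s)\prod_{p\equiv1\,(3)}(1-p^{-s})\\&=\tfrac13\zeta(s)\zeta(s-1)\prod_{p\equiv1\,(3)}(1-p^{-s})+\tfrac23\zeta(s)\prod_{q\equiv2\,(3)}(1+q^{-s})^{-1},\end{aligned}$$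 $$\begin{aligned}\zeta_f(s)&=\tfrac12\zeta^+_f(s)+\tfrac12(1-2^{-s}+2\cdot2^{-2s})\zeta(s)^2\prod_{p\equiv1\,(3)}(1+p^{-s})\\&=\tfrac16\zeta(s)\zeta(s-1)\prod_{p\equiv1\,(3)}(1-p^{-s})+\tfrac13\zeta(s)\prod_{q\equiv2\,(3)}(1+q^{-s})^{-1}+\tfrac12(1-2^{-s}+2\cdot2^{-2s})\zeta(s)^2\prod_{p\equiv1\,(3)}(1+p^{-s}).\end{aligned}$$ **Square lattice.** Let $f=x^2+y^2$ and $F=\mathbb{Q}(\sqrt{-1})$. For $\Re(s)>2$ the series $\zeta^+_f(s)$ and $\zeta_f(s)$ converge absolutely, and $$\begin{aligned}\zeta^+_f(s)&=\tfrac12\zeta(s)\zeta(s-1)\prod_{p\equiv1\,(4)}(1-p^{-s})+\tfrac12\zeta_F(s)\prod_{p\equiv1\,(4)}(1-p^{-s})\\&=\tfrac12\zeta(s)\zeta(s-1)\prod_{p\equiv1\,(4)}(1-p^{-s})+\tfrac12\zeta(s)\prod_{q\equiv3\,(4)}(1+q^{-s})^{-1},\end{aligned}$$ $$\begin{aligned}\zeta_f(s)&=\tfrac12\zeta^+_f(s)+\tfrac12(1+2^{-2s})\zeta(s)^2\prod_{p\equiv1\,(4)}(1+p^{-s})\\&=\tfrac14\zeta(s)\zeta(s-1)\prod_{p\equiv1\,(4)}(1-p^{-s})+\tfrac14\zeta(s)\prod_{q\equiv3\,(4)}(1+q^{-s})^{-1}+\tfrac12(1+2^{-2s})\zeta(s)^2\prod_{p\equiv1\,(4)}(1+p^{-s}).\end{aligned}$$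 -/

import Mathlib

namespace SubformZeta

/-! ### Quadratic spaces, sublattices and their zeta functions

A `ℤ`-lattice on a rational quadratic space `V` is treated as an additive subgroup of `V`. -/

section QuadraticSpace

variable {V : Type*} [AddCommGroup V] [Module ℚ V]

/-- The orthogonal group `O(V)` of the quadratic space `(V, Q)`. -/
def orthogonal (Q : QuadraticForm ℚ V) : Subgroup (V ≃ₗ[ℚ] V) where
  carrier := {σ | ∀ x, Q (σ x) = Q x}
  one_mem' := fun _ => rfl
  mul_mem' := fun {σ τ} hσ hτ x => (hσ (τ x)).trans (hτ x)
  inv_mem' := fun {σ} hσ x => by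
    have h := hσ (σ.symm x)
    rw [σ.apply_symm_apply] at h
    exact h.symm

/-- The proper orthogonal group `O⁺(V) = O(V) ∩ SL(V)`. -/
noncomputable def properOrthogonal (Q : QuadraticForm ℚ V) : Subgroup (V ≃ₗ[ℚ] V) :=
  orthogonal Q ⊓ (LinearEquiv.det (R := ℚ) (M := V)).ker

/-- The set of reflections `O⁻(V) = O(V) \ O⁺(V)`. -/
def reflections (Q : QuadraticForm ℚ V) : Set (V ≃ₗ[ℚ] V) :=
  {ρ | ρ ∈ orthogonal Q ∧ ρ ∉ properOrthogonal Q}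

/-- The image `σ(K)` of a lattice `K`. -/
def image (σ : V ≃ₗ[ℚ] V) (K : AddSubgroup V) : AddSubgroup V :=
  K.map σ.toAddEquiv.toAddMonoidHom

/-- The set of all sublattices of index `m` in `L` (used for `m ≥ 1`). -/
abbrev Sublattice (L : AddSubgroup V) (m : ℕ) : Type _ :=
  {K : AddSubgroup V // K ≤ L ∧ K.relIndex L = m}

/-- `G`-equivalence of sublattices of index `m` of `L`: `K₁ ∼ K₂` iff `σ(K₁) = K₂` for some
`σ ∈ G`. -/
def sublatticeSetoid (G : Subgroup (V ≃ₗ[ℚ] V)) (L : AddSubgroup V) (m : ℕ) :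
    Setoid (Sublattice L m) where
  r K₁ K₂ := ∃ σ ∈ G, image σ K₁.1 = K₂.1
  iseqv :=
    { refl := fun K => ⟨1, G.one_mem, by ext x; simp [image]⟩
      symm := by
        rintro ⟨K₁, h₁⟩ ⟨K₂, h₂⟩ ⟨σ, hσ, h⟩
        refine ⟨σ⁻¹, G.inv_mem hσ, ?_⟩
        change image σ K₁ = K₂ at h
        change image σ⁻¹ K₂ = K₁
        subst h
        ext x
        simp only [image, AddSubgroup.mem_map]
        constructor
        · rintro ⟨y, ⟨z, hz, rfl⟩, rfl⟩
          change σ.symm (σ z) ∈ K₁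
          rwa [σ.symm_apply_apply]
        · intro hx
          exact ⟨σ x, ⟨x, hx, rfl⟩, σ.symm_apply_apply x⟩
      trans := by
        rintro ⟨K₁, h₁⟩ ⟨K₂, h₂⟩ ⟨K₃, h₃⟩ ⟨σ, hσ, h⟩ ⟨τ, hτ, h'⟩
        refine ⟨τ * σ, G.mul_mem hτ hσ, ?_⟩
        change image σ K₁ = K₂ at h
        change image τ K₂ = K₃ at h'
        change image (τ * σ) K₁ = K₃
        subst h h'
        ext x
        simp only [image, AddSubgroup.mem_map]
        constructor
        · rintro ⟨y, hy, rfl⟩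
          exact ⟨σ y, ⟨y, hy, rfl⟩, rfl⟩
        · rintro ⟨_, ⟨y, hy, rfl⟩, rfl⟩
          exact ⟨y, hy, rfl⟩ }

/-- The number of `G`-inequivalent sublattices of index `m` in `L`. -/
noncomputable def classCount (G : Subgroup (V ≃ₗ[ℚ] V)) (L : AddSubgroup V) (m : ℕ) : ℕ :=
  Nat.card (Quotient (sublatticeSetoid G L m))

/-- `a⁺_m(L)`, as a complex sequence. -/
noncomputable def properCoeff (Q : QuadraticForm ℚ V) (L : AddSubgroup V) (m : ℕ) : ℂ :=
  classCount (properOrthogonal Q) L m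

/-- `a_m(L)`, as a complex sequence. -/
noncomputable def coeff (Q : QuadraticForm ℚ V) (L : AddSubgroup V) (m : ℕ) : ℂ :=
  classCount (orthogonal Q) L m

/-- The zeta function of proper isometry classes, `ζ⁺_L(s) = ∑_{m ≥ 1} a⁺_m(L) m^{-s}`. -/
noncomputable def properZeta (Q : QuadraticForm ℚ V) (L : AddSubgroup V) (s : ℂ) : ℂ :=
  LSeries (properCoeff Q L) s

/-- The zeta function of isometry classes, `ζ_L(s) = ∑_{m ≥ 1} a_m(L) m^{-s}`. -/
noncomputable def zeta (Q : QuadraticForm ℚ V) (L : AddSubgroup V) (s : ℂ) : ℂ :=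
  LSeries (coeff Q L) s

/-- The sublattices `K ⊆ L` of finite index with `ρ(K) = K`. -/
abbrev InvariantSublattice (L : AddSubgroup V) (ρ : V ≃ₗ[ℚ] V) : Type _ :=
  {K : AddSubgroup V // K ≤ L ∧ K.relIndex L ≠ 0 ∧ image ρ K = K}

/-- The summand `|L : K|^{-s} / #{σ ∈ O(V) : σ(K) ⊆ L}`. -/
noncomputable def summand (Q : QuadraticForm ℚ V) (L : AddSubgroup V) (s : ℂ)
    (K : AddSubgroup V) : ℂ :=
  (K.relIndex L : ℂ) ^ (-s) / (Nat.card {σ : V ≃ₗ[ℚ] V // σ ∈ orthogonal Q ∧ image σ K ≤ L} : ℂ)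

/-- `Z_{L,ρ}(s)`. -/
noncomputable def Z (Q : QuadraticForm ℚ V) (L : AddSubgroup V) (ρ : V ≃ₗ[ℚ] V) (s : ℂ) : ℂ :=
  ∑' K : InvariantSublattice L ρ, summand Q L s K.1

/-- The sum of all reflection terms, `Refl_L(s) = ∑_{ρ ∈ O⁻(V)} Z_{L,ρ}(s)`. -/
noncomputable def Refl (Q : QuadraticForm ℚ V) (L : AddSubgroup V) (s : ℂ) : ℂ :=
  ∑' ρ : reflections Q, Z Q L ρ.1 s

/-- The double series defining `Refl_L(s)` converges absolutely, jointly in `ρ` and `K`. -/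
def ReflSummable (Q : QuadraticForm ℚ V) (L : AddSubgroup V) (s : ℂ) : Prop :=
  Summable fun x : (Σ ρ : reflections Q, InvariantSublattice L ρ.1) => summand Q L s x.2.1

/-- `L` is a binary lattice on `(V, Q)` with `V = ℚL` and `Q_L ≅ a x² + b x y + c y²`: for some
`ℤ`-basis `e₀, e₁` of `L`, which is also a `ℚ`-basis of `V`, one has
`Q(x e₀ + y e₁) = a x² + b x y + c y²`. -/
def IsLatticeOfForm (Q : QuadraticForm ℚ V) (L : AddSubgroup V) (a b c : ℤ) : Prop :=
  ∃ e : Module.Basis (Fin 2) ℚ V, L = AddSubgroup.closure (Set.range e) ∧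
    ∀ x y : ℤ, Q ((x : ℚ) • e 0 + (y : ℚ) • e 1) = (a * x ^ 2 + b * x * y + c * y ^ 2 : ℤ)

end QuadraticSpace

/-! ### The fields `ℚ(√-1)` and `ℚ(√-3)` as quadratic spaces -/

/-- `ℚ(√d)`: pairs `x + y √d` with `x, y ∈ ℚ` and `(√d)² = d`. -/
abbrev QuadField (d : ℚ) : Type := QuadraticAlgebra ℚ d 0

theorem sq_ne_of_neg {d : ℚ} (hd : d < 0) (r : ℚ) : r ^ 2 ≠ d + 0 * r := by
  nlinarith [sq_nonneg r]

instance factNegOne : Fact (∀ r : ℚ, r ^ 2 ≠ -1 + 0 * r) := ⟨sq_ne_of_neg (by norm_num)⟩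

instance factNegThree : Fact (∀ r : ℚ, r ^ 2 ≠ -3 + 0 * r) := ⟨sq_ne_of_neg (by norm_num)⟩

instance numberField (d : ℚ) [Fact (∀ r : ℚ, r ^ 2 ≠ d + 0 * r)] : NumberField (QuadField d) where
  to_charZero := ⟨fun m n h => by simpa using congrArg QuadraticAlgebra.re h⟩
  to_finiteDimensional := by
    have h : Module.Finite ℚ (QuadraticAlgebra ℚ d 0) := inferInstance
    convert h

/-- The norm of `ℚ(√d)` over `ℚ`, as a quadratic form. -/
def normForm (d : ℚ) : QuadraticForm ℚ (QuadField d) where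
  toFun x := x.norm
  toFun_smul r x := by
    simp only [QuadraticAlgebra.norm_def, QuadraticAlgebra.re_smul, QuadraticAlgebra.im_smul,
      smul_eq_mul]
    ring
  exists_companion' :=
    ⟨LinearMap.mk₂ ℚ (fun x y => 2 * x.re * y.re - 2 * d * x.im * y.im)
      (fun x y z => by simp; ring) (fun r x y => by simp; ring)
      (fun x y z => by simp; ring) (fun r x y => by simp; ring),
     fun x y => by simp [QuadraticAlgebra.norm_def]; ring⟩

theorem normForm_apply (d : ℚ) (x : QuadField d) : normForm d x = Algebra.norm ℚ x := by
  change x.norm = _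
  rw [← QuadraticAlgebra.det_toLinearMap_eq_norm, Algebra.norm_apply]
  rfl

/-- The ring of integers of `F`, as a lattice on `F`. -/
def integerLattice (F : Type*) [Field F] : AddSubgroup F :=
  (algebraMap (NumberField.RingOfIntegers F) F).range.toAddSubgroup

/-! ### Products over primes in a residue class -/

/-- The primes `p ≡ a (mod n)`. -/
abbrev PrimesMod (n a : ℕ) : Type := {p : ℕ // p.Prime ∧ p ≡ a [MOD n]}

end SubformZeta

/-! Let `R` be `IntRing b`, that is `ℤ[i]` for `b = 0` and `ℤ[ω]` for `b = 1` (here `ω² = ω - 1`, so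
`ω` is a primitive sixth root of unity). The lattice `L` in `V` is identified with `R` in its
fraction field `F` under the norm form (`NormModel`). Isometries are then exactly `x ↦ u x` and `x ↦
u conj(x)` with `N(u) = 1`, and those of the second kind are the reflections.

Since `R` is principal, every sublattice of finite index is `αK` with `(α)` the ideal that it
generates and `K` primitive, meaning that `K` generates the unit ideal (`scale_gen_bijective`).
Primitivity forces an isometry from `αK` to `βK'` to come from a unit `w` of `R`, possibly with a
conjugation, that takes `K` to `K'`. So `αK` and `βK'` are equivalent exactly when `N(α) = N(β)` and
`K`, `K'` lie in one orbit of a finite group (`equivalent_iff`). The zeta function of classes is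
therefore `normZeta`, the sum of `n^{-s}` over all norms `n`, times `orbitZeta`.

Burnside's lemma evaluates `orbitZeta`. The units `1` and `-1` fix every primitive sublattice, which
contributes `ζ(s) ζ(s-1) / ζ_F(s)`; any other unit fixes only `R`, because a sublattice stable under
it is an ideal. Conjugations contribute `invariantZeta`. In `Refl` each summand is divided by twice
the number of elements of norm `N(α)`. These elements are the unit multiples of generators of the
ideals of that norm, so summing over those ideals leaves each norm once, and `Refl` equals `normZeta
* invariantZeta` over twice the number of units (`NormModel.refl_eq`). This is also what
conjugations add to `ζ_L` in Burnside's lemma.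

A sublattice stable under a reflection is described by its intersections `a e₁`, `c e₂` with the two
axes and by whether it contains `(a e₁ + c e₂) / 2` (`Axes.exists_eq_axisLat`). Primitivity becomes
coprimality of `a` and `c` together with conditions at 2 and 3, so `invariantZeta` is an elementary
factor times the sum of `(ac)^{-s}` over coprime pairs, which is `ζ(s)² / ζ(2s)`.

Finally the splitting of rational primes (`SplitLaw`) gives Euler products for `normZeta` and `ζ_F`,
which differ only at split primes, and these turn all factors into the stated products. -/

namespace SubformZeta

/-! ### Zeta series of a set with a size function -/

section ZetaSeries

variable {X Y : Type*}

/-- The Dirichlet series `∑_x g(x)^{-s}` attached to a size function `g` on `X`. -/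
noncomputable def zetaSeries (g : X → ℕ) (s : ℂ) : ℂ := ∑' x, (g x : ℂ) ^ (-s)

/-- Absolute convergence of `∑_x g(x)^{-s}`. -/
def ZetaSummable (g : X → ℕ) (s : ℂ) : Prop := Summable fun x => (g x : ℂ) ^ (-s)

theorem zetaSeries_congr {g : X → ℕ} {h : Y → ℕ} (e : X ≃ Y) (H : ∀ x, h (e x) = g x) (s : ℂ) :
    zetaSeries g s = zetaSeries h s := by
  unfold zetaSeries
  rw [← e.tsum_eq]
  simp [H]

theorem zetaSeries_of_bijective {g : X → ℕ} {h : Y → ℕ} (f : X → Y) (hf : f.Bijective)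
    (H : ∀ x, h (f x) = g x) (s : ℂ) : zetaSeries g s = zetaSeries h s :=
  zetaSeries_congr (Equiv.ofBijective f hf) H s

theorem zetaSummable_congr {g : X → ℕ} {h : Y → ℕ} (e : X ≃ Y) (H : ∀ x, h (e x) = g x) (s : ℂ) :
    ZetaSummable g s ↔ ZetaSummable h s := by
  unfold ZetaSummable
  rw [← e.summable_iff]
  simp [Function.comp_def, H]

theorem ZetaSummable.comp {g : X → ℕ} {s : ℂ} (hg : ZetaSummable g s) (f : Y → X)
    (hf : f.Injective) : ZetaSummable (fun y => g (f y)) s :=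
  Summable.comp_injective hg hf

theorem ZetaSummable.norm_cpow {g : X → ℕ} {s : ℂ} (hg : ZetaSummable g s) :
    Summable fun x => ‖(g x : ℂ) ^ (-s)‖ :=
  Summable.norm hg

theorem ZetaSummable.prod {g : X → ℕ} {h : Y → ℕ} {s : ℂ} (hg : ZetaSummable g s)
    (hh : ZetaSummable h s) : ZetaSummable (fun p : X × Y => g p.1 * h p.2) s := by
  have := summable_mul_of_summable_norm hg.norm_cpow hh.norm_cpow
  simpa only [ZetaSummable, Nat.cast_mul, Complex.natCast_mul_natCast_cpow] using this

theorem zetaSeries_prod {g : X → ℕ} {h : Y → ℕ} {s : ℂ} (hg : ZetaSummable g s)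
    (hh : ZetaSummable h s) :
    zetaSeries (fun p : X × Y => g p.1 * h p.2) s = zetaSeries g s * zetaSeries h s := by
  have := tsum_mul_tsum_of_summable_norm hg.norm_cpow hh.norm_cpow
  simpa only [zetaSeries, Nat.cast_mul, Complex.natCast_mul_natCast_cpow] using this.symm

theorem zetaSeries_smul (c : ℕ) (g : X → ℕ) (s : ℂ) :
    zetaSeries (fun x => c * g x) s = (c : ℂ) ^ (-s) * zetaSeries g s := by
  simp only [zetaSeries, Nat.cast_mul, Complex.natCast_mul_natCast_cpow, tsum_mul_left]

theorem ZetaSummable.smul {g : X → ℕ} {s : ℂ} (hg : ZetaSummable g s) (c : ℕ) :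
    ZetaSummable (fun x => c * g x) s := by
  simp only [ZetaSummable, Nat.cast_mul, Complex.natCast_mul_natCast_cpow]
  exact Summable.mul_left _ hg

theorem ZetaSummable.of_smul {g : X → ℕ} {s : ℂ} {c : ℕ} (hc : c ≠ 0)
    (hg : ZetaSummable (fun x => c * g x) s) : ZetaSummable g s := by
  simp only [ZetaSummable, Nat.cast_mul, Complex.natCast_mul_natCast_cpow] at hg
  refine (summable_mul_left_iff ?_).1 hg
  simp [Complex.cpow_eq_zero_iff, hc]

/-- The slice over `y` is `g` multiplied by the nonzero constant `h y`. This lets convergence of a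
factor be deduced from convergence of a product series. -/
theorem ZetaSummable.fst {g : X → ℕ} {h : Y → ℕ} {s : ℂ}
    (H : ZetaSummable (fun p : X × Y => g p.1 * h p.2) s) (y : Y) (hy : h y ≠ 0) :
    ZetaSummable g s := by
  have := H.comp (fun x => (x, y)) fun _ _ hab => (Prod.ext_iff.1 hab).1
  simp only [mul_comm _ (h y)] at this
  exact this.of_smul hy

theorem ZetaSummable.snd {g : X → ℕ} {h : Y → ℕ} {s : ℂ}
    (H : ZetaSummable (fun p : X × Y => g p.1 * h p.2) s) (x : X) (hx : g x ≠ 0) :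
    ZetaSummable h s :=
  (H.comp (fun y => (x, y)) fun _ _ hab => (Prod.ext_iff.1 hab).2).of_smul hx

theorem zetaSeries_subtype_add_compl {g : X → ℕ} {s : ℂ} (hg : ZetaSummable g s) (T : X → Prop) :
    zetaSeries (fun x : {x // T x} => g x) s + zetaSeries (fun x : {x // ¬ T x} => g x) s =
      zetaSeries g s :=
  Summable.tsum_subtype_add_tsum_subtype_compl hg {x | T x}

theorem zetaSummable_sum {g : X → ℕ} {h : Y → ℕ} {s : ℂ} (hg : ZetaSummable g s)
    (hh : ZetaSummable h s) : ZetaSummable (Sum.elim g h) s := by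
  have := (HasSum.sum (f := fun x : X ⊕ Y => ((Sum.elim g h x : ℕ) : ℂ) ^ (-s)) hg.hasSum hh.hasSum)
  exact this.summable

theorem zetaSeries_sum {g : X → ℕ} {h : Y → ℕ} {s : ℂ} (hg : ZetaSummable g s)
    (hh : ZetaSummable h s) : zetaSeries (Sum.elim g h) s = zetaSeries g s + zetaSeries h s :=
  (HasSum.sum (f := fun x : X ⊕ Y => ((Sum.elim g h x : ℕ) : ℂ) ^ (-s))
    hg.hasSum hh.hasSum).tsum_eq

theorem zetaSeries_unique [Unique X] {g : X → ℕ} (hg : g default = 1) (s : ℂ) :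
    zetaSeries g s = 1 := by
  simp [zetaSeries, tsum_fintype, hg]

theorem zetaSummable_sigma {Γ : Type*} [Finite Γ] {F : Γ → Type*} {g : (Σ i, F i) → ℕ} {s : ℂ}
    (H : ∀ i, ZetaSummable (fun x : F i => g ⟨i, x⟩) s) : ZetaSummable g s := by
  have := Fintype.ofFinite Γ
  refine Summable.of_norm ((summable_sigma_of_nonneg fun _ => norm_nonneg _).2
    ⟨fun i => (H i).norm_cpow, (hasSum_fintype _).summable⟩)

theorem zetaSeries_sigma {Γ : Type*} [Fintype Γ] {F : Γ → Type*} {g : (Σ i, F i) → ℕ} {s : ℂ}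
    (H : ∀ i, ZetaSummable (fun x : F i => g ⟨i, x⟩) s) :
    zetaSeries g s = ∑ i, zetaSeries (fun x : F i => g ⟨i, x⟩) s := by
  unfold zetaSeries
  rw [Summable.tsum_sigma (zetaSummable_sigma H), tsum_fintype]

/-- The zeta series of a size function is the `L`-series of its fibre cardinalities. -/
theorem LSeriesHasSum_of_zetaSummable {g : X → ℕ} (hpos : ∀ x, g x ≠ 0) {s : ℂ}
    (hg : ZetaSummable g s) {a : ℕ → ℂ} (ha : ∀ n ≠ 0, a n = Nat.card {x // g x = n}) :
    LSeriesSummable a s ∧ LSeries a s = zetaSeries g s := by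
  have h1 : HasSum (fun y : Σ n, {x // g x = n} => ((g y.2.1 : ℕ) : ℂ) ^ (-s))
      (zetaSeries g s) := (Equiv.sigmaFiberEquiv g).hasSum_iff.2 hg.hasSum
  have h2 : HasSum (LSeries.term a s) (zetaSeries g s) := by
    refine h1.sigma fun n => ?_
    rcases eq_or_ne n 0 with rfl | hn
    · have : IsEmpty {x // g x = 0} := ⟨fun x => hpos _ x.2⟩
      simp
    have hs : Summable fun x : {x // g x = n} => (n : ℂ) ^ (-s) := by
      have := hg.comp (fun x : {x // g x = n} => x.1) Subtype.val_injective
      refine Summable.congr this fun x => ?_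
      simp only [x.2]
    -- The series is constant and nonzero on a fibre, so summability forces the fibre to be finite
    -- and `Nat.card` is its true cardinality.
    have hfin : Finite {x // g x = n} := by
      by_contra hinf
      rw [not_finite_iff_infinite] at hinf
      simp [summable_const_iff, Complex.cpow_eq_zero_iff, hn] at hs
    have := Fintype.ofFinite {x // g x = n}
    have h3 := hasSum_fintype fun x : {x // g x = n} => ((g x.1 : ℕ) : ℂ) ^ (-s)
    convert h3 using 1
    rw [Finset.sum_congr rfl fun x _ => by rw [x.2]]
    simp [LSeries.term, hn, ha n hn, Complex.cpow_neg, div_eq_mul_inv]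
  exact ⟨h2.summable, h2.tsum_eq⟩

/-- The only property of the Burnside bijection that matters for size functions: it preserves the
orbit of the fixed point. -/
theorem burnside_fst {Γ : Type*} [Group Γ] [MulAction Γ X] (x : Σ γ : Γ, MulAction.fixedBy X γ) :
    (MulAction.sigmaFixedByEquivOrbitsProdGroup Γ X x).1 = Quotient.mk _ x.2.1 := by
  rfl

/-- Burnside's lemma for zeta series. -/
theorem zetaSeries_orbits {Γ : Type*} [Group Γ] [Fintype Γ] [MulAction Γ X] {g : X → ℕ} {s : ℂ}
    (hg : ZetaSummable g s) {h : Quotient (MulAction.orbitRel Γ X) → ℕ}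
    (hh : ∀ x, h (Quotient.mk _ x) = g x) :
    ZetaSummable h s ∧ Fintype.card Γ * zetaSeries h s =
      ∑ γ : Γ, zetaSeries (fun x : MulAction.fixedBy X γ => g x) s := by
  obtain ⟨e, he⟩ : ∃ e : (Σ γ : Γ, MulAction.fixedBy X γ) ≃
      Quotient (MulAction.orbitRel Γ X) × Γ, ∀ x, (e x).1 = Quotient.mk _ x.2.1 :=
    ⟨_, burnside_fst⟩
  have hs : ∀ γ : Γ, ZetaSummable (fun x : MulAction.fixedBy X γ => g x) s := fun γ =>
    hg.comp _ Subtype.val_injective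
  have hone : ZetaSummable (fun _ : Γ => 1) s := (hasSum_fintype _).summable
  have hz : zetaSeries (fun _ : Γ => 1) s = Fintype.card Γ := by simp [zetaSeries]
  have H1 := zetaSummable_sigma (g := fun x : Σ γ : Γ, MulAction.fixedBy X γ => g x.2.1) hs
  have he' : ∀ x, h (e x).1 * 1 = g x.2.1 := fun x => by rw [he, hh, mul_one]
  -- The group carries the constant weight 1, so the pairs (orbit, group element) have the size of
  -- the orbit. The slice at `1` gives convergence over orbits.
  have H2 : ZetaSummable h s := ZetaSummable.fst (h := fun _ : Γ => 1)
    ((zetaSummable_congr e he' s).1 H1) 1 one_ne_zero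
  refine ⟨H2, ?_⟩
  rw [← zetaSeries_sigma (g := fun x : Σ γ : Γ, MulAction.fixedBy X γ => g x.2.1) hs,
    zetaSeries_congr (h := fun p : Quotient (MulAction.orbitRel Γ X) × Γ => h p.1 * 1) e he',
    zetaSeries_prod H2 hone, hz, mul_comm]

theorem zetaSummable_pnat {s : ℂ} (hs : 1 < s.re) : ZetaSummable (fun n : ℕ+ => (n : ℕ)) s := by
  have := (Complex.summable_one_div_nat_cpow.2 hs).comp_injective PNat.coe_injective
  refine this.congr fun n => ?_
  simp [Complex.cpow_neg]

theorem zetaSeries_pnat {s : ℂ} (hs : 1 < s.re) :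
    zetaSeries (fun n : ℕ+ => (n : ℕ)) s = riemannZeta s := by
  rw [zeta_eq_tsum_one_div_nat_add_one_cpow hs, zetaSeries,
    ← Equiv.pnatEquivNat.symm.tsum_eq]
  refine tsum_congr fun n => ?_
  simp [Complex.cpow_neg, Nat.succPNat]

end ZetaSeries

end SubformZeta

namespace SubformZeta

/-! ### Sums over pairs of coprime positive integers -/

section CoprimePairs

/-- Pairs of coprime positive integers satisfying `T`. -/
abbrev CoprimePair (T : ℕ → ℕ → Prop) : Type :=
  {p : ℕ+ × ℕ+ // (p.1 : ℕ).Coprime p.2 ∧ T p.1 p.2}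

/-- `∑ (ab)^{-s}` over coprime pairs satisfying `T`. -/
noncomputable def coprimeZeta (T : ℕ → ℕ → Prop) (s : ℂ) : ℂ :=
  zetaSeries (fun p : CoprimePair T => (p.1.1 : ℕ) * p.1.2) s

variable {s : ℂ} (T U : ℕ → ℕ → Prop)

theorem zetaSummable_coprimePair (hs : 1 < s.re) :
    ZetaSummable (fun p : CoprimePair T => (p.1.1 : ℕ) * p.1.2) s :=
  ((zetaSummable_pnat hs).prod (zetaSummable_pnat hs)).comp _ Subtype.val_injective

theorem coprimeZeta_congr {T U : ℕ → ℕ → Prop} (h : ∀ a b, a.Coprime b → (T a b ↔ U a b)) :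
    coprimeZeta T s = coprimeZeta U s := by
  unfold coprimeZeta
  refine zetaSeries_congr (Equiv.subtypeEquivRight fun (p : ℕ+ × ℕ+) =>
    and_congr_right fun hp => h (p.1 : ℕ) p.2 hp) (fun _ => ?_) s
  rfl

theorem coprimeZeta_add (hs : 1 < s.re) :
    coprimeZeta (fun a b => T a b ∧ U a b) s + coprimeZeta (fun a b => T a b ∧ ¬ U a b) s =
      coprimeZeta T s := by
  rw [coprimeZeta, coprimeZeta, coprimeZeta,
    ← zetaSeries_subtype_add_compl (zetaSummable_coprimePair T hs) fun p => U p.1.1 p.1.2]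
  congr 1
  all_goals
    refine zetaSeries_of_bijective (fun p => ⟨⟨p.1, p.2.1, p.2.2.1⟩, p.2.2.2⟩) ⟨?_, ?_⟩
      (fun _ => ?_) s
    · intro p q h
      simpa [Subtype.ext_iff] using h
    · exact fun p => ⟨⟨p.1.1, p.1.2.1, p.1.2.2, p.2⟩, rfl⟩
    · rfl

theorem coprimeZeta_swap : coprimeZeta (fun a b => T b a) s = coprimeZeta T s := by
  unfold coprimeZeta
  refine zetaSeries_of_bijective (fun p => ⟨p.1.swap, p.2.1.symm, p.2.2⟩) ⟨?_, ?_⟩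
    (fun _ => ?_) s
  · intro p q h
    simpa [Subtype.ext_iff] using h
  · exact fun p => ⟨⟨p.1.swap, p.2.1.symm, p.2.2⟩, rfl⟩
  · exact mul_comm _ _

/-- Dividing the first entry by a prime `p` that divides it. -/
theorem coprimeZeta_dvd_left {p : ℕ} (hp : p.Prime) (hT : ∀ a b, T (p * a) b ↔ T a b) :
    coprimeZeta (fun a b => T a b ∧ p ∣ a) s =
      (p : ℂ) ^ (-s) * coprimeZeta (fun a b => T a b ∧ ¬ p ∣ b) s := by
  rw [coprimeZeta, coprimeZeta, ← zetaSeries_smul]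
  symm
  -- Coprimality of `pa` and `b` means that of `a` and `b` together with `p ∤ b`; after the division
  -- nothing is required of `p` and `a`, so no condition on `a` survives on the right.
  refine zetaSeries_of_bijective
    (fun q => ⟨(Nat.toPNat p hp.pos * q.1.1, q.1.2),
      Nat.Coprime.mul_left ((Nat.Prime.coprime_iff_not_dvd hp).2 q.2.2.2) q.2.1,
      (hT _ _).2 q.2.2.1, dvd_mul_right _ _⟩) ⟨?_, ?_⟩ (fun x => ?_) s
  · rintro ⟨⟨a, b⟩, h⟩ ⟨⟨a', b'⟩, h'⟩ e
    simpa only [Subtype.mk.injEq, Prod.mk.injEq, mul_right_inj] using e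
  · rintro ⟨⟨a, b⟩, h1, h2, h3⟩
    obtain ⟨c, hc⟩ := h3
    have hc0 : 0 < c := Nat.pos_of_ne_zero fun h => a.pos.ne' (by simp [h] at hc)
    simp only [hc] at h1 h2
    refine ⟨⟨(⟨c, hc0⟩, b), h1.coprime_mul_left, (hT _ _).1 h2, fun hb => ?_⟩, ?_⟩
    · exact (Nat.Prime.coprime_iff_not_dvd hp).1 h1.coprime_mul_right hb
    · apply Subtype.ext
      refine Prod.ext (PNat.eq ?_) rfl
      exact hc.symm
  · exact mul_assoc _ _ _

variable {T}

theorem one_add_prime_cpow_ne_zero {p : ℕ} (hp : p.Prime) (hs : 1 < s.re) :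
    1 + (p : ℂ) ^ (-s) ≠ 0 := by
  intro h
  have h1 : ‖(p : ℂ) ^ (-s)‖ = 1 := by
    rw [← eq_neg_iff_add_eq_zero] at h
    have := congrArg norm h
    simpa using this.symm
  rw [Complex.norm_natCast_cpow_of_pos hp.pos, Complex.neg_re] at h1
  have h2 : (p : ℝ) ^ (-s.re) < 1 :=
    Real.rpow_lt_one_of_one_lt_of_neg (by exact_mod_cast hp.one_lt) (by linarith)
  linarith

/-- Put `y = p^{-s}` and let `A`, `A'`, `B`, `B'` be the parts with `p ∣ a`, `p ∤ a`, `p ∣ b`, `p ∤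
b`. Then `A = y B'`, `B = y A'` and `A + A' = B + B' = W`, a linear system of determinant `1 - y²`.
Since `p` never divides both entries, its solution determines the remaining sums. -/
theorem coprimeZeta_not_dvd_right {p : ℕ} (hp : p.Prime) (hT : ∀ a b, T (p * a) b ↔ T a b)
    (hT' : ∀ a b, T a (p * b) ↔ T a b) (hs : 1 < s.re) :
    (1 + (p : ℂ) ^ (-s)) * coprimeZeta (fun a b => T a b ∧ ¬ p ∣ b) s = coprimeZeta T s ∧
    (1 + (p : ℂ) ^ (-s)) * coprimeZeta (fun a b => T a b ∧ ¬ p ∣ a ∧ ¬ p ∣ b) s =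
      (1 - (p : ℂ) ^ (-s)) * coprimeZeta T s ∧
    (1 + (p : ℂ) ^ (-s)) * coprimeZeta (fun a b => T a b ∧ (p ∣ a ∨ p ∣ b)) s =
      2 * (p : ℂ) ^ (-s) * coprimeZeta T s := by
  set y := (p : ℂ) ^ (-s)
  have e1 : coprimeZeta (fun a b => T a b ∧ p ∣ a) s =
      y * coprimeZeta (fun a b => T a b ∧ ¬ p ∣ b) s := coprimeZeta_dvd_left T hp hT
  have e2 : coprimeZeta (fun a b => T a b ∧ p ∣ b) s =
      y * coprimeZeta (fun a b => T a b ∧ ¬ p ∣ a) s := by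
    rw [← coprimeZeta_swap, coprimeZeta_dvd_left (fun a b => T b a) hp fun a b => hT' b a,
      ← coprimeZeta_swap]
  have e3 := coprimeZeta_add T (fun a _ => p ∣ a) hs
  have e4 := coprimeZeta_add T (fun _ b => p ∣ b) hs
  have e5 := coprimeZeta_add T (fun a b => p ∣ a ∨ p ∣ b) hs
  have e6 := coprimeZeta_add (fun a b => T a b ∧ ¬ p ∣ b) (fun a _ => p ∣ a) hs
  have e7 : coprimeZeta (fun a b => (T a b ∧ ¬ p ∣ b) ∧ p ∣ a) s =
      coprimeZeta (fun a b => T a b ∧ p ∣ a) s := coprimeZeta_congr fun a b hab => by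
    have : p ∣ a → ¬ p ∣ b := fun h h' => hp.one_lt.ne' (Nat.dvd_one.1 (hab ▸ Nat.dvd_gcd h h'))
    tauto
  have e8 : coprimeZeta (fun a b => (T a b ∧ ¬ p ∣ b) ∧ ¬ p ∣ a) s =
      coprimeZeta (fun a b => T a b ∧ ¬ p ∣ a ∧ ¬ p ∣ b) s := coprimeZeta_congr fun a b _ => by tauto
  have e9 : coprimeZeta (fun a b => T a b ∧ ¬ (p ∣ a ∨ p ∣ b)) s =
      coprimeZeta (fun a b => T a b ∧ ¬ p ∣ a ∧ ¬ p ∣ b) s := coprimeZeta_congr fun a b _ => by tauto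
  rw [e7, e8] at e6
  rw [e9] at e5
  have hy := one_add_prime_cpow_ne_zero hp hs
  change 1 + y ≠ 0 at hy
  set A := coprimeZeta (fun a b => T a b ∧ p ∣ a) s
  set A' := coprimeZeta (fun a b => T a b ∧ ¬ p ∣ a) s
  set B := coprimeZeta (fun a b => T a b ∧ p ∣ b) s
  set B' := coprimeZeta (fun a b => T a b ∧ ¬ p ∣ b) s
  set W := coprimeZeta T s
  have e10 : (1 + y) * B' = W := by
    -- Elimination yields `(1 - y)(1 + y) B' = (1 - y) W`, so the factor `1 - y` has to be
    -- cancelled; it is nonzero because `|y| < 1`.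
    by_cases h1 : 1 - y = 0
    · have hy1 : y = 1 := (sub_eq_zero.1 h1).symm
      have h2 : ‖y‖ < 1 := by
        change ‖(p : ℂ) ^ (-s)‖ < 1
        rw [Complex.norm_natCast_cpow_of_pos hp.pos, Complex.neg_re]
        exact Real.rpow_lt_one_of_one_lt_of_neg (by exact_mod_cast hp.one_lt) (by linarith)
      simp [hy1] at h2
    · apply mul_left_cancel₀ h1
      linear_combination e4 - y * e3 - e2 + y * e1
  refine ⟨e10, ?_, ?_⟩
  · linear_combination (1 + y) * e6 + (1 - y) * e10 - (1 + y) * e1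
  · linear_combination (1 + y) * e5 - (1 + y) * e6 - (1 - y) * e10 + (1 + y) * e1

/-- Every pair of positive integers is uniquely `(ga, gb)` with `a`, `b` coprime, and the common
divisor `g` contributes `g²` to the product of the entries. -/
theorem riemannZeta_two_mul_mul_coprimeZeta (hs : 1 < s.re) :
    riemannZeta (2 * s) * coprimeZeta (fun _ _ => True) s = riemannZeta s ^ 2 := by
  have h2 : 1 < (2 * s).re := by simp; linarith
  have hsq : ∀ n : ℕ+, ((n : ℕ) : ℂ) ^ (-(2 * s)) = (((n : ℕ) * (n : ℕ) : ℕ) : ℂ) ^ (-s) := by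
    intro n
    rw [Nat.cast_mul, Complex.natCast_mul_natCast_cpow, ← Complex.cpow_add _ _ (by simp)]
    congr 1; ring
  have e1 : riemannZeta (2 * s) = zetaSeries (fun n : ℕ+ => (n : ℕ) * n) s := by
    rw [← zetaSeries_pnat h2]
    exact tsum_congr hsq
  have s1 : ZetaSummable (fun n : ℕ+ => (n : ℕ) * n) s := (zetaSummable_pnat h2).congr hsq
  rw [e1, coprimeZeta, ← zetaSeries_prod s1 (zetaSummable_coprimePair _ hs), sq,
    ← zetaSeries_pnat hs, ← zetaSeries_prod (zetaSummable_pnat hs) (zetaSummable_pnat hs)]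
  refine zetaSeries_of_bijective
    (fun q => (q.1 * q.2.1.1, q.1 * q.2.1.2)) ⟨?_, ?_⟩ (fun x => ?_) s
  · rintro ⟨g, ⟨⟨a, b⟩, h, _⟩⟩ ⟨g', ⟨⟨a', b'⟩, h', _⟩⟩ e
    rw [Prod.mk.injEq] at e
    have hg : (g : ℕ) = g' := by
      have e1 : ((g : ℕ) * a).gcd (g * b) = g := by rw [Nat.gcd_mul_left, h]; simp
      have e2 : ((g' : ℕ) * a').gcd (g' * b') = g' := by rw [Nat.gcd_mul_left, h']; simp
      rw [← e1, ← e2]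
      simp only [← PNat.mul_coe, e.1, e.2]
    obtain rfl := PNat.eq hg
    simp only [mul_right_inj] at e
    simp [e.1, e.2]
  · rintro ⟨a, b⟩
    have h0 : 0 < (a : ℕ).gcd b := Nat.gcd_pos_of_pos_left _ a.pos
    obtain ⟨a', b', hco, ha, hb⟩ := Nat.exists_coprime (a : ℕ) b
    have ha' : 0 < a' := Nat.pos_of_ne_zero fun h => a.pos.ne' (by rw [ha, h, zero_mul])
    have hb' : 0 < b' := Nat.pos_of_ne_zero fun h => b.pos.ne' (by rw [hb, h, zero_mul])
    refine ⟨(⟨_, h0⟩, ⟨(⟨a', ha'⟩, ⟨b', hb'⟩), hco, trivial⟩), Prod.ext (PNat.eq ?_) (PNat.eq ?_)⟩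
    · rw [PNat.mul_coe, mul_comm]; exact ha.symm
    · rw [PNat.mul_coe, mul_comm]; exact hb.symm
  · simp only [PNat.mul_coe]
    ring

end CoprimePairs

end SubformZeta

namespace SubformZeta

/-! ### The rings `ℤ[i]` and `ℤ[ω]` -/

section Ring

/-- The ring `ℤ[ω]` with `ω² = -1 + bω`; its norm form is `x² + bxy + y²`. -/
abbrev IntRing (b : ℤ) : Type := QuadraticAlgebra ℤ (-1) b

/-- The fraction field of `IntRing b`. -/
abbrev RatField (b : ℤ) : Type := QuadraticAlgebra ℚ (-1) (b : ℚ)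

variable {b : ℤ}

/-- The inclusion of `IntRing b` in its fraction field. -/
def incl (b : ℤ) : IntRing b →+* RatField b where
  toFun z := ⟨z.re, z.im⟩
  map_one' := by ext <;> simp [QuadraticAlgebra.re_one, QuadraticAlgebra.im_one]
  map_zero' := by ext <;> simp
  map_mul' x y := by ext <;> simp
  map_add' x y := by ext <;> simp

@[simp] theorem incl_re (z : IntRing b) : (incl b z).re = z.re := rfl

@[simp] theorem incl_im (z : IntRing b) : (incl b z).im = z.im := rfl

theorem incl_injective : Function.Injective (incl b) := by
  intro x y h
  have h1 := congrArg QuadraticAlgebra.re h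
  have h2 := congrArg QuadraticAlgebra.im h
  simp only [incl_re, incl_im, Int.cast_inj] at h1 h2
  exact QuadraticAlgebra.ext h1 h2

theorem incl_star (z : IntRing b) : incl b (star z) = star (incl b z) := by
  ext <;> simp

theorem incl_norm (z : IntRing b) : (incl b z).norm = (z.norm : ℤ) := by
  simp [QuadraticAlgebra.norm_def]

/-- The norm as a natural number. -/
def nrm (z : IntRing b) : ℕ := z.norm.natAbs

theorem nrm_mul (x y : IntRing b) : nrm (x * y) = nrm x * nrm y := by
  simp [nrm, Int.natAbs_mul]

theorem nrm_star (x : IntRing b) : nrm (star x) = nrm x := by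
  simp [nrm]

theorem isUnit_iff_nrm {x : IntRing b} : IsUnit x ↔ nrm x = 1 := by
  rw [QuadraticAlgebra.isUnit_iff_norm_isUnit, Int.isUnit_iff_natAbs_eq, nrm]

variable [hb : Fact (b = 0 ∨ b = 1)]

instance ratFieldFact : Fact (∀ r : ℚ, r ^ 2 ≠ -1 + (b : ℚ) * r) := ⟨fun r h => by
  rcases hb.out with rfl | rfl
  · push_cast at h
    nlinarith [sq_nonneg r]
  · push_cast at h
    nlinarith [sq_nonneg (2 * r - 1)]⟩

instance intRingIsDomain : IsDomain (IntRing b) := incl_injective.isDomain (incl b)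

theorem norm_eq_zero {x : RatField b} : x.norm = 0 ↔ x = 0 :=
  QuadraticAlgebra.norm_eq_zero_iff_eq_zero

theorem norm_nonneg' (z : IntRing b) : 0 ≤ z.norm := by
  rw [QuadraticAlgebra.norm_def]
  rcases hb.out with rfl | rfl
  · nlinarith [sq_nonneg z.re, sq_nonneg z.im]
  · nlinarith [sq_nonneg (z.re + z.im), sq_nonneg z.re, sq_nonneg z.im]

theorem coe_nrm (z : IntRing b) : (nrm z : ℤ) = z.norm := Int.natAbs_of_nonneg (norm_nonneg' z)

theorem norm_incl (z : IntRing b) : (incl b z).norm = nrm z := by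
  rw [incl_norm, ← coe_nrm, Int.cast_natCast]

theorem nrm_eq_zero {x : IntRing b} : nrm x = 0 ↔ x = 0 := by
  rw [← Nat.cast_eq_zero (R := ℚ), ← norm_incl, norm_eq_zero, map_eq_zero_iff _ incl_injective]

theorem mul_star_eq (x : IntRing b) : x * star x = (nrm x : IntRing b) := by
  rw [← QuadraticAlgebra.algebraMap_norm_eq_mul_star, ← coe_nrm]
  simp

/-- Division with remainder: rounding both coordinates of `x / y` leaves a remainder with
coordinates at most `1/2` in absolute value, whose norm is at most `3/4`. -/
theorem exists_nrm_sub_lt (x y : IntRing b) (hy : y ≠ 0) : ∃ q, nrm (x - q * y) < nrm y := by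
  have hn : 0 < nrm y := Nat.pos_of_ne_zero (mt nrm_eq_zero.1 hy)
  obtain ⟨n, hndef⟩ : ∃ n : ℤ, n = nrm y := ⟨_, rfl⟩
  have hn' : 0 < n := by omega
  set z := x * star y
  -- The floor of `t/n + 1/2`, the nearest integer to `t/n`, for both coordinates `t` of `z = x
  -- conj(y)`; note that `x / y = z / n`.
  let q : IntRing b := ⟨(2 * z.re + n) / (2 * n), (2 * z.im + n) / (2 * n)⟩
  refine ⟨q, ?_⟩
  -- Multiplication by `conj(y)` replaces the remainder by `z - nq`, whose coordinates are explicit.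
  have key : nrm (x - q * y) * nrm y = nrm (z - (n : IntRing b) * q) := by
    rw [← nrm_star y, ← nrm_mul]
    congr 1
    have := mul_star_eq y
    rw [hndef, Int.cast_natCast, ← this]
    ring
  have hre : (z - (n : IntRing b) * q).re = z.re - n * q.re := by simp
  have him : (z - (n : IntRing b) * q).im = z.im - n * q.im := by simp
  have h1 := Int.emod_add_mul_ediv (2 * z.re + n) (2 * n)
  have h2 := Int.emod_nonneg (2 * z.re + n) (b := 2 * n) (by omega)
  have h3 := Int.emod_lt_of_pos (2 * z.re + n) (b := 2 * n) (by omega)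
  have h4 := Int.emod_add_mul_ediv (2 * z.im + n) (2 * n)
  have h5 := Int.emod_nonneg (2 * z.im + n) (b := 2 * n) (by omega)
  have h6 := Int.emod_lt_of_pos (2 * z.im + n) (b := 2 * n) (by omega)
  have key2 : ((nrm (z - (n : IntRing b) * q) : ℕ) : ℤ) < n * n := by
    rw [coe_nrm, QuadraticAlgebra.norm_def, hre, him]
    have b1 : |z.re - n * q.re| * 2 ≤ n := by
      rw [← abs_two, ← abs_mul, abs_le]
      simp only [q]
      constructor <;> linarith
    have b2 : |z.im - n * q.im| * 2 ≤ n := by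
      rw [← abs_two, ← abs_mul, abs_le]
      simp only [q]
      constructor <;> linarith
    set u := z.re - n * q.re
    set v := z.im - n * q.im
    have hu := sq_abs u
    have hv := sq_abs v
    have huv : u * v ≤ |u| * |v| := by rw [← abs_mul]; exact le_abs_self _
    have := abs_nonneg u
    have := abs_nonneg v
    have c1 : 4 * |u| ^ 2 ≤ n ^ 2 := by nlinarith
    have c2 : 4 * |v| ^ 2 ≤ n ^ 2 := by nlinarith
    have c3 : 4 * (|u| * |v|) ≤ n ^ 2 := by nlinarith
    rcases hb.out with rfl | rfl <;> nlinarith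
  have key3 : nrm (x - q * y) * nrm y < nrm y * nrm y := by
    rw [key]; zify; rw [← hndef]; exact key2
  exact lt_of_mul_lt_mul_right key3 (Nat.zero_le _)

instance intRingPrincipal : IsPrincipalIdealRing (IntRing b) where
  principal I := by
    by_cases hI : I = ⊥
    · exact hI ▸ bot_isPrincipal
    obtain ⟨x, hx, hx0⟩ := Submodule.exists_mem_ne_zero_of_ne_bot hI
    obtain ⟨y, ⟨hy, hy0⟩, hmin⟩ : ∃ y, (y ∈ I ∧ y ≠ 0) ∧ ∀ z ∈ I, z ≠ 0 → nrm y ≤ nrm z := by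
      have hne : {z | z ∈ I ∧ z ≠ 0}.Nonempty := ⟨x, hx, hx0⟩
      exact ⟨Function.argminOn nrm _ hne, Function.argminOn_mem nrm _ hne, fun z hz hz0 =>
        Function.argminOn_le nrm _ (show z ∈ {z | z ∈ I ∧ z ≠ 0} from ⟨hz, hz0⟩)⟩
    refine ⟨⟨y, le_antisymm (fun z hz => ?_) ((Submodule.span_singleton_le_iff_mem _ _).2 hy)⟩⟩
    obtain ⟨q, hq⟩ := exists_nrm_sub_lt z y hy0
    by_cases h0 : z - q * y = 0
    · exact Submodule.mem_span_singleton.2 ⟨q, (sub_eq_zero.1 h0).symm⟩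
    · exact absurd hq (not_lt.2 (hmin _ (I.sub_mem hz (I.mul_mem_left q hy)) h0))

theorem absNorm_span (x : IntRing b) : Ideal.absNorm (Ideal.span {x}) = nrm x := by
  rw [Ideal.absNorm_span_singleton, nrm, Algebra.norm_apply,
    ← QuadraticAlgebra.det_toLinearMap_eq_norm]
  rfl

theorem absNorm_eq_index (I : Ideal (IntRing b)) : Ideal.absNorm I = I.toAddSubgroup.index := by
  rw [Ideal.absNorm_apply, Submodule.cardQuot_apply]
  rfl

end Ring

end SubformZeta

namespace SubformZeta

/-! ### Subgroups of finite index in `ℤ × ℤ` -/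

section Hermite

/-- Subgroups of finite index. -/
abbrev FiniteIndexSubgroup (A : Type*) [AddGroup A] : Type _ := {K : AddSubgroup A // K.index ≠ 0}

theorem exists_eq_zmultiples (H : AddSubgroup ℤ) {n : ℤ} (hn : n ∈ H) (hn0 : n ≠ 0) :
    ∃ a : ℕ+, ∀ x, x ∈ H ↔ (a : ℤ) ∣ x := by
  obtain ⟨g, rfl⟩ := Int.subgroup_cyclic H
  simp only [AddSubgroup.mem_closure_singleton, smul_eq_mul] at hn ⊢
  have hg : g ≠ 0 := by
    rintro rfl
    obtain ⟨k, hk⟩ := hn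
    exact hn0 (by simpa using hk.symm)
  refine ⟨⟨g.natAbs, Int.natAbs_pos.2 hg⟩, fun x => ?_⟩
  rw [PNat.mk_coe, Int.natAbs_dvd]
  exact ⟨fun ⟨k, hk⟩ => ⟨k, by rw [← hk, mul_comm]⟩, fun ⟨k, hk⟩ => ⟨k, by rw [hk, mul_comm]⟩⟩

/-- The subgroup of `ℤ × ℤ` with Hermite normal form `(a, r), (0, d)`. -/
def hermite (a d : ℕ+) (r : ℤ) : AddSubgroup (ℤ × ℤ) where
  carrier := {z | ∃ k, z.1 = a * k ∧ (d : ℤ) ∣ z.2 - r * k}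
  zero_mem' := ⟨0, by simp, by simp⟩
  add_mem' := by
    rintro x y ⟨k, h1, h2⟩ ⟨l, h3, h4⟩
    refine ⟨k + l, by simp [h1, h3, mul_add], ?_⟩
    have := dvd_add h2 h4
    rwa [show x.2 - r * k + (y.2 - r * l) = (x + y).2 - r * (k + l) by simp; ring] at this
  neg_mem' := by
    rintro x ⟨k, h1, h2⟩
    refine ⟨-k, by simp [h1], ?_⟩
    have := (dvd_neg (α := ℤ)).2 h2
    rwa [show -(x.2 - r * k) = (-x).2 - r * (-k) by simp; ring] at this

theorem index_ker_of_surjective {A : Type*} [AddCommGroup A] {n : ℕ}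
    (f : A →+ ZMod n) (hf : Function.Surjective f) : f.ker.index = n := by
  rw [AddSubgroup.index_ker, AddMonoidHom.range_eq_top.2 hf, AddSubgroup.card_top,
    Nat.card_zmod]

/-- `(x, y) ↦ (ax, cy)`. -/
def diagHom (a c : ℤ) : ℤ × ℤ →+ ℤ × ℤ :=
  (AddMonoidHom.mulLeft a).prodMap (AddMonoidHom.mulLeft c)

@[simp] theorem diagHom_apply (a c : ℤ) (z : ℤ × ℤ) : diagHom a c z = (a * z.1, c * z.2) := rfl

theorem diagHom_injective {a c : ℤ} (ha : a ≠ 0) (hc : c ≠ 0) :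
    Function.Injective (diagHom a c) := by
  intro x y h
  simpa [Prod.ext_iff, ha, hc] using h

theorem index_range_diagHom_one (a : ℕ) : (diagHom a 1).range.index = a := by
  have : (diagHom a 1).range = ((Int.castAddHom (ZMod a)).comp (AddMonoidHom.fst ℤ ℤ)).ker := by
    ext z
    simp only [AddMonoidHom.mem_range, AddMonoidHom.mem_ker, AddMonoidHom.comp_apply,
      AddMonoidHom.coe_fst, Int.coe_castAddHom, ZMod.intCast_zmod_eq_zero_iff_dvd]
    constructor
    · rintro ⟨w, rfl⟩
      simp
    · rintro ⟨k, hk⟩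
      exact ⟨(k, z.2), by simp [Prod.ext_iff, hk]⟩
  rw [this, index_ker_of_surjective]
  intro x
  obtain ⟨y, rfl⟩ := ZMod.intCast_surjective x
  exact ⟨(y, 0), rfl⟩

/-- The kernel of `(x, y) ↦ y - r x` modulo `d` has index `d`. Its image under the injection `(x, y)
↦ (ax, y)`, whose range has index `a`, is the lattice in question. -/
theorem index_hermite (a d : ℕ+) (r : ℤ) : (hermite a d r).index = a * d := by
  let g : ℤ × ℤ →+ ZMod d := (Int.castAddHom (ZMod d)).comp
    (AddMonoidHom.snd ℤ ℤ - (AddMonoidHom.mulLeft r).comp (AddMonoidHom.fst ℤ ℤ))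
  have hg : Function.Surjective g := by
    intro x
    obtain ⟨y, rfl⟩ := ZMod.intCast_surjective x
    exact ⟨(0, y), by simp [g]⟩
  have h1 : hermite a d r = g.ker.map (diagHom a 1) := by
    ext z
    simp only [AddSubgroup.mem_map, AddMonoidHom.mem_ker]
    have hgz : ∀ w : ℤ × ℤ, g w = 0 ↔ (d : ℤ) ∣ w.2 - r * w.1 := fun w => by
      rw [← ZMod.intCast_zmod_eq_zero_iff_dvd]
      rfl
    constructor
    · rintro ⟨k, h1, h2⟩
      exact ⟨(k, z.2), (hgz _).2 h2, by simp [Prod.ext_iff, h1]⟩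
    · rintro ⟨w, hw, rfl⟩
      exact ⟨w.1, by simp, by simpa using (hgz _).1 hw⟩
  rw [h1, AddSubgroup.index_map_of_injective _ (diagHom_injective (by simp) one_ne_zero),
    index_ker_of_surjective g hg, index_range_diagHom_one, mul_comm]

theorem exists_pos_smul_mem {A : Type*} [AddCommGroup A] {K : AddSubgroup A} (hK : K.index ≠ 0) :
    ∃ n : ℕ, n ≠ 0 ∧ ∀ x, n • x ∈ K := ⟨K.index, hK, fun x => K.nsmul_index_mem x⟩

/-- From a subgroup `K` one recovers `a` as the generator of the first projection, `d` as the
generator of the intersection with `0 × ℤ`, and `r` as the class modulo `d` of the second coordinate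
of any element of `K` over `a`. -/
theorem hermite_bijective :
    Function.Bijective fun q : ℕ+ × (Σ d : ℕ+, Fin d) =>
      (⟨hermite q.1 q.2.1 q.2.2, by rw [index_hermite]; simp⟩ : FiniteIndexSubgroup (ℤ × ℤ)) := by
  constructor
  · rintro ⟨a, d, r⟩ ⟨a', d', r'⟩ h
    simp only [Subtype.mk.injEq, SetLike.ext_iff] at h
    have hmem : ∀ (a d : ℕ+) (r : ℤ) (z : ℤ × ℤ), z ∈ hermite a d r ↔
        ∃ k, z.1 = a * k ∧ (d : ℤ) ∣ z.2 - r * k := fun _ _ _ _ => Iff.rfl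
    simp only [hmem, Prod.forall] at h
    -- Testing the inclusion on the elements `(a, r)` and `(0, d)` gives two divisibilities; both
    -- inclusions together force equality.
    have ha : ∀ {a d a' d' : ℕ+} {r r' : ℤ}, (∀ x y : ℤ, (∃ k, x = a * k ∧ (d : ℤ) ∣ y - r * k) →
        (∃ k, x = a' * k ∧ (d' : ℤ) ∣ y - r' * k)) → (a' : ℤ) ∣ a ∧ (d' : ℤ) ∣ d := by
      intro a d a' d' r r' h
      obtain ⟨k, h1, -⟩ := h a r ⟨1, by simp, by simp⟩
      obtain ⟨l, h2, h3⟩ := h 0 d ⟨0, by simp, by simp⟩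
      have : l = 0 := by simpa using h2
      subst this
      exact ⟨⟨k, h1⟩, by simpa using h3⟩
    have h1 := ha fun x y => (h x y).1
    have h2 := ha fun x y => (h x y).2
    obtain rfl : a = a' := PNat.eq (Nat.dvd_antisymm (by exact_mod_cast h2.1) (by exact_mod_cast h1.1))
    obtain rfl : d = d' := PNat.eq (Nat.dvd_antisymm (by exact_mod_cast h2.2) (by exact_mod_cast h1.2))
    obtain ⟨k, h3, h4⟩ := (h a r).1 ⟨1, by simp, by simp⟩
    have hk : k = 1 := by
      have : (a : ℤ) * 1 = a * k := by simpa using h3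
      exact (mul_left_cancel₀ (by simp) this).symm
    subst hk
    have hr : (r : ℕ) = r' := by
      have h5 : ((r : ℕ) : ℤ) ≡ (r' : ℕ) [ZMOD (d : ℕ)] :=
        (Int.modEq_iff_dvd.2 (by simpa using h4)).symm
      have h6 := Int.natCast_modEq_iff.1 h5
      exact h6.eq_of_lt_of_lt r.2 r'.2
    rw [Fin.ext hr]
  · rintro ⟨K, hK⟩
    obtain ⟨n, hn, hK'⟩ := exists_pos_smul_mem hK
    have hn' : (n : ℤ) ≠ 0 := by exact_mod_cast hn
    obtain ⟨a, ha⟩ := exists_eq_zmultiples (K.map (AddMonoidHom.fst ℤ ℤ)) (n := n)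
      ⟨(n, 0), by simpa using hK' (1, 0), rfl⟩ hn'
    obtain ⟨d, hd⟩ := exists_eq_zmultiples (K.comap (AddMonoidHom.inr ℤ ℤ)) (n := n)
      (by simpa using hK' (0, 1)) hn'
    simp only [AddSubgroup.mem_comap, AddMonoidHom.inr_apply] at hd
    obtain ⟨⟨a', t⟩, hat, ha'⟩ := (ha a).2 dvd_rfl
    obtain rfl : a' = a := ha'
    have hd0 : (0 : ℤ) < d := by simp
    refine ⟨⟨a, d, ⟨(t % d).toNat, ?_⟩⟩, ?_⟩
    · have := Int.emod_lt_of_pos t hd0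
      have := Int.emod_nonneg t hd0.ne'
      omega
    · apply Subtype.ext
      ext ⟨x, y⟩
      have hr : (((t % d).toNat : ℕ) : ℤ) = t % d := Int.toNat_of_nonneg (Int.emod_nonneg _ hd0.ne')
      change (∃ k, x = a * k ∧ (d : ℤ) ∣ y - ((t % d).toNat : ℕ) * k) ↔ _
      rw [hr]
      have hcong : ∀ k, (d : ℤ) ∣ y - t % d * k ↔ (d : ℤ) ∣ y - t * k := fun k => by
        have : y - t % d * k = y - t * k + d * (t / d * k) := by
          have := Int.emod_add_mul_ediv t d
          linear_combination (-k) * this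
        rw [this]
        exact (Int.dvd_add_left (dvd_mul_right _ _))
      -- Subtracting `k (a, t)`, which lies in `K`, reduces membership to the vertical axis.
      have hsplit : ∀ k, ((a * k, y) : ℤ × ℤ) ∈ K ↔ (d : ℤ) ∣ y - t * k := fun k => by
        rw [← hd, ← K.add_mem_cancel_left (K.zsmul_mem hat k) (y := (0, y - t * k))]
        simp [mul_comm]
      constructor
      · rintro ⟨k, rfl, h⟩
        exact (hsplit k).2 ((hcong k).1 h)
      · intro h
        obtain ⟨k, hk⟩ := (ha x).1 ⟨_, h, rfl⟩
        subst hk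
        exact ⟨k, rfl, (hcong k).2 ((hsplit k).1 h)⟩

/-- The `d` residues turn `d^{-s}` into `d · d^{-s} = d^{-(s-1)}`, which is where the condition `Re
s > 2` enters. -/
theorem zeta_sigma_fin {s : ℂ} (hs : 2 < s.re) :
    ZetaSummable (fun x : Σ d : ℕ+, Fin d => (x.1 : ℕ)) s ∧
      zetaSeries (fun x : Σ d : ℕ+, Fin d => (x.1 : ℕ)) s = riemannZeta (s - 1) := by
  have h1 : 1 < (s - 1).re := by simp; linarith
  have key : ∀ d : ℕ+, (d : ℂ) * ((d : ℕ) : ℂ) ^ (-s) = ((d : ℕ) : ℂ) ^ (-(s - 1)) := fun d => by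
    rw [neg_sub, sub_eq_add_neg, Complex.cpow_add _ _ (by simp), Complex.cpow_one]
  have hsum : ZetaSummable (fun x : Σ d : ℕ+, Fin d => (x.1 : ℕ)) s := by
    refine Summable.of_norm ((summable_sigma_of_nonneg fun _ => norm_nonneg _).2
      ⟨fun d => (hasSum_fintype _).summable, ?_⟩)
    refine (zetaSummable_pnat h1).norm_cpow.congr fun d => ?_
    rw [← key, norm_mul, tsum_fintype]
    simp
  refine ⟨hsum, ?_⟩
  rw [← zetaSeries_pnat h1, zetaSeries, Summable.tsum_sigma hsum]
  refine tsum_congr fun d => ?_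
  rw [← key, tsum_fintype]
  simp

/-- The zeta function of all subgroups of finite index in `ℤ × ℤ`. -/
theorem zeta_finiteIndexSubgroup {s : ℂ} (hs : 2 < s.re) :
    ZetaSummable (fun K : FiniteIndexSubgroup (ℤ × ℤ) => K.1.index) s ∧
      zetaSeries (fun K : FiniteIndexSubgroup (ℤ × ℤ) => K.1.index) s =
        riemannZeta s * riemannZeta (s - 1) := by
  have h1 : 1 < s.re := by linarith
  have H : ∀ q : ℕ+ × (Σ d : ℕ+, Fin d),
      (Equiv.ofBijective _ hermite_bijective q).1.index = (q.1 : ℕ) * (q.2.1 : ℕ) :=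
    fun q => index_hermite _ _ _
  constructor
  · exact (zetaSummable_congr (Equiv.ofBijective _ hermite_bijective) H s).1
      ((zetaSummable_pnat h1).prod (zeta_sigma_fin hs).1)
  · rw [← zetaSeries_congr (Equiv.ofBijective _ hermite_bijective) H s,
      zetaSeries_prod (zetaSummable_pnat h1) (zeta_sigma_fin hs).1, (zeta_sigma_fin hs).2,
      zetaSeries_pnat h1]

end Hermite

end SubformZeta

namespace SubformZeta

/-! ### Primitive sublattices -/

section Primitive

variable {b : ℤ}

/-- Coordinates on `IntRing b`. -/
def coord (b : ℤ) : IntRing b ≃+ ℤ × ℤ where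
  toFun z := (z.re, z.im)
  invFun p := ⟨p.1, p.2⟩
  left_inv _ := rfl
  right_inv _ := rfl
  map_add' _ _ := rfl

theorem index_map_addEquiv {A B : Type*} [AddGroup A] [AddGroup B] (e : A ≃+ B)
    (K : AddSubgroup A) : (K.map e.toAddMonoidHom).index = K.index :=
  AddSubgroup.index_map_equiv K e

/-- An additive equivalence transports subgroups of finite index. -/
noncomputable def finiteIndexEquiv {A B : Type*} [AddGroup A] [AddGroup B] (e : A ≃+ B) :
    FiniteIndexSubgroup A ≃ FiniteIndexSubgroup B :=
  (e.mapAddSubgroup.toEquiv).subtypeEquiv fun K => by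
    change _ ↔ (K.map e.toAddMonoidHom).index ≠ 0
    rw [index_map_addEquiv]

theorem zeta_finiteIndexSubgroup_intRing {s : ℂ} (hs : 2 < s.re) :
    ZetaSummable (fun K : FiniteIndexSubgroup (IntRing b) => K.1.index) s ∧
      zetaSeries (fun K : FiniteIndexSubgroup (IntRing b) => K.1.index) s =
        riemannZeta s * riemannZeta (s - 1) := by
  have H : ∀ K, (finiteIndexEquiv (coord b) K).1.index = K.1.index :=
    fun K => index_map_addEquiv (coord b) K.1
  obtain ⟨h1, h2⟩ := zeta_finiteIndexSubgroup hs
  exact ⟨(zetaSummable_congr (h := fun K : FiniteIndexSubgroup (ℤ × ℤ) => K.1.index) _ H s).2 h1,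
    (zetaSeries_congr (h := fun K : FiniteIndexSubgroup (ℤ × ℤ) => K.1.index) _ H s).trans h2⟩

/-- The ideal generated by a sublattice. -/
abbrev idealSpan (K : AddSubgroup (IntRing b)) : Ideal (IntRing b) := Ideal.span (K : Set (IntRing b))

/-- Sublattices of finite index generating the unit ideal. -/
abbrev PrimitiveSublattice (b : ℤ) : Type :=
  {K : AddSubgroup (IntRing b) // K.index ≠ 0 ∧ idealSpan K = ⊤}

/-- Nonzero ideals. -/
abbrev NonzeroIdeal (R : Type*) [CommRing R] : Type _ := {I : Ideal R // I ≠ ⊥}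

/-- The sublattice `αK`. -/
def scale (α : IntRing b) (K : AddSubgroup (IntRing b)) : AddSubgroup (IntRing b) :=
  K.map (AddMonoidHom.mulLeft α)

theorem mem_scale {α : IntRing b} {K : AddSubgroup (IntRing b)} {x : IntRing b} :
    x ∈ scale α K ↔ ∃ k ∈ K, α * k = x := Iff.rfl

theorem idealSpan_scale (α : IntRing b) (K : AddSubgroup (IntRing b)) :
    idealSpan (scale α K) = Ideal.span {α} * idealSpan K := by
  rw [idealSpan, idealSpan, Ideal.span_mul_span']
  congr 1
  ext x
  simp [mem_scale]

theorem idealSpan_ne_bot {K : AddSubgroup (IntRing b)} (hK : K.index ≠ 0) : idealSpan K ≠ ⊥ := by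
  intro h
  obtain ⟨n, hn, hn'⟩ := exists_pos_smul_mem hK
  have h1 : n • (1 : IntRing b) ∈ idealSpan K := Ideal.subset_span (hn' 1)
  rw [h, Ideal.mem_bot, nsmul_eq_mul, mul_one] at h1
  exact hn (by exact_mod_cast h1)

theorem idealSpan_scale_primitive (α : IntRing b) (K : PrimitiveSublattice b) :
    idealSpan (scale α K.1) = Ideal.span {α} := by
  rw [idealSpan_scale, K.2.2, Ideal.mul_top]

variable [hb : Fact (b = 0 ∨ b = 1)]

theorem scale_injective {α : IntRing b} (hα : α ≠ 0) : Function.Injective (scale α) :=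
  AddSubgroup.map_injective (mul_right_injective₀ hα)

theorem index_scale {α : IntRing b} (hα : α ≠ 0) (K : AddSubgroup (IntRing b)) :
    (scale α K).index = nrm α * K.index := by
  have h : (AddMonoidHom.mulLeft α).range = (Ideal.span {α}).toAddSubgroup := by
    ext x
    simp only [AddMonoidHom.mem_range, AddMonoidHom.coe_mulLeft, Submodule.mem_toAddSubgroup,
      Ideal.mem_span_singleton, dvd_def, eq_comm]
  rw [scale, AddSubgroup.index_map_of_injective _ (mul_right_injective₀ hα), h,
    ← absNorm_eq_index, absNorm_span, mul_comm]

/-- As `K` lies in `(α)`, it can be divided by `α`. The quotient `K'` satisfies `(α) · idealSpan K'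
= (α)`, and nonzero ideals cancel. -/
theorem exists_eq_scale {K : AddSubgroup (IntRing b)} (hK : K.index ≠ 0) {α : IntRing b}
    (hα : idealSpan K = Ideal.span {α}) :
    α ≠ 0 ∧ ∃ K' : PrimitiveSublattice b, scale α K'.1 = K := by
  have hα0 : α ≠ 0 := by
    rintro rfl
    exact idealSpan_ne_bot hK (by rw [hα]; simp)
  have h1 : scale α (K.comap (AddMonoidHom.mulLeft α)) = K := by
    ext x
    rw [mem_scale]
    constructor
    · rintro ⟨k, hk, rfl⟩
      exact hk
    · intro hx
      have : x ∈ Ideal.span {α} := hα ▸ Ideal.subset_span hx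
      obtain ⟨k, rfl⟩ := Ideal.mem_span_singleton.1 this
      exact ⟨k, hx, rfl⟩
  refine ⟨hα0, ⟨K.comap (AddMonoidHom.mulLeft α), ?_, ?_⟩, h1⟩
  · intro h
    apply hK
    rw [← h1, index_scale hα0, h, mul_zero]
  · have h2 := idealSpan_scale α (K.comap (AddMonoidHom.mulLeft α))
    rw [h1, hα] at h2
    have h3 : Ideal.span {α} ≠ ⊥ := by simpa using hα0
    exact (mul_left_cancel₀ h3 (by rw [← h2, Ideal.mul_top])).symm

/-- A generator of a nonzero ideal. -/
noncomputable def gen (I : NonzeroIdeal (IntRing b)) : IntRing b :=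
  Submodule.IsPrincipal.generator I.1

theorem span_gen (I : NonzeroIdeal (IntRing b)) : Ideal.span {gen I} = I.1 :=
  Ideal.span_singleton_generator I.1

theorem gen_ne_zero (I : NonzeroIdeal (IntRing b)) : gen I ≠ 0 := by
  intro h
  exact I.2 (by rw [← span_gen I, h]; simp)

theorem nrm_gen (I : NonzeroIdeal (IntRing b)) : nrm (gen I) = Ideal.absNorm I.1 := by
  rw [← absNorm_span, span_gen]

/-- The ideal is recovered as the one generated by the sublattice. Fixing one generator for each
ideal then makes the primitive factor unique, not merely unique up to units. -/
theorem scale_gen_bijective :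
    Function.Bijective fun q : NonzeroIdeal (IntRing b) × PrimitiveSublattice b =>
      (⟨scale (gen q.1) q.2.1, by
        rw [index_scale (gen_ne_zero _)]
        exact mul_ne_zero (mt nrm_eq_zero.1 (gen_ne_zero _)) q.2.2.1⟩ :
        FiniteIndexSubgroup (IntRing b)) := by
  constructor
  · rintro ⟨I, K⟩ ⟨I', K'⟩ h
    simp only [Subtype.mk.injEq] at h
    have h1 := congrArg idealSpan h
    rw [idealSpan_scale_primitive, idealSpan_scale_primitive, span_gen, span_gen] at h1
    obtain rfl := Subtype.ext h1
    rw [Subtype.ext (scale_injective (gen_ne_zero I) h)]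
  · rintro ⟨K, hK⟩
    let I : NonzeroIdeal (IntRing b) := ⟨idealSpan K, idealSpan_ne_bot hK⟩
    obtain ⟨-, K', hK'⟩ := exists_eq_scale hK (span_gen I).symm
    exact ⟨(I, K'), Subtype.ext hK'⟩

/-- The zeta function of the ideals of `IntRing b`. -/
noncomputable def idealZeta (b : ℤ) [Fact (b = 0 ∨ b = 1)] (s : ℂ) : ℂ :=
  zetaSeries (fun I : NonzeroIdeal (IntRing b) => Ideal.absNorm I.1) s

/-- The zeta function of the primitive sublattices of `IntRing b`. -/
noncomputable def primitiveZeta (b : ℤ) (s : ℂ) : ℂ :=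
  zetaSeries (fun K : PrimitiveSublattice b => K.1.index) s

theorem idealZeta_mul_primitiveZeta {s : ℂ} (hs : 2 < s.re) :
    ZetaSummable (fun I : NonzeroIdeal (IntRing b) => Ideal.absNorm I.1) s ∧
    ZetaSummable (fun K : PrimitiveSublattice b => K.1.index) s ∧
      idealZeta b s * primitiveZeta b s = riemannZeta s * riemannZeta (s - 1) := by
  obtain ⟨e, H⟩ : ∃ e : NonzeroIdeal (IntRing b) × PrimitiveSublattice b ≃
      FiniteIndexSubgroup (IntRing b),
      ∀ q, (e q).1.index = Ideal.absNorm q.1.1 * q.2.1.index := by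
    refine ⟨Equiv.ofBijective _ scale_gen_bijective, fun q => ?_⟩
    change (scale (gen q.1) q.2.1).index = _
    rw [index_scale (gen_ne_zero _), nrm_gen]
  obtain ⟨h1, h2⟩ := zeta_finiteIndexSubgroup_intRing (b := b) hs
  have h1' := (zetaSummable_congr (h := fun K : FiniteIndexSubgroup (IntRing b) => K.1.index)
    e H s).2 h1
  have h2' := (zetaSeries_congr (h := fun K : FiniteIndexSubgroup (IntRing b) => K.1.index)
    e H s).trans h2
  -- Convergence of both factors follows from that of the product by restricting to the slices where
  -- the other factor is the whole ring.
  have h3 := ZetaSummable.fst (g := fun I : NonzeroIdeal (IntRing b) => Ideal.absNorm I.1)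
    (h := fun K : PrimitiveSublattice b => K.1.index) h1' ⟨⊤, by simp, Ideal.span_eq ⊤⟩ (by simp)
  have h4 := ZetaSummable.snd (g := fun I : NonzeroIdeal (IntRing b) => Ideal.absNorm I.1)
    (h := fun K : PrimitiveSublattice b => K.1.index) h1' ⟨⊤, by simp⟩ (by simp)
  exact ⟨h3, h4, (zetaSeries_prod h3 h4).symm.trans h2'⟩

end Primitive

end SubformZeta

namespace SubformZeta

/-! ### The symmetries of `IntRing b` acting on primitive sublattices -/

section Symmetry

/-- Conjugation if `t`, the identity otherwise. -/
def tw {R : Type*} [CommRing R] [StarRing R] (t : Bool) : RingAut R :=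
  if t then starRingAut else 1

section Tw

variable {R : Type*} [CommRing R] [StarRing R]

@[simp] theorem tw_true (x : R) : tw true x = star x := rfl

@[simp] theorem tw_false (x : R) : tw false x = x := rfl

theorem tw_tw (t t' : Bool) (x : R) : tw t (tw t' x) = tw (xor t t') x := by
  cases t <;> cases t' <;> simp

@[simp] theorem tw_tw_self (t : Bool) (x : R) : tw t (tw t x) = x := by
  rw [tw_tw, Bool.xor_self, tw_false]

end Tw

variable {b : ℤ}

theorem incl_tw (t : Bool) (x : IntRing b) : incl b (tw t x) = tw t (incl b x) := by
  cases t
  · rfl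
  · exact incl_star x

@[simp] theorem norm_tw (t : Bool) (x : RatField b) : (tw t x).norm = x.norm := by
  cases t
  · rfl
  · exact QuadraticAlgebra.norm_star x

/-- The map `x ↦ u τ(x)` with `τ` the identity or conjugation. -/
def symHom (u : IntRing b) (t : Bool) : IntRing b →+ IntRing b :=
  (AddMonoidHom.mulLeft u).comp ((tw t : RingAut (IntRing b)) : IntRing b →+ IntRing b)

@[simp] theorem symHom_apply (u : IntRing b) (t : Bool) (x : IntRing b) :
    symHom u t x = u * tw t x := rfl

/-- The sublattice `u τ(K)`. -/
def twist (u : IntRing b) (t : Bool) (K : AddSubgroup (IntRing b)) : AddSubgroup (IntRing b) :=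
  K.map (symHom u t)

theorem mem_twist {u : IntRing b} {t : Bool} {K : AddSubgroup (IntRing b)} {x : IntRing b} :
    x ∈ twist u t K ↔ ∃ k ∈ K, u * tw t k = x := Iff.rfl

theorem twist_twist (u v : IntRing b) (t t' : Bool) (K : AddSubgroup (IntRing b)) :
    twist u t (twist v t' K) = twist (u * tw t v) (xor t t') K := by
  rw [twist, twist, AddSubgroup.map_map]
  congr 1
  ext1 x
  simp [tw_tw, mul_assoc]

theorem twist_one_false (K : AddSubgroup (IntRing b)) : twist 1 false K = K := by
  ext x
  simp [mem_twist]

theorem idealSpan_twist {u : IntRing b} (hu : IsUnit u) (t : Bool) {K : AddSubgroup (IntRing b)}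
    (hK : idealSpan K = ⊤) : idealSpan (twist u t K) = ⊤ := by
  have h : twist u t K = scale u (K.map ((tw t : RingAut (IntRing b)) : IntRing b →+ IntRing b)) := by
    rw [twist, scale, AddSubgroup.map_map]
    rfl
  have h2 : idealSpan (K.map ((tw t : RingAut (IntRing b)) : IntRing b →+ IntRing b)) =
      (idealSpan K).map ((tw t : RingAut (IntRing b)) : IntRing b →+* IntRing b) := by
    rw [idealSpan, idealSpan, Ideal.map_span]
    rfl
  rw [h, idealSpan_scale, h2, hK, Ideal.map_top, Ideal.span_singleton_eq_top.2 hu, Ideal.mul_top]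

theorem twist_eq_iff {u : IntRing b} (hu : IsUnit u) (t : Bool) {K K' : AddSubgroup (IntRing b)} :
    twist u t K = K' ↔ ∀ x, x ∈ K ↔ u * tw t x ∈ K' := by
  have hinj : Function.Injective (symHom u t) := fun x y h =>
    (tw t).injective (hu.mul_right_injective h)
  constructor
  · rintro rfl x
    exact (AddSubgroup.mem_map_iff_mem hinj).symm
  · intro h
    ext x
    obtain ⟨v, hv⟩ := hu.exists_right_inv
    have hx : u * tw t (tw t (v * x)) = x := by rw [tw_tw_self, ← mul_assoc, hv, one_mul]
    constructor
    · rintro ⟨k, hk, rfl⟩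
      exact (h k).1 hk
    · intro hx'
      exact ⟨tw t (v * x), (h _).2 (by rwa [hx]), hx⟩

/-- The automorphism `x ↦ u τ(x)` of the additive group of `IntRing b`. -/
def symEquiv (u : (IntRing b)ˣ) (t : Bool) : IntRing b ≃ₗ[ℤ] IntRing b where
  toFun x := u * tw t x
  map_smul' n x := by simp [mul_left_comm]
  invFun x := tw t (↑u⁻¹ * x)
  left_inv x := by simp
  right_inv x := by simp
  map_add' x y := by simp [mul_add]

@[simp] theorem symEquiv_apply (u : (IntRing b)ˣ) (t : Bool) (x : IntRing b) :
    symEquiv u t x = u * tw t x := rfl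

/-- The group of the symmetries `x ↦ u τ(x)`, with conjugations allowed if `c`. -/
def symGroup (b : ℤ) (c : Bool) : Subgroup ((IntRing b ≃ₗ[ℤ] IntRing b)) where
  -- In the order `false ≤ true` of `Bool`, the bound `t ≤ c` admits both values for `c = true` and
  -- only the identity for `c = false`.
  carrier := {φ | ∃ u t, t ≤ c ∧ φ = symEquiv u t}
  one_mem' := ⟨1, false, Bool.false_le c, by ext1 x; simp⟩
  mul_mem' := by
    rintro _ _ ⟨u, t, ht, rfl⟩ ⟨v, t', ht', rfl⟩
    refine ⟨u * Units.map (tw t : RingAut (IntRing b)).toMonoidHom v, xor t t', ?_, ?_⟩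
    · revert ht ht'; cases t <;> cases t' <;> cases c <;> decide
    · ext1 x
      simp [LinearEquiv.mul_apply, tw_tw, mul_assoc]
  inv_mem' := by
    rintro _ ⟨u, t, ht, rfl⟩
    refine ⟨Units.map (tw t : RingAut (IntRing b)).toMonoidHom u⁻¹, t, ht, ?_⟩
    rw [inv_eq_iff_mul_eq_one]
    ext1 x
    simp [LinearEquiv.mul_apply, ← map_mul]

/-- The parametrisation of `symGroup` by units and conjugations. -/
theorem symEquiv_bijective (c : Bool) :
    Function.Bijective fun p : (IntRing b)ˣ × {t : Bool // t ≤ c} =>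
      (⟨symEquiv p.1 p.2.1, p.1, p.2.1, p.2.2, rfl⟩ : symGroup b c) := by
  constructor
  · rintro ⟨u, t, ht⟩ ⟨v, t', ht'⟩ h
    replace h : symEquiv u t = symEquiv v t' := congrArg Subtype.val h
    -- The value at `1` recovers the unit, and afterwards the value at `ω` shows whether a
    -- conjugation is present.
    have h1 : u = v := by
      have := DFunLike.congr_fun h 1
      simpa [Units.ext_iff] using this
    subst h1
    have h2 := DFunLike.congr_fun h (⟨0, 1⟩ : IntRing b)
    simp only [symEquiv_apply, Units.mul_right_inj] at h2
    have h3 : t = t' := by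
      cases t <;> cases t' <;> simp [QuadraticAlgebra.ext_iff] at h2 ⊢
    subst h3
    rfl
  · rintro ⟨_, u, t, ht, rfl⟩
    exact ⟨(u, ⟨t, ht⟩), rfl⟩

/-- The action of a symmetry on a primitive sublattice. -/
def symAct (u : (IntRing b)ˣ) (t : Bool) (K : PrimitiveSublattice b) : PrimitiveSublattice b :=
  ⟨twist u t K.1, by
    refine ⟨?_, idealSpan_twist u.isUnit t K.2.2⟩
    have := index_map_addEquiv (symEquiv u t).toAddEquiv K.1
    exact fun h => K.2.1 (this.symm.trans h)⟩

instance symGroupAction (c : Bool) : MulAction (symGroup b c) (PrimitiveSublattice b) where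
  smul φ K := ⟨K.1.map φ.1.toAddEquiv.toAddMonoidHom, by
    obtain ⟨_, u, t, ht, rfl⟩ := φ
    exact (symAct u t K).2⟩
  one_smul K := Subtype.ext (AddSubgroup.map_id K.1)
  mul_smul φ ψ K := Subtype.ext (AddSubgroup.map_map K.1 φ.1.toAddEquiv.toAddMonoidHom
    ψ.1.toAddEquiv.toAddMonoidHom).symm

/-- Orbits of primitive sublattices. -/
abbrev PrimitiveOrbit (b : ℤ) (c : Bool) : Type :=
  Quotient (MulAction.orbitRel (symGroup b c) (PrimitiveSublattice b))

theorem primitiveOrbit_eq_iff {c : Bool} {K K' : PrimitiveSublattice b} :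
    (Quotient.mk _ K : PrimitiveOrbit b c) = Quotient.mk _ K' ↔
      ∃ u : (IntRing b)ˣ, ∃ t ≤ c, twist u t K.1 = K'.1 := by
  rw [eq_comm, Quotient.eq, MulAction.orbitRel_apply]
  constructor
  · rintro ⟨⟨_, u, t, ht, rfl⟩, h⟩
    exact ⟨u, t, ht, congrArg Subtype.val h⟩
  · rintro ⟨u, t, ht, h⟩
    exact ⟨⟨symEquiv u t, u, t, ht, rfl⟩, Subtype.ext h⟩

/-- The index of a primitive sublattice, as a function of its orbit. -/
noncomputable def orbitIndex (c : Bool) : PrimitiveOrbit b c → ℕ :=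
  Quotient.lift (fun K => K.1.index) fun K K' h => by
    obtain ⟨⟨φ, hφ⟩, rfl⟩ := MulAction.orbitRel_apply.1 h
    exact index_map_addEquiv φ.toAddEquiv K'.1

@[simp] theorem orbitIndex_mk (c : Bool) (K : PrimitiveSublattice b) :
    orbitIndex c (Quotient.mk _ K) = K.1.index := rfl

theorem orbitIndex_ne_zero (c : Bool) (x : PrimitiveOrbit b c) : orbitIndex c x ≠ 0 := by
  induction x using Quotient.inductionOn with | h K => exact K.2.1

/-- The zeta function of the orbits of primitive sublattices. -/
noncomputable def orbitZeta (b : ℤ) (c : Bool) (s : ℂ) : ℂ :=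
  zetaSeries (orbitIndex (b := b) c) s

/-- The zeta function of the primitive sublattices `K` with `uτ(K) = K`. -/
noncomputable def fixedZeta (u : IntRing b) (t : Bool) (s : ℂ) : ℂ :=
  zetaSeries (fun K : {K : PrimitiveSublattice b // twist u t K.1 = K.1} => K.1.1.index) s

theorem burnside_primitive [Fintype (IntRing b)ˣ] (c : Bool) {s : ℂ}
    (hs : ZetaSummable (fun K : PrimitiveSublattice b => K.1.index) s) :
    ZetaSummable (orbitIndex (b := b) c) s ∧
      Fintype.card (IntRing b)ˣ * Fintype.card {t : Bool // t ≤ c} * orbitZeta b c s =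
        ∑ u : (IntRing b)ˣ, ∑ t : {t : Bool // t ≤ c}, fixedZeta (u : IntRing b) t.1 s := by
  let e := Equiv.ofBijective _ (symEquiv_bijective (b := b) c)
  let _ : Fintype (symGroup b c) := Fintype.ofEquiv _ e
  obtain ⟨h1, h2⟩ := zetaSeries_orbits (Γ := symGroup b c) hs (h := orbitIndex c) fun _ => rfl
  refine ⟨h1, ?_⟩
  rw [← Fintype.card_congr e, Fintype.card_prod] at h2
  rw [orbitZeta, ← Nat.cast_mul, h2, ← e.sum_comp, Fintype.sum_prod_type]
  refine Finset.sum_congr rfl fun u _ => Finset.sum_congr rfl fun t _ => ?_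
  refine zetaSeries_congr (Equiv.subtypeEquivRight fun K : PrimitiveSublattice b => ?_)
    (fun _ => ?_) s
  · rw [MulAction.mem_fixedBy, Subtype.ext_iff]
    rfl
  · rfl

end Symmetry

end SubformZeta

open scoped QuadraticAlgebra

namespace SubformZeta

/-! ### Isometries of the rational quadratic space -/

section Isometry

variable {b : ℤ}

theorem tw_smul (t : Bool) (r : ℚ) (x : RatField b) : tw t (r • x) = r • tw t x := by
  cases t
  · rfl
  · ext <;> simp

/-- Conjugation (or the identity) as a linear automorphism. -/
def twLinear (b : ℤ) (t : Bool) : RatField b ≃ₗ[ℚ] RatField b where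
  toFun := tw t
  invFun := tw t
  left_inv := tw_tw_self t
  right_inv := tw_tw_self t
  map_add' := map_add _
  map_smul' := tw_smul t

@[simp] theorem twLinear_apply (t : Bool) (x : RatField b) : twLinear b t x = tw t x := rfl

theorem det_twLinear_true : LinearMap.det (twLinear b true : RatField b →ₗ[ℚ] RatField b) = -1 := by
  rw [← LinearMap.det_toMatrix (QuadraticAlgebra.basis (-1 : ℚ) (b : ℚ)), Matrix.det_fin_two]
  simp [LinearMap.toMatrix_apply, QuadraticAlgebra.basis, QuadraticAlgebra.linearEquivTuple,
    QuadraticAlgebra.equivProd]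

theorem det_mulLeft (u : RatField b) : LinearMap.det (LinearMap.mulLeft ℚ u) = u.norm := by
  rw [← QuadraticAlgebra.det_toLinearMap_eq_norm]
  rfl

variable {V : Type*} [AddCommGroup V] [Module ℚ V]

/-- An identification of `(V, Q)` with the norm form on `RatField b`, taking `L` to `IntRing b`. -/
structure NormModel (b : ℤ) (Q : QuadraticForm ℚ V) (L : AddSubgroup V) where
  /-- The underlying linear equivalence. -/
  equiv : V ≃ₗ[ℚ] RatField b
  norm_equiv : ∀ x, (equiv x).norm = Q x
  mem_iff : ∀ x, x ∈ L ↔ ∃ z, incl b z = equiv x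

theorem IsLatticeOfForm.exists_normModel {Q : QuadraticForm ℚ V} {L : AddSubgroup V}
    (h : IsLatticeOfForm Q L 1 b 1) : Nonempty (NormModel b Q L) := by
  obtain ⟨e, rfl, hQ⟩ := h
  have h0 : Q (e 0) = 1 := by simpa using hQ 1 0
  have h1 : Q (e 1) = 1 := by simpa using hQ 0 1
  -- The form on integral vectors determines the polar form, here through `Q (e 0 + e 1) = 2 + b`,
  -- and hence `Q` on all of `V`.
  have h2 : QuadraticMap.polar Q (e 0) (e 1) = b := by
    have := hQ 1 1
    rw [QuadraticMap.polar, h0, h1]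
    simp only [Int.cast_one, one_smul] at this
    rw [this]
    push_cast
    ring
  let f := e.equivFun.trans (QuadraticAlgebra.linearEquivTuple (-1 : ℚ) (b : ℚ)).symm
  have hf : ∀ x, f x = ⟨e.repr x 0, e.repr x 1⟩ := fun x => rfl
  have hx : ∀ x, x = e.repr x 0 • e 0 + e.repr x 1 • e 1 := fun x => by
    rw [← Fin.sum_univ_two (fun i => e.repr x i • e i), e.sum_repr]
  refine ⟨⟨f, fun x => ?_, fun x => ?_⟩⟩
  · conv_rhs => rw [hx x, QuadraticMap.map_add (⇑Q), QuadraticMap.polar_smul_left,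
      QuadraticMap.polar_smul_right, h2, QuadraticMap.map_smul, QuadraticMap.map_smul, h0, h1]
    rw [hf, QuadraticAlgebra.norm_def]
    simp only [smul_eq_mul]
    ring
  · have hr : Set.range e = {e 0, e 1} := by
      ext y
      simp [Fin.exists_fin_two, eq_comm]
    have hf' : ∀ m n : ℤ, f (m • e 0 + n • e 1) = ⟨m, n⟩ := fun m n => by
      rw [hf]
      ext <;> simp
    rw [hr, AddSubgroup.mem_closure_pair]
    constructor
    · rintro ⟨m, n, rfl⟩
      exact ⟨⟨m, n⟩, (hf' m n).symm⟩
    · rintro ⟨z, hz⟩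
      refine ⟨z.re, z.im, f.injective ?_⟩
      rw [hf', ← hz]
      rfl

variable {Q : QuadraticForm ℚ V} {L : AddSubgroup V} (M : NormModel b Q L)

namespace NormModel

/-- The lattice in `V` corresponding to a sublattice of `IntRing b`. -/
def lat (K : AddSubgroup (IntRing b)) : AddSubgroup V :=
  (K.map (incl b).toAddMonoidHom).comap M.equiv.toAddEquiv.toAddMonoidHom

theorem mem_lat {K : AddSubgroup (IntRing b)} {x : V} :
    x ∈ M.lat K ↔ ∃ k ∈ K, incl b k = M.equiv x := Iff.rfl

/-- The vector of `V` corresponding to an element of `IntRing b`. -/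
def vec : IntRing b →+ V := M.equiv.symm.toAddEquiv.toAddMonoidHom.comp (incl b).toAddMonoidHom

@[simp] theorem equiv_vec (z : IntRing b) : M.equiv (M.vec z) = incl b z :=
  M.equiv.apply_symm_apply _

theorem vec_injective : Function.Injective M.vec :=
  M.equiv.symm.injective.comp incl_injective

theorem lat_eq_map (K : AddSubgroup (IntRing b)) : M.lat K = K.map M.vec := by
  ext x
  rw [mem_lat, AddSubgroup.mem_map]
  refine exists_congr fun k => and_congr_right fun _ => ?_
  rw [← M.equiv.injective.eq_iff, equiv_vec]

theorem range_vec : M.vec.range = L := by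
  ext x
  rw [M.mem_iff, AddMonoidHom.mem_range]
  exact exists_congr fun k => by rw [← M.equiv.injective.eq_iff, equiv_vec]

theorem lat_le (K : AddSubgroup (IntRing b)) : M.lat K ≤ L := by
  rw [lat_eq_map]
  exact (AddSubgroup.map_le_range _ _).trans M.range_vec.le

theorem lat_injective : Function.Injective M.lat := fun K K' h => by
  rw [lat_eq_map, lat_eq_map] at h
  exact AddSubgroup.map_injective M.vec_injective h

theorem exists_lat_eq {H : AddSubgroup V} (h : H ≤ L) : ∃ K, M.lat K = H := by
  refine ⟨H.comap M.vec, ?_⟩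
  rw [lat_eq_map, AddSubgroup.map_comap_eq, M.range_vec]
  exact inf_eq_right.2 h

theorem relIndex_lat (K : AddSubgroup (IntRing b)) : (M.lat K).relIndex L = K.index := by
  have h := congrArg (K.map M.vec).relIndex M.range_vec
  rw [lat_eq_map, ← h, AddMonoidHom.range_eq_map,
    AddSubgroup.relIndex_map_map_of_injective _ _ M.vec_injective, AddSubgroup.relIndex_top_right]

variable [hb : Fact (b = 0 ∨ b = 1)]

/-- The isometry `x ↦ u τ(x)`. -/
noncomputable def iso (u : {u : RatField b // u.norm = 1}) (t : Bool) : V ≃ₗ[ℚ] V :=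
  (M.equiv.trans ((twLinear b t).trans (LinearEquiv.ofBijective (LinearMap.mulLeft ℚ u.1)
    (mulLeft_bijective₀ u.1 fun h => by
      have := u.2
      rw [h, QuadraticAlgebra.norm_zero] at this
      exact zero_ne_one this)))).trans M.equiv.symm

@[simp] theorem equiv_iso (u : {u : RatField b // u.norm = 1}) (t : Bool) (x : V) :
    M.equiv (M.iso u t x) = u.1 * tw t (M.equiv x) :=
  M.equiv.apply_symm_apply _

theorem iso_mem_orthogonal (u : {u : RatField b // u.norm = 1}) (t : Bool) :
    M.iso u t ∈ orthogonal Q := fun x => by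
  rw [← M.norm_equiv, ← M.norm_equiv, equiv_iso, map_mul, u.2, one_mul, norm_tw]

/-- After division by `u = g 1`, of norm 1, the isometry fixes `1` and sends `ω` to some `v` with
`N(v) = N(ω)` and `N(1 + v) = N(1 + ω)`. So `v` has the norm and the trace of `ω`, which leaves only
`ω` and its conjugate. -/
theorem exists_iso_eq {σ : V ≃ₗ[ℚ] V} (hσ : σ ∈ orthogonal Q) : ∃ u t, M.iso u t = σ := by
  let g : RatField b →ₗ[ℚ] RatField b :=
    (M.equiv.symm.trans (σ.trans M.equiv) : RatField b ≃ₗ[ℚ] RatField b)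
  have hg : ∀ x, g (M.equiv x) = M.equiv (σ x) := fun x => by simp [g]
  have hN : ∀ z, (g z).norm = z.norm := fun z => by
    obtain ⟨x, rfl⟩ := M.equiv.surjective z
    rw [hg, M.norm_equiv, M.norm_equiv]
    exact hσ x
  have hu : (g 1).norm = 1 := by rw [hN, QuadraticAlgebra.norm_one]
  set u := g 1
  have hus : u * star u = 1 := by
    rw [← QuadraticAlgebra.algebraMap_norm_eq_mul_star, hu, map_one]
  set v := star u * g ⟨0, 1⟩
  have huv : u * v = g ⟨0, 1⟩ := by rw [← mul_assoc, hus, one_mul]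
  have hv : v.norm = 1 := by
    rw [map_mul, QuadraticAlgebra.norm_star, hu, hN]
    simp [QuadraticAlgebra.norm_def]
  have hv1 : (1 + v).norm = 2 + b := by
    have h1 : u * (1 + v) = g ⟨1, 1⟩ := by
      rw [mul_add, mul_one, huv, ← map_add]
      congr 1
      ext <;> simp
    have h2 := hN ⟨1, 1⟩
    rw [← h1, map_mul, hu, one_mul] at h2
    rw [h2]
    simp [QuadraticAlgebra.norm_def]
    ring
  have hgz : ∀ z, g z = u * (z.re • 1 + z.im • v) := fun z => by
    have : z = z.re • 1 + z.im • (⟨0, 1⟩ : RatField b) := by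
      ext <;> simp
    conv_lhs => rw [this, map_add, map_smul, map_smul, ← huv]
    rw [mul_add, mul_smul_comm, mul_smul_comm, mul_one]
  have key : v = ⟨0, 1⟩ ∨ v = star ⟨0, 1⟩ := by
    rw [QuadraticAlgebra.norm_def] at hv hv1
    simp only [QuadraticAlgebra.re_add, QuadraticAlgebra.im_add, QuadraticAlgebra.re_one,
      QuadraticAlgebra.im_one] at hv1
    have h1 : 2 * v.re + b * v.im = b := by linear_combination hv1 - hv
    -- With trace `2 v.re + b v.im = b`, the identity `4 N(v) = (2 v.re + b v.im)² + (4 - b²) v.im²`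
    -- leaves `v.im = ±1`.
    have h2 : (4 - (b : ℚ) ^ 2) * ((v.im - 1) * (v.im + 1)) = 0 := by
      linear_combination 4 * hv - (2 * v.re + b * v.im + b) * h1
    have hb4 : (4 - (b : ℚ) ^ 2) ≠ 0 := by
      rcases hb.out with rfl | rfl <;> norm_num
    rcases mul_eq_zero.1 ((mul_eq_zero.1 h2).resolve_left hb4) with h3 | h3
    · left
      ext
      · simp only
        linear_combination (h1 - b * h3) / 2
      · simp only
        linear_combination h3
    · right
      ext
      · simp
        linear_combination (h1 - b * h3) / 2
      · simp
        linear_combination h3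
  have hrep : ∀ z : RatField b, z.re • 1 + z.im • (⟨0, 1⟩ : RatField b) = z := fun z => by
    ext <;> simp
  rcases key with hv' | hv'
  · refine ⟨⟨u, hu⟩, false, LinearEquiv.ext fun x => M.equiv.injective ?_⟩
    rw [equiv_iso, ← hg, hgz, hv', hrep, tw_false]
  · refine ⟨⟨u, hu⟩, true, LinearEquiv.ext fun x => M.equiv.injective ?_⟩
    rw [equiv_iso, ← hg, hgz, hv', tw_true]
    conv_lhs => rw [← hrep (M.equiv x)]
    congr 1
    ext <;> simp [mul_comm]

/-- Multiplication by `u` has determinant `N(u) = 1` and conjugation has determinant `-1`. -/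
theorem iso_mem_properOrthogonal_iff (u : {u : RatField b // u.norm = 1}) (t : Bool) :
    M.iso u t ∈ properOrthogonal Q ↔ t = false := by
  have h1 : LinearMap.det (M.iso u t : V →ₗ[ℚ] V) =
      u.1.norm * LinearMap.det (twLinear b t : RatField b →ₗ[ℚ] RatField b) := by
    rw [← det_mulLeft, ← LinearMap.det_comp, ← LinearMap.det_conj _ M.equiv.symm]
    rfl
  rw [properOrthogonal, Subgroup.mem_inf, MonoidHom.mem_ker, Units.ext_iff, LinearEquiv.coe_det, h1,
    u.2, one_mul]
  refine (and_iff_right (M.iso_mem_orthogonal u t)).trans ?_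
  cases t
  · simp only [iff_true]
    have : (twLinear b false : RatField b →ₗ[ℚ] RatField b) = LinearMap.id := rfl
    rw [this, LinearMap.det_id]
    rfl
  · rw [det_twLinear_true]
    norm_num

theorem iso_bijective :
    Function.Bijective fun p : {u : RatField b // u.norm = 1} × Bool =>
      (⟨M.iso p.1 p.2, M.iso_mem_orthogonal _ _⟩ : orthogonal Q) := by
  constructor
  · rintro ⟨⟨u, hu⟩, t⟩ ⟨⟨v, hv⟩, t'⟩ h
    have h' : ∀ z, u * tw t z = v * tw t' z := fun z => by
      have h1 := congrArg (fun σ : orthogonal Q => M.equiv (σ.1 (M.equiv.symm z))) h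
      simpa using h1
    have huv : u = v := by simpa using h' 1
    subst huv
    have hu0 : u ≠ 0 := fun h => by simp [h] at hu
    have h2 := mul_left_cancel₀ hu0 (h' ⟨0, 1⟩)
    have : t = t' := by
      cases t <;> cases t' <;> simp [QuadraticAlgebra.ext_iff] at h2 ⊢ <;> norm_num at h2
    rw [this]
  · rintro ⟨σ, hσ⟩
    obtain ⟨u, t, rfl⟩ := M.exists_iso_eq hσ
    exact ⟨(u, t), rfl⟩

end NormModel

end Isometry

end SubformZeta

namespace SubformZeta

/-! ### Classes of sublattices -/

section Classes

variable {b : ℤ}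

theorem incl_ne_zero {α : IntRing b} (hα : α ≠ 0) : incl b α ≠ 0 := by
  rwa [Ne, map_eq_zero_iff _ incl_injective]

/-- The positive integers that are norms. -/
abbrev NormValue (b : ℤ) : Type := {n : ℕ // n ≠ 0 ∧ ∃ α : IntRing b, nrm α = n}

/-- The zeta function of the set of norms. -/
noncomputable def normZeta (b : ℤ) (s : ℂ) : ℂ := zetaSeries (fun n : NormValue b => n.1) s

theorem zetaSummable_normValue {s : ℂ} (hs : 1 < s.re) :
    ZetaSummable (fun n : NormValue b => n.1) s :=
  (zetaSummable_pnat hs).comp (fun n : NormValue b => (⟨n.1, Nat.pos_of_ne_zero n.2.1⟩ : ℕ+))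
    fun _ _ h => Subtype.ext (congrArg PNat.val h)

/-- An element of given norm. -/
noncomputable def normRep (n : NormValue b) : IntRing b := n.2.2.choose

theorem nrm_normRep (n : NormValue b) : nrm (normRep n) = n.1 := n.2.2.choose_spec

variable [hb : Fact (b = 0 ∨ b = 1)]

/-- The elements `r` of the ring for which `v r` is integral form an ideal. It contains `τ(K)`,
which still generates the unit ideal, so it contains `1`. -/
theorem exists_incl_eq_of_primitive {K : AddSubgroup (IntRing b)} (hK : idealSpan K = ⊤)
    {v : RatField b} {t : Bool} (h : ∀ k ∈ K, ∃ z, v * tw t (incl b k) = incl b z) :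
    ∃ z, incl b z = v := by
  let I : Ideal (IntRing b) :=
    { carrier := {r | ∃ z, v * incl b r = incl b z}
      zero_mem' := ⟨0, by simp⟩
      add_mem' := by
        rintro x y ⟨z, hz⟩ ⟨w, hw⟩
        exact ⟨z + w, by rw [map_add, mul_add, hz, hw, map_add]⟩
      smul_mem' := by
        rintro r x ⟨z, hz⟩
        exact ⟨r * z, by rw [smul_eq_mul, map_mul, map_mul, mul_left_comm, hz]⟩ }
  have h1 : idealSpan (twist 1 t K) ≤ I := by
    refine Ideal.span_le.2 ?_
    rintro _ ⟨k, hk, rfl⟩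
    obtain ⟨z, hz⟩ := h k hk
    exact ⟨z, by simpa [incl_tw] using hz⟩
  rw [idealSpan_twist isUnit_one t hK] at h1
  obtain ⟨z, hz⟩ := h1 (Submodule.mem_top (x := 1))
  exact ⟨z, by rw [← hz, map_one, mul_one]⟩

/-- A similarity between primitive sublattices is given by a unit. -/
theorem exists_unit_of_similar {K K' : AddSubgroup (IntRing b)} (hK : idealSpan K = ⊤)
    (hK' : idealSpan K' = ⊤) {v : RatField b} (hv : v ≠ 0) {t : Bool}
    (h : ∀ k ∈ K, ∃ k' ∈ K', v * tw t (incl b k) = incl b k')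
    (h' : ∀ k' ∈ K', ∃ k ∈ K, v * tw t (incl b k) = incl b k') :
    ∃ w : (IntRing b)ˣ, incl b w = v ∧ twist w t K = K' := by
  obtain ⟨w, hw⟩ := exists_incl_eq_of_primitive hK fun k hk => by
    obtain ⟨k', -, h2⟩ := h k hk
    exact ⟨k', h2⟩
  -- The same argument for `v⁻¹`, which carries `K'` onto `τ(K)`, shows that `v⁻¹` is integral too,
  -- so `v` is a unit.
  obtain ⟨w', hw'⟩ := exists_incl_eq_of_primitive (v := v⁻¹) (t := false) hK' fun k' hk' => by
    obtain ⟨k, -, h2⟩ := h' k' hk'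
    exact ⟨tw t k, by rw [tw_false, ← h2, inv_mul_cancel_left₀ hv, incl_tw]⟩
  have hww : w * w' = 1 := incl_injective (by rw [map_mul, hw, hw', mul_inv_cancel₀ hv, map_one])
  refine ⟨⟨w, w', hww, by rw [mul_comm, hww]⟩, hw, ?_⟩
  have hinc : ∀ k, incl b (w * tw t k) = v * tw t (incl b k) := fun k => by
    rw [map_mul, hw, incl_tw]
  ext x
  rw [mem_twist]
  constructor
  · rintro ⟨k, hk, rfl⟩
    obtain ⟨k', hk', h2⟩ := h k hk
    have : w * tw t k = k' := incl_injective (by rw [hinc, h2])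
    rwa [this]
  · intro hx
    obtain ⟨k, hk, h2⟩ := h' x hx
    exact ⟨k, hk, incl_injective (by rw [hinc, h2])⟩

variable {V : Type*} [AddCommGroup V] [Module ℚ V] {Q : QuadraticForm ℚ V} {L : AddSubgroup V}
  (M : NormModel b Q L)

namespace NormModel

theorem image_iso_lat_eq_iff (u : {u : RatField b // u.norm = 1}) (t : Bool)
    {K K' : AddSubgroup (IntRing b)} : image (M.iso u t) (M.lat K) = M.lat K' ↔
      (∀ k ∈ K, ∃ k' ∈ K', u.1 * tw t (incl b k) = incl b k') ∧
        ∀ k' ∈ K', ∃ k ∈ K, u.1 * tw t (incl b k) = incl b k' := by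
  have hvec : ∀ {K : AddSubgroup (IntRing b)} {k}, M.vec k ∈ M.lat K ↔ k ∈ K := fun {K k} => by
    rw [lat_eq_map]
    exact AddSubgroup.mem_map_iff_mem M.vec_injective
  rw [le_antisymm_iff]
  refine and_congr ⟨fun h k hk => ?_, ?_⟩ ⟨fun h k' hk' => ?_, ?_⟩
  · obtain ⟨k', hk', h2⟩ := h ⟨M.vec k, hvec.2 hk, rfl⟩
    exact ⟨k', hk', by simpa using h2.symm⟩
  · rintro h _ ⟨x, ⟨k, hk, hkx⟩, rfl⟩
    obtain ⟨k', hk', h2⟩ := h k hk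
    replace hkx : incl b k = M.equiv x := hkx
    refine ⟨k', hk', ?_⟩
    change incl b k' = M.equiv (M.iso u t x)
    rw [← h2, hkx, equiv_iso]
  · obtain ⟨x, ⟨k, hk, hkx⟩, h2⟩ := h (hvec.2 hk')
    replace hkx : incl b k = M.equiv x := hkx
    replace h2 : M.iso u t x = M.vec k' := h2
    refine ⟨k, hk, ?_⟩
    rw [hkx, ← equiv_vec M k', ← h2, equiv_iso]
  · rintro h x ⟨k', hk', hx⟩
    obtain ⟨k, hk, h2⟩ := h k' hk'
    refine ⟨M.vec k, hvec.2 hk, M.equiv.injective ?_⟩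
    replace hx : incl b k' = M.equiv x := hx
    change M.equiv (M.iso u t (M.vec k)) = M.equiv x
    rw [← hx, ← h2, equiv_iso, equiv_vec]

theorem image_iso_lat_le_iff (u : {u : RatField b // u.norm = 1}) (t : Bool)
    {K : AddSubgroup (IntRing b)} : image (M.iso u t) (M.lat K) ≤ L ↔
      ∀ k ∈ K, ∃ z, u.1 * tw t (incl b k) = incl b z := by
  constructor
  · intro h k hk
    obtain ⟨z, hz⟩ := (M.mem_iff _).1 (h ⟨M.vec k, ⟨k, hk, by simp⟩, rfl⟩)
    refine ⟨z, hz.symm ▸ ?_⟩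
    rw [← equiv_vec M k]
    exact (M.equiv_iso u t _).symm
  · rintro h _ ⟨x, ⟨k, hk, hkx⟩, rfl⟩
    obtain ⟨z, hz⟩ := h k hk
    refine (M.mem_iff _).2 ⟨z, ?_⟩
    replace hkx : incl b k = M.equiv x := hkx
    change incl b z = M.equiv (M.iso u t x)
    rw [← hz, hkx, equiv_iso]

/-- An isometry between `αK` and `βK'` is given by a unit. -/
theorem image_iso_lat_scale_iff (u : {u : RatField b // u.norm = 1}) (t : Bool)
    {α β : IntRing b} (hα : α ≠ 0) (hβ : β ≠ 0) {K K' : PrimitiveSublattice b} :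
    image (M.iso u t) (M.lat (scale α K.1)) = M.lat (scale β K'.1) ↔
      ∃ w : (IntRing b)ˣ, u.1 * tw t (incl b α) = incl b (β * w) ∧ twist (w : IntRing b) t K.1 = K'.1 := by
  rw [image_iso_lat_eq_iff]
  have hβ' := incl_ne_zero hβ
  have hu0 : u.1 ≠ 0 := fun h => by
    have := u.2
    simp [h] at this
  have hv0 : u.1 * tw t (incl b α) / incl b β ≠ 0 :=
    div_ne_zero (mul_ne_zero hu0 ((map_ne_zero_iff _ (tw t).injective).2 (incl_ne_zero hα))) hβ'
  -- Division by `β` turns an isometry from `αK` to `βK'` into a similarity from `K` to `K'` with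
  -- multiplier `u τ(α) / β`.
  have hiff : ∀ k k' : IntRing b, u.1 * tw t (incl b (α * k)) = incl b (β * k') ↔
      u.1 * tw t (incl b α) / incl b β * tw t (incl b k) = incl b k' := fun k k' => by
    rw [map_mul, map_mul, map_mul, ← mul_assoc, div_mul_eq_mul_div, div_eq_iff hβ',
      mul_comm (incl b k')]
  constructor
  · rintro ⟨h1, h2⟩
    obtain ⟨w, hw, hwK⟩ := exists_unit_of_similar K.2.2 K'.2.2 hv0
      (fun k hk => by
        obtain ⟨_, ⟨k', hk', rfl⟩, h3⟩ := h1 _ ⟨k, hk, rfl⟩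
        exact ⟨k', hk', (hiff k k').1 h3⟩)
      (fun k' hk' => by
        obtain ⟨_, ⟨k, hk, rfl⟩, h3⟩ := h2 _ ⟨k', hk', rfl⟩
        exact ⟨k, hk, (hiff k k').1 h3⟩)
    refine ⟨w, ?_, hwK⟩
    rw [map_mul, hw, mul_div_cancel₀ _ hβ']
  · rintro ⟨w, hw, hwK⟩
    have key : ∀ k, u.1 * tw t (incl b (α * k)) = incl b (β * (w * tw t k)) := fun k => by
      rw [map_mul, map_mul, ← mul_assoc, hw, ← mul_assoc, map_mul _ (β * (w : IntRing b)), incl_tw]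
    constructor
    · rintro _ ⟨k, hk, rfl⟩
      exact ⟨_, ⟨w * tw t k, hwK ▸ ⟨k, hk, rfl⟩, rfl⟩, key k⟩
    · rintro _ ⟨k', hk', rfl⟩
      rw [SetLike.mem_coe, ← hwK] at hk'
      obtain ⟨k, hk, rfl⟩ := hk'
      exact ⟨_, ⟨k, hk, rfl⟩, key k⟩

/-- The orthogonal group if `c`, the proper orthogonal group otherwise. -/
def _root_.SubformZeta.isometryGroup (Q : QuadraticForm ℚ V) (c : Bool) : Subgroup (V ≃ₗ[ℚ] V) where
  carrier := {σ | σ ∈ if c then orthogonal Q else properOrthogonal Q}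
  one_mem' := Subgroup.one_mem _
  mul_mem' := Subgroup.mul_mem _
  inv_mem' := Subgroup.inv_mem _

theorem mem_isometryGroup {c : Bool} {σ : V ≃ₗ[ℚ] V} :
    σ ∈ isometryGroup Q c ↔ ∃ u, ∃ t ≤ c, M.iso u t = σ := by
  change (σ ∈ if c then orthogonal Q else properOrthogonal Q) ↔ _
  constructor
  · intro h
    have hσ : σ ∈ orthogonal Q := by
      cases c
      · exact h.1
      · exact h
    obtain ⟨u, t, rfl⟩ := M.exists_iso_eq hσ
    refine ⟨u, t, ?_, rfl⟩
    cases c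
    · exact ((M.iso_mem_properOrthogonal_iff u t).1 h).le
    · exact Bool.le_true t
  · rintro ⟨u, t, ht, rfl⟩
    cases c
    · exact (M.iso_mem_properOrthogonal_iff u t).2 (le_antisymm ht (Bool.false_le t))
    · exact M.iso_mem_orthogonal u t

/-- The unit `w` with `u τ(α) = β w` carries `K` to `K'` after the twist, and taking norms gives
`N(α) = N(β)`. Conversely, equal norms make `u = β w / τ(α)` an element of norm 1 for every `w`.
Norm and orbit thus vary independently, which makes the zeta function a product. -/
theorem equivalent_iff {c : Bool} {α β : IntRing b} (hα : α ≠ 0) (hβ : β ≠ 0)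
    {K K' : PrimitiveSublattice b} :
    (∃ σ ∈ isometryGroup Q c, image σ (M.lat (scale α K.1)) = M.lat (scale β K'.1)) ↔
      nrm α = nrm β ∧ (Quotient.mk _ K : PrimitiveOrbit b c) = Quotient.mk _ K' := by
  rw [primitiveOrbit_eq_iff]
  constructor
  · rintro ⟨σ, hσ, h⟩
    obtain ⟨u, t, ht, rfl⟩ := M.mem_isometryGroup.1 hσ
    obtain ⟨w, h1, h2⟩ := (M.image_iso_lat_scale_iff u t hα hβ).1 h
    refine ⟨?_, w, t, ht, h2⟩
    have h3 := congrArg QuadraticAlgebra.norm h1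
    rw [map_mul, u.2, one_mul, norm_tw, norm_incl, norm_incl, nrm_mul,
      isUnit_iff_nrm.1 w.isUnit, mul_one] at h3
    exact_mod_cast h3
  · rintro ⟨hn, w, t, ht, h2⟩
    have hα' : tw t (incl b α) ≠ 0 := (map_ne_zero_iff _ (tw t).injective).2 (incl_ne_zero hα)
    have hu : (incl b (β * w) / tw t (incl b α)).norm = 1 := by
      have h3 : (incl b (β * w) / tw t (incl b α) * tw t (incl b α)).norm =
          (tw t (incl b α)).norm := by
        rw [div_mul_cancel₀ _ hα', norm_incl, nrm_mul, isUnit_iff_nrm.1 w.isUnit, mul_one, norm_tw,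
          norm_incl, hn]
      rw [map_mul] at h3
      exact (mul_eq_right₀ (mt norm_eq_zero.1 hα')).1 h3
    refine ⟨M.iso ⟨_, hu⟩ t, M.mem_isometryGroup.2 ⟨_, t, ht, rfl⟩, ?_⟩
    exact (M.image_iso_lat_scale_iff _ t hα hβ).2 ⟨w, div_mul_cancel₀ _ hα', h2⟩

end NormModel

theorem normRep_ne_zero (n : NormValue b) : normRep n ≠ 0 := fun h => n.2.1 (by
  rw [← nrm_normRep, nrm_eq_zero, h])

namespace NormModel

/-- A sublattice representing the class with given norm and orbit. -/
noncomputable def classRep (c : Bool) (x : NormValue b × PrimitiveOrbit b c) : AddSubgroup V :=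
  M.lat (scale (normRep x.1) x.2.out.1)

theorem relIndex_classRep (c : Bool) (x : NormValue b × PrimitiveOrbit b c) :
    (M.classRep c x).relIndex L = x.1.1 * orbitIndex c x.2 := by
  rw [classRep, relIndex_lat, index_scale (normRep_ne_zero _), nrm_normRep]
  conv_rhs => rw [← Quotient.out_eq x.2, orbitIndex_mk]

/-- The class with given norm and orbit. -/
noncomputable def toClass (c : Bool) (m : ℕ)
    (x : {x : NormValue b × PrimitiveOrbit b c // x.1.1 * orbitIndex c x.2 = m}) :
    Quotient (sublatticeSetoid (isometryGroup Q c) L m) :=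
  Quotient.mk _ ⟨M.classRep c x.1, M.lat_le _, (M.relIndex_classRep c x.1).trans x.2⟩

theorem toClass_injective (c : Bool) (m : ℕ) : Function.Injective (M.toClass c m) := by
  intro x y h
  have h1 := (M.equivalent_iff (normRep_ne_zero x.1.1) (normRep_ne_zero y.1.1)).1 (Quotient.exact h)
  rw [nrm_normRep, nrm_normRep, Quotient.out_eq, Quotient.out_eq] at h1
  exact Subtype.ext (Prod.ext (Subtype.ext h1.1) h1.2)

theorem toClass_surjective (c : Bool) {m : ℕ} (hm : m ≠ 0) :
    Function.Surjective (M.toClass c m) := by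
  intro q
  obtain ⟨⟨H, hHL, hHm⟩, rfl⟩ := Quotient.exists_rep q
  obtain ⟨K, rfl⟩ := M.exists_lat_eq hHL
  have hK : K.index = m := by rw [← hHm, relIndex_lat]
  obtain ⟨α, hα'⟩ := IsPrincipalIdealRing.principal (idealSpan K)
  obtain ⟨hα0, K', rfl⟩ := exists_eq_scale (hK.trans_ne hm) hα'
  let n : NormValue b := ⟨nrm α, mt nrm_eq_zero.1 hα0, α, rfl⟩
  refine ⟨⟨(n, Quotient.mk _ K'), ?_⟩, Quotient.sound ?_⟩
  · rw [orbitIndex_mk, ← hK, index_scale hα0]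
  · exact (M.equivalent_iff (normRep_ne_zero _) hα0).2 ⟨nrm_normRep n, Quotient.out_eq _⟩

theorem card_classes (M : NormModel b Q L) (c : Bool) {m : ℕ} (hm : m ≠ 0) :
    classCount (isometryGroup Q c) L m =
      Nat.card {x : NormValue b × PrimitiveOrbit b c // x.1.1 * orbitIndex c x.2 = m} :=
  (Nat.card_congr (Equiv.ofBijective _ ⟨M.toClass_injective c m, M.toClass_surjective c hm⟩)).symm

end NormModel

/-- Classes correspond to pairs (norm, orbit of primitive sublattices), and the index of a class is
the product of the norm and the index of the orbit. -/
theorem NormModel.LSeries_classCount (M : NormModel b Q L) (c : Bool) {s : ℂ} (hs : 1 < s.re)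
    (h : ZetaSummable (orbitIndex (b := b) c) s) :
    LSeriesSummable (fun m => (classCount (isometryGroup Q c) L m : ℂ)) s ∧
      LSeries (fun m => (classCount (isometryGroup Q c) L m : ℂ)) s =
        normZeta b s * orbitZeta b c s := by
  have hn := zetaSummable_normValue (b := b) hs
  have key :=  LSeriesHasSum_of_zetaSummable
    (g := fun x : NormValue b × PrimitiveOrbit b c => x.1.1 * orbitIndex c x.2) (fun x => mul_ne_zero x.1.2.1 (orbitIndex_ne_zero c x.2))
    (hn.prod h) (a := fun m => (classCount (isometryGroup Q c) L m : ℂ))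
    fun m hm => by rw [M.card_classes c hm]
  exact ⟨key.1, key.2.trans (zetaSeries_prod hn h)⟩

end Classes

end SubformZeta

namespace SubformZeta

/-! ### Units -/

section Units

instance factZero : Fact ((0 : ℤ) = 0 ∨ (0 : ℤ) = 1) := ⟨Or.inl rfl⟩

instance factOne : Fact ((1 : ℤ) = 0 ∨ (1 : ℤ) = 1) := ⟨Or.inr rfl⟩

theorem nrm_eq_one_iff_zero (x : IntRing 0) :
    nrm x = 1 ↔ x = ⟨1, 0⟩ ∨ x = ⟨-1, 0⟩ ∨ x = ⟨0, 1⟩ ∨ x = ⟨0, -1⟩ := by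
  constructor
  · intro h
    have h1 : x.norm = 1 := by rw [← coe_nrm, h]; rfl
    rw [QuadraticAlgebra.norm_def] at h1
    have hre : x.re ^ 2 ≤ 1 := by nlinarith [sq_nonneg x.im]
    have him : x.im ^ 2 ≤ 1 := by nlinarith [sq_nonneg x.re]
    obtain ⟨r, i⟩ := x
    simp only at h1 hre him
    have : r ≤ 1 := by nlinarith
    have : -1 ≤ r := by nlinarith
    have : i ≤ 1 := by nlinarith
    have : -1 ≤ i := by nlinarith
    interval_cases r <;> interval_cases i <;> simp_all
  · rintro (rfl | rfl | rfl | rfl) <;> simp [nrm, QuadraticAlgebra.norm_def]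

theorem nrm_eq_one_iff_one (x : IntRing 1) :
    nrm x = 1 ↔ x = ⟨1, 0⟩ ∨ x = ⟨-1, 0⟩ ∨ x = ⟨0, 1⟩ ∨ x = ⟨0, -1⟩ ∨ x = ⟨1, -1⟩ ∨ x = ⟨-1, 1⟩ := by
  constructor
  · intro h
    have h1 : x.norm = 1 := by rw [← coe_nrm, h]; rfl
    rw [QuadraticAlgebra.norm_def] at h1
    -- This uses `4 N(x) = 3 re² + (re + 2 im)²`, and its mirror image bounds the other coordinate.
    have hre : 3 * x.re ^ 2 ≤ 4 := by nlinarith [sq_nonneg (x.re + 2 * x.im)]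
    have him : 3 * x.im ^ 2 ≤ 4 := by nlinarith [sq_nonneg (2 * x.re + x.im)]
    obtain ⟨r, i⟩ := x
    simp only at h1 hre him
    have : r ≤ 1 := by nlinarith
    have : -1 ≤ r := by nlinarith
    have : i ≤ 1 := by nlinarith
    have : -1 ≤ i := by nlinarith
    interval_cases r <;> interval_cases i <;> simp_all
  · rintro (rfl | rfl | rfl | rfl | rfl | rfl) <;> simp [nrm, QuadraticAlgebra.norm_def]

theorem sum_units {b : ℤ} [Fintype (IntRing b)ˣ] {T : Finset (IntRing b)}
    (hT : ∀ x, nrm x = 1 ↔ x ∈ T) (f : IntRing b → ℂ) :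
    ∑ u : (IntRing b)ˣ, f u = ∑ x ∈ T, f x := by
  refine (Finset.sum_map Finset.univ ⟨Units.val, Units.val_injective⟩ f).symm.trans ?_
  refine Finset.sum_congr ?_ fun _ _ => rfl
  ext x
  rw [← hT, ← isUnit_iff_nrm]
  simp [IsUnit]

theorem sum_units_zero [Fintype (IntRing 0)ˣ] (f : IntRing 0 → ℂ) :
    ∑ u : (IntRing 0)ˣ, f u = f ⟨1, 0⟩ + f ⟨-1, 0⟩ + f ⟨0, 1⟩ + f ⟨0, -1⟩ := by
  classical
  rw [sum_units (T := {⟨1, 0⟩, ⟨-1, 0⟩, ⟨0, 1⟩, ⟨0, -1⟩}) (by simpa using nrm_eq_one_iff_zero)]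
  rw [Finset.sum_insert (by simp), Finset.sum_insert (by simp), Finset.sum_insert (by simp),
    Finset.sum_singleton]
  ring

theorem sum_units_one [Fintype (IntRing 1)ˣ] (f : IntRing 1 → ℂ) :
    ∑ u : (IntRing 1)ˣ, f u =
      f ⟨1, 0⟩ + f ⟨-1, 0⟩ + f ⟨0, 1⟩ + f ⟨0, -1⟩ + f ⟨1, -1⟩ + f ⟨-1, 1⟩ := by
  classical
  rw [sum_units (T := {⟨1, 0⟩, ⟨-1, 0⟩, ⟨0, 1⟩, ⟨0, -1⟩, ⟨1, -1⟩, ⟨-1, 1⟩})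
    (by simpa using nrm_eq_one_iff_one)]
  rw [Finset.sum_insert (by simp), Finset.sum_insert (by simp), Finset.sum_insert (by simp),
    Finset.sum_insert (by simp), Finset.sum_insert (by simp), Finset.sum_singleton]
  ring

theorem card_units_zero [Fintype (IntRing 0)ˣ] : (Fintype.card (IntRing 0)ˣ : ℂ) = 4 := by
  have := sum_units_zero fun _ => 1
  simp at this
  rw [this]; norm_num

theorem card_units_one [Fintype (IntRing 1)ˣ] : (Fintype.card (IntRing 1)ˣ : ℂ) = 6 := by
  have := sum_units_one fun _ => 1
  simp at this
  rw [this]; norm_num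

instance finite_units (b : ℤ) [hb : Fact (b = 0 ∨ b = 1)] : Finite (IntRing b)ˣ := by
  classical
  have : ∃ T : Finset (IntRing b), ∀ x, nrm x = 1 ↔ x ∈ T := by
    rcases hb.out with rfl | rfl
    · exact ⟨{⟨1, 0⟩, ⟨-1, 0⟩, ⟨0, 1⟩, ⟨0, -1⟩}, by simpa using nrm_eq_one_iff_zero⟩
    · exact ⟨{⟨1, 0⟩, ⟨-1, 0⟩, ⟨0, 1⟩, ⟨0, -1⟩, ⟨1, -1⟩, ⟨-1, 1⟩},
        by simpa using nrm_eq_one_iff_one⟩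
  obtain ⟨T, hT⟩ := this
  exact Finite.of_injective (fun u : (IntRing b)ˣ => (⟨u, (hT _).1 (isUnit_iff_nrm.1 u.isUnit)⟩ : T))
    fun u v h => Units.ext (congrArg Subtype.val h)

end Units

/-! ### Rotations fixing a primitive sublattice -/

section Rotations

variable {b : ℤ}

theorem fixedZeta_one (s : ℂ) : fixedZeta (1 : IntRing b) false s = primitiveZeta b s := by
  unfold fixedZeta primitiveZeta
  refine zetaSeries_congr (Equiv.subtypeUnivEquiv fun K : PrimitiveSublattice b => twist_one_false K.1) (fun _ => ?_) s
  rfl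

/-- Subgroups are closed under negation, so only units up to sign matter for invariance. -/
theorem twist_neg (u : IntRing b) (t : Bool) (K : AddSubgroup (IntRing b)) :
    twist (-u) t K = twist u t K := by
  ext x
  rw [mem_twist, mem_twist]
  constructor
  all_goals
    rintro ⟨k, hk, rfl⟩
    exact ⟨-k, K.neg_mem hk, by simp⟩

theorem fixedZeta_neg (u : IntRing b) (t : Bool) (s : ℂ) : fixedZeta (-u) t s = fixedZeta u t s := by
  unfold fixedZeta
  refine zetaSeries_congr (Equiv.subtypeEquivRight fun K : PrimitiveSublattice b => ?_)
    (fun _ => ?_) s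
  · rw [twist_neg]
  · rfl

/-- Stability under `r + ω` and under integers gives stability under `ω`, so `K` is an ideal; being
primitive, it is the whole ring. -/
theorem eq_top_of_twist_eq {K : AddSubgroup (IntRing b)} (hK : idealSpan K = ⊤) {r : ℤ}
    (h : twist (⟨r, 1⟩ : IntRing b) false K = K) : K = ⊤ := by
  have hω : ∀ k ∈ K, (⟨0, 1⟩ : IntRing b) * k ∈ K := fun k hk => by
    have h1 : (⟨r, 1⟩ : IntRing b) * k ∈ K := by
      have h3 : (⟨r, 1⟩ : IntRing b) * k ∈ twist (⟨r, 1⟩ : IntRing b) false K := ⟨k, hk, rfl⟩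
      rwa [h] at h3
    have h2 : (⟨0, 1⟩ : IntRing b) * k = (⟨r, 1⟩ : IntRing b) * k - r • k := by
      ext <;> (simp; try ring)
    rw [h2]
    exact K.sub_mem h1 (K.zsmul_mem hk r)
  let I : Ideal (IntRing b) :=
    { K.toAddSubmonoid with
      smul_mem' := fun z k hk => by
        have h2 : z • k = z.re • k + z.im • ((⟨0, 1⟩ : IntRing b) * k) := by
          ext <;> (simp; try ring)
        rw [h2]
        exact K.add_mem (K.zsmul_mem hk _) (K.zsmul_mem (hω k hk) _) }
  have h1 : idealSpan K ≤ I := Ideal.span_le.2 fun k hk => hk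
  rw [hK] at h1
  exact eq_top_iff.2 fun x _ => h1 (Submodule.mem_top (x := x))

theorem fixedZeta_eq_one {r : ℤ} (hu : IsUnit (⟨r, 1⟩ : IntRing b)) (s : ℂ) :
    fixedZeta (⟨r, 1⟩ : IntRing b) false s = 1 := by
  let _ : Unique {K : PrimitiveSublattice b // twist (⟨r, 1⟩ : IntRing b) false K.1 = K.1} :=
    { default := ⟨⟨⊤, by simp, Ideal.span_eq ⊤⟩, (twist_eq_iff hu _).2 fun _ => by simp⟩
      uniq := fun K => Subtype.ext (Subtype.ext (eq_top_of_twist_eq K.1.2.2 K.2)) }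
  exact zetaSeries_unique AddSubgroup.index_top s

end Rotations

/-! ### Burnside's lemma for the unit groups of order 4 and 6. -/

section OrbitZeta

variable {s : ℂ}

theorem orbitZeta_false {b : ℤ} [Fintype (IntRing b)ˣ]
    (hs : ZetaSummable (fun K : PrimitiveSublattice b => K.1.index) s) :
    Fintype.card (IntRing b)ˣ * orbitZeta b false s =
      ∑ u : (IntRing b)ˣ, fixedZeta (u : IntRing b) false s := by
  have h := (burnside_primitive false hs).2
  rw [show Fintype.card {t : Bool // t ≤ false} = 1 from rfl, Nat.cast_one, mul_one] at h
  refine h.trans (Finset.sum_congr rfl fun u _ => ?_)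
  exact Fintype.sum_eq_single (⟨false, le_rfl⟩ : {t : Bool // t ≤ false})
    fun t ht => absurd (Subtype.ext (le_antisymm t.2 (Bool.false_le t.1))) ht

theorem orbitZeta_true {b : ℤ} [Fintype (IntRing b)ˣ]
    (hs : ZetaSummable (fun K : PrimitiveSublattice b => K.1.index) s) :
    2 * Fintype.card (IntRing b)ˣ * orbitZeta b true s =
      ∑ u : (IntRing b)ˣ, fixedZeta (u : IntRing b) false s +
        ∑ u : (IntRing b)ˣ, fixedZeta (u : IntRing b) true s := by
  have h := (burnside_primitive true hs).2
  rw [show Fintype.card {t : Bool // t ≤ true} = 2 from rfl, mul_comm _ ((2 : ℕ) : ℂ)] at h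
  refine h.trans ?_
  rw [← Finset.sum_add_distrib]
  refine Finset.sum_congr rfl fun u _ => ?_
  refine ((Equiv.subtypeUnivEquiv Bool.le_true).sum_comp
    fun t => fixedZeta (u : IntRing b) t s).trans ?_
  rw [Fintype.sum_bool, add_comm]

/-- The sum of the zeta functions of the reflection-invariant primitive sublattices. -/
noncomputable def invariantZeta (b : ℤ) [Fintype (IntRing b)ˣ] (s : ℂ) : ℂ :=
  ∑ u : (IntRing b)ˣ, fixedZeta (u : IntRing b) true s

/-- The rotations `±1` fix all primitive sublattices and `±i` fix only the full ring. -/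
theorem orbitZeta_zero [Fintype (IntRing 0)ˣ]
    (hs : ZetaSummable (fun K : PrimitiveSublattice 0 => K.1.index) s) :
    4 * orbitZeta 0 false s = 2 * primitiveZeta 0 s + 2 ∧
      8 * orbitZeta 0 true s = 2 * primitiveZeta 0 s + 2 + invariantZeta 0 s := by
  have hrot : ∑ u : (IntRing 0)ˣ, fixedZeta (u : IntRing 0) false s = 2 * primitiveZeta 0 s + 2 := by
    rw [sum_units_zero fun u => fixedZeta u false s]
    have e1 : (⟨1, 0⟩ : IntRing 0) = 1 := rfl
    have e2 : (⟨-1, 0⟩ : IntRing 0) = -1 := rfl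
    have e3 : (⟨0, -1⟩ : IntRing 0) = -⟨0, 1⟩ := rfl
    rw [e1, e2, e3, fixedZeta_neg, fixedZeta_neg, fixedZeta_one, fixedZeta_eq_one
      (isUnit_iff_nrm.2 ((nrm_eq_one_iff_zero _).2 (by simp)))]
    ring
  have h1 := orbitZeta_false hs
  have h2 := orbitZeta_true hs
  rw [hrot, card_units_zero] at h1 h2
  exact ⟨h1, by rw [invariantZeta, ← h2]; ring⟩

/-- The rotations `±1` fix all primitive sublattices, while the four units `±ω` and `±(ω - 1)` fix
only the full ring. -/
theorem orbitZeta_one [Fintype (IntRing 1)ˣ]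
    (hs : ZetaSummable (fun K : PrimitiveSublattice 1 => K.1.index) s) :
    6 * orbitZeta 1 false s = 2 * primitiveZeta 1 s + 4 ∧
      12 * orbitZeta 1 true s = 2 * primitiveZeta 1 s + 4 + invariantZeta 1 s := by
  have hrot : ∑ u : (IntRing 1)ˣ, fixedZeta (u : IntRing 1) false s = 2 * primitiveZeta 1 s + 4 := by
    rw [sum_units_one fun u => fixedZeta u false s]
    have e1 : (⟨1, 0⟩ : IntRing 1) = 1 := rfl
    have e2 : (⟨-1, 0⟩ : IntRing 1) = -1 := rfl
    have e3 : (⟨0, -1⟩ : IntRing 1) = -⟨0, 1⟩ := rfl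
    have e4 : (⟨1, -1⟩ : IntRing 1) = -⟨-1, 1⟩ := rfl
    rw [e1, e2, e3, e4, fixedZeta_neg, fixedZeta_neg, fixedZeta_neg, fixedZeta_one, fixedZeta_eq_one
      (isUnit_iff_nrm.2 ((nrm_eq_one_iff_one _).2 (by simp))), fixedZeta_eq_one
      (isUnit_iff_nrm.2 ((nrm_eq_one_iff_one _).2 (by simp)))]
    ring
  have h1 := orbitZeta_false hs
  have h2 := orbitZeta_true hs
  rw [hrot, card_units_one] at h1 h2
  exact ⟨h1, by rw [invariantZeta, ← h2]; ring⟩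

end OrbitZeta

end SubformZeta

namespace SubformZeta

/-! ### Reflection terms -/

section Reflections

variable {b : ℤ}

theorem tw_incl_ne_zero {α : IntRing b} (hα : α ≠ 0) (t : Bool) : tw t (incl b α) ≠ 0 :=
  (map_ne_zero_iff _ (tw t).injective).2 (incl_ne_zero hα)

variable [hb : Fact (b = 0 ∨ b = 1)] {V : Type*} [AddCommGroup V] [Module ℚ V]
  {Q : QuadraticForm ℚ V} {L : AddSubgroup V} (M : NormModel b Q L)

/-- The number of elements of given norm. -/
noncomputable def repCount (b : ℤ) (n : ℕ) : ℕ := Nat.card {β : IntRing b // nrm β = n}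

/-- The number of ideals of given norm. -/
noncomputable def idealCount (b : ℤ) [Fact (b = 0 ∨ b = 1)] (n : ℕ) : ℕ :=
  Nat.card {I : NonzeroIdeal (IntRing b) // Ideal.absNorm I.1 = n}

theorem norm_div_eq_one {x y : RatField b} (hy : y ≠ 0) (h : x.norm = y.norm) :
    (x / y).norm = 1 := by
  have h3 : (x / y * y).norm = y.norm := by rw [div_mul_cancel₀ _ hy, h]
  rw [map_mul] at h3
  exact (mul_eq_right₀ (mt norm_eq_zero.1 hy)).1 h3

namespace NormModel

/-- By primitivity of `K`, integrality of `u τ(αK)` is already integrality of the single element `u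
τ(α)`. -/
theorem image_iso_lat_scale_le_iff (u : {u : RatField b // u.norm = 1}) (t : Bool)
    {α : IntRing b} {K : PrimitiveSublattice b} :
    image (M.iso u t) (M.lat (scale α K.1)) ≤ L ↔ ∃ β, incl b β = u.1 * tw t (incl b α) := by
  rw [image_iso_lat_le_iff]
  constructor
  · intro h
    refine exists_incl_eq_of_primitive K.2.2 (t := t) fun k hk => ?_
    obtain ⟨z, hz⟩ := h _ ⟨k, hk, rfl⟩
    exact ⟨z, by rw [← hz, AddMonoidHom.coe_mulLeft, map_mul, map_mul, mul_assoc]⟩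
  · rintro ⟨β, hβ⟩ _ ⟨k, hk, rfl⟩
    exact ⟨β * tw t k, by
      rw [AddMonoidHom.coe_mulLeft, map_mul, map_mul, map_mul, ← mul_assoc, hβ, incl_tw]⟩

/-- An isometry `u τ` taking `αK` into `L` is determined by `τ` and `β = u τ(α)`. Here `β` is an
arbitrary element of norm `N(α)`, and the factor 2 counts the choices of `τ`. -/
theorem card_isometries {α : IntRing b} (hα : α ≠ 0) (K : PrimitiveSublattice b) :
    Nat.card {σ : V ≃ₗ[ℚ] V // σ ∈ orthogonal Q ∧ image σ (M.lat (scale α K.1)) ≤ L} =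
      2 * repCount b (nrm α) := by
  have hu : ∀ (β : {β : IntRing b // nrm β = nrm α}) (t : Bool),
      (incl b β.1 / tw t (incl b α)).norm = 1 := fun β t =>
    norm_div_eq_one (tw_incl_ne_zero hα t) (by rw [norm_incl, norm_tw, norm_incl, β.2])
  have h2 : Nat.card (Bool × {β : IntRing b // nrm β = nrm α}) = 2 * repCount b (nrm α) := by
    rw [Nat.card_prod, repCount]
    simp
  rw [← h2]
  refine (Nat.card_congr (Equiv.ofBijective (fun p : Bool × {β : IntRing b // nrm β = nrm α} =>
    ⟨M.iso ⟨_, hu p.2 p.1⟩ p.1, M.iso_mem_orthogonal _ _,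
      (M.image_iso_lat_scale_le_iff _ _).2 ⟨p.2.1, (div_mul_cancel₀ _ (tw_incl_ne_zero hα p.1)).symm⟩⟩)
    ⟨?_, ?_⟩)).symm
  · rintro ⟨t, β⟩ ⟨t', β'⟩ h
    have h1 : M.iso ⟨_, hu β t⟩ t = M.iso ⟨_, hu β' t'⟩ t' := congrArg Subtype.val h
    have h3 := M.iso_bijective.1 (a₁ := (⟨_, hu β t⟩, t)) (a₂ := (⟨_, hu β' t'⟩, t'))
      (Subtype.ext h1)
    rw [Prod.mk.injEq, Subtype.mk.injEq] at h3
    obtain ⟨h4, rfl⟩ := h3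
    have h5 := incl_injective ((div_left_inj' (tw_incl_ne_zero hα t)).1 h4)
    rw [Subtype.ext h5]
  · rintro ⟨σ, hσ, hσL⟩
    obtain ⟨u, t, rfl⟩ := M.exists_iso_eq hσ
    obtain ⟨β, hβ⟩ := (M.image_iso_lat_scale_le_iff u t).1 hσL
    have hβn : nrm β = nrm α := by
      have := congrArg QuadraticAlgebra.norm hβ
      rw [map_mul, u.2, one_mul, norm_tw, norm_incl, norm_incl] at this
      exact_mod_cast this
    refine ⟨(t, ⟨β, hβn⟩), Subtype.ext ?_⟩
    change M.iso ⟨_, hu ⟨β, hβn⟩ t⟩ t = M.iso u t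
    congr 1
    apply Subtype.ext
    change incl b β / _ = _
    rw [hβ, mul_div_cancel_right₀ _ (tw_incl_ne_zero hα t)]

theorem summand_lat_scale {α : IntRing b} (hα : α ≠ 0) (K : PrimitiveSublattice b) (s : ℂ) :
    summand Q L s (M.lat (scale α K.1)) =
      (nrm α : ℂ) ^ (-s) / (2 * repCount b (nrm α)) * (K.1.index : ℂ) ^ (-s) := by
  rw [summand, M.card_isometries hα, relIndex_lat, index_scale hα, Nat.cast_mul,
    Complex.natCast_mul_natCast_cpow, Nat.cast_mul, Nat.cast_ofNat]
  ring

/-- Pairs of a unit `w` and a primitive sublattice `K` with `w * conj K = K`. -/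
abbrev _root_.SubformZeta.InvariantPair (b : ℤ) : Type :=
  Σ w : (IntRing b)ˣ, {K : PrimitiveSublattice b // twist (w : IntRing b) true K.1 = K.1}

/-- The element `α w / conj(α)` of norm one. -/
noncomputable def _root_.SubformZeta.reflUnit (I : NonzeroIdeal (IntRing b)) (w : (IntRing b)ˣ) :
    {u : RatField b // u.norm = 1} :=
  ⟨incl b (gen I * w) / tw true (incl b (gen I)),
    norm_div_eq_one (tw_incl_ne_zero (gen_ne_zero I) true) (by
      rw [norm_incl, norm_tw, norm_incl, nrm_mul, isUnit_iff_nrm.1 w.isUnit, mul_one])⟩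

theorem _root_.SubformZeta.reflUnit_injective (I : NonzeroIdeal (IntRing b)) :
    Function.Injective (reflUnit I) := fun w w' h => by
  have h1 : incl b (gen I * w) / tw true (incl b (gen I)) =
    incl b (gen I * w') / tw true (incl b (gen I)) := congrArg Subtype.val h
  have h5 := incl_injective ((div_left_inj' (tw_incl_ne_zero (gen_ne_zero I) true)).1 h1)
  exact Units.ext (mul_left_cancel₀ (gen_ne_zero I) h5)

theorem iso_inj {u v : {u : RatField b // u.norm = 1}} {t t' : Bool}
    (h : M.iso u t = M.iso v t') : u = v ∧ t = t' :=
  Prod.mk.injEq u t v t' ▸ M.iso_bijective.1 (a₁ := (u, t)) (a₂ := (v, t')) (Subtype.ext h)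

/-- The reflection `x ↦ α w conj(x / α)`. -/
noncomputable def reflAt (I : NonzeroIdeal (IntRing b)) (w : (IntRing b)ˣ) : V ≃ₗ[ℚ] V :=
  M.iso (reflUnit I w) true

theorem reflAt_mem (I : NonzeroIdeal (IntRing b)) (w : (IntRing b)ˣ) :
    M.reflAt I w ∈ reflections Q :=
  ⟨M.iso_mem_orthogonal _ _, fun h => Bool.noConfusion ((M.iso_mem_properOrthogonal_iff _ _).1 h)⟩

theorem index_scale_gen_ne_zero (I : NonzeroIdeal (IntRing b)) (K : PrimitiveSublattice b) :
    (scale (gen I) K.1).index ≠ 0 := by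
  rw [index_scale (gen_ne_zero I)]
  exact mul_ne_zero (mt nrm_eq_zero.1 (gen_ne_zero I)) K.2.1

theorem image_reflAt (I : NonzeroIdeal (IntRing b)) (x : InvariantPair b) :
    image (M.reflAt I x.1) (M.lat (scale (gen I) x.2.1.1)) = M.lat (scale (gen I) x.2.1.1) :=
  (M.image_iso_lat_scale_iff _ _ (gen_ne_zero I) (gen_ne_zero I)).2
    ⟨x.1, div_mul_cancel₀ _ (tw_incl_ne_zero (gen_ne_zero I) true), x.2.2⟩

/-- The parametrisation of the terms of the reflection sum. -/
noncomputable def reflParam (p : NonzeroIdeal (IntRing b) × InvariantPair b) :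
    Σ ρ : reflections Q, InvariantSublattice L ρ.1 :=
  ⟨⟨M.reflAt p.1 p.2.1, M.reflAt_mem _ _⟩, M.lat (scale (gen p.1) p.2.2.1.1), M.lat_le _, by
    rw [relIndex_lat]; exact index_scale_gen_ne_zero _ _, M.image_reflAt p.1 p.2⟩

theorem sigma_ext {x y : Σ ρ : reflections Q, InvariantSublattice L ρ.1} (h1 : x.1.1 = y.1.1)
    (h2 : x.2.1 = y.2.1) : x = y := by
  obtain ⟨⟨ρ, hρ⟩, K, hK⟩ := x
  obtain ⟨⟨ρ', hρ'⟩, K', hK'⟩ := y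
  obtain rfl : ρ = ρ' := h1
  obtain rfl : K = K' := h2
  rfl

/-- Writing the invariant sublattice as `αK`, invariance under `x ↦ u conj(x)` yields a unit `w`
with `u conj(α) = α w` and `w conj(K) = K`. -/
theorem exists_eq_reflAt {ρ : V ≃ₗ[ℚ] V} (hρ : ρ ∈ reflections Q) {H : AddSubgroup V}
    (hHL : H ≤ L) (hH0 : H.relIndex L ≠ 0) (hH : image ρ H = H) :
    ∃ p : NonzeroIdeal (IntRing b) × InvariantPair b,
      M.reflAt p.1 p.2.1 = ρ ∧ M.lat (scale (gen p.1) p.2.2.1.1) = H := by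
  obtain ⟨u, t, rfl⟩ := M.exists_iso_eq hρ.1
  have ht : t = true := by
    have := hρ.2
    rw [M.iso_mem_properOrthogonal_iff] at this
    simpa using this
  subst ht
  obtain ⟨K, rfl⟩ := M.exists_lat_eq hHL
  rw [relIndex_lat] at hH0
  obtain ⟨⟨I, K'⟩, hIK⟩ := scale_gen_bijective.2 ⟨K, hH0⟩
  have hK : scale (gen I) K'.1 = K := congrArg Subtype.val hIK
  rw [← hK] at hH
  obtain ⟨w, h1, h2⟩ := (M.image_iso_lat_scale_iff u true (gen_ne_zero I) (gen_ne_zero I)).1 hH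
  refine ⟨(I, ⟨w, K', h2⟩), ?_, congrArg M.lat hK⟩
  have h3 : reflUnit I w = u := by
    apply Subtype.ext
    change incl b (gen I * w) / _ = _
    rw [← h1, mul_div_cancel_right₀ _ (tw_incl_ne_zero (gen_ne_zero I) true)]
  rw [reflAt, h3]

/-- The sublattice determines the ideal and the primitive factor; with these known, the reflection
determines the unit. -/
theorem reflParam_bijective : Function.Bijective M.reflParam := by
  constructor
  · rintro ⟨I, w, K, hK⟩ ⟨I', w', K', hK'⟩ h
    have h1 : M.reflAt I w = M.reflAt I' w' := congrArg (fun x => x.1.1) h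
    have h2 : M.lat (scale (gen I) K.1) = M.lat (scale (gen I') K'.1) :=
      congrArg (fun x => x.2.1) h
    have h3 := scale_gen_bijective.1 (a₁ := (I, K)) (a₂ := (I', K'))
      (Subtype.ext (M.lat_injective h2))
    rw [Prod.mk.injEq] at h3
    obtain ⟨rfl, rfl⟩ := h3
    obtain rfl := reflUnit_injective I (M.iso_inj h1).1
    rfl
  · rintro ⟨⟨ρ, hρ⟩, H, hHL, hH0, hH⟩
    obtain ⟨p, h1, h2⟩ := M.exists_eq_reflAt hρ hHL hH0 hH
    exact ⟨p, sigma_ext h1 h2⟩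

end NormModel

theorem finite_absNorm_eq (n : ℕ) :
    Finite {I : NonzeroIdeal (IntRing b) // Ideal.absNorm I.1 = n} := by
  have := (Ideal.finite_setOfPred_absNorm_eq (S := IntRing b) n).to_subtype
  exact Finite.of_injective (fun I => (⟨I.1.1, I.2⟩ : {I : Ideal (IntRing b) | Ideal.absNorm I = n}))
    fun I J h => Subtype.ext (Subtype.ext (by simpa using h))

/-- Every nonzero element is a unit times the chosen generator of the ideal that it generates. -/
theorem repCount_eq {n : ℕ} (hn : n ≠ 0) :
    repCount b n = Nat.card (IntRing b)ˣ * idealCount b n := by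
  rw [repCount, idealCount, mul_comm, ← Nat.card_prod]
  refine (Nat.card_congr (Equiv.ofBijective (fun p => ⟨gen p.1.1 * p.2, by
    rw [nrm_mul, isUnit_iff_nrm.1 p.2.isUnit, mul_one, nrm_gen, p.1.2]⟩) ⟨?_, ?_⟩)).symm
  · rintro ⟨⟨I, hI⟩, w⟩ ⟨⟨J, hJ⟩, w'⟩ h
    have h1 : gen I * w = gen J * w' := congrArg Subtype.val h
    have h2 : I = J := by
      apply Subtype.ext
      rw [← span_gen I, ← span_gen J, ← Ideal.span_singleton_mul_right_unit w.isUnit, h1,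
        Ideal.span_singleton_mul_right_unit w'.isUnit]
    subst h2
    obtain rfl : w = w' := Units.ext (mul_left_cancel₀ (gen_ne_zero I) h1)
    rfl
  · rintro ⟨β, hβ⟩
    have hβ0 : β ≠ 0 := by
      rintro rfl
      exact hn (by rw [← hβ]; exact nrm_eq_zero.2 rfl)
    let I : NonzeroIdeal (IntRing b) := ⟨Ideal.span {β}, by simpa using hβ0⟩
    have hI : Ideal.span {gen I} = Ideal.span {β} := span_gen I
    obtain ⟨w, hw⟩ := Ideal.span_singleton_eq_span_singleton.1 hI
    exact ⟨(⟨I, by rw [absNorm_span, hβ]⟩, w), Subtype.ext hw⟩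

theorem idealCount_ne_zero (n : NormValue b) : idealCount b n.1 ≠ 0 := by
  have := finite_absNorm_eq (b := b) n.1
  obtain ⟨n, hn, α, hα⟩ := n
  have : Nonempty {I : NonzeroIdeal (IntRing b) // Ideal.absNorm I.1 = n} :=
    ⟨⟨Ideal.span {α}, by
      have : α ≠ 0 := by
        rintro rfl
        exact hn (by rw [← hα]; exact nrm_eq_zero.2 rfl)
      simpa using this⟩, by rw [absNorm_span, hα]⟩
  exact Nat.card_pos.ne'

theorem absNorm_ne_zero (I : NonzeroIdeal (IntRing b)) : Ideal.absNorm I.1 ≠ 0 := by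
  rw [← nrm_gen]
  exact mt nrm_eq_zero.1 (gen_ne_zero I)

/-- Each ideal of norm `n` has weight `n^{-s}` divided by `2 · #units · idealCount n`, so the ideals
of norm `n` together contribute `n^{-s} / (2 · #units)`. Each norm is counted once, so the series is
dominated by that of `ζ` and `Re s > 1` suffices. -/
theorem hasSum_ideals {s : ℂ} (hs : 1 < s.re) :
    HasSum (fun I : NonzeroIdeal (IntRing b) =>
      (Ideal.absNorm I.1 : ℂ) ^ (-s) / (2 * repCount b (Ideal.absNorm I.1)))
      (normZeta b s / (2 * Nat.card (IntRing b)ˣ)) := by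
  let f : NonzeroIdeal (IntRing b) → NormValue b := fun I =>
    ⟨Ideal.absNorm I.1, absNorm_ne_zero I, gen I, nrm_gen I⟩
  have hw : (Nat.card (IntRing b)ˣ : ℂ) ≠ 0 := Nat.cast_ne_zero.2 Nat.card_pos.ne'
  have hcard : ∀ n : NormValue b, Nat.card {I // f I = n} = idealCount b n.1 := fun n =>
    Nat.card_congr (Equiv.subtypeEquivRight fun I => Subtype.ext_iff)
  have hfin : ∀ n : NormValue b, Finite {I // f I = n} := fun n =>
    Nat.finite_of_card_ne_zero (by rw [hcard]; exact idealCount_ne_zero n)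
  have hterm : ∀ n : NormValue b, HasSum (fun I : {I // f I = n} =>
      (Ideal.absNorm I.1.1 : ℂ) ^ (-s) / (2 * repCount b (Ideal.absNorm I.1.1)))
      ((n.1 : ℂ) ^ (-s) / (2 * Nat.card (IntRing b)ˣ)) := fun n => by
    have := Fintype.ofFinite {I // f I = n}
    convert hasSum_fintype _
    have h1 : ∀ I : {I // f I = n}, Ideal.absNorm I.1.1 = n.1 := fun I => congrArg Subtype.val I.2
    have h2 : (idealCount b n.1 : ℂ) ≠ 0 := Nat.cast_ne_zero.2 (idealCount_ne_zero n)
    simp only [h1, Finset.sum_const, Finset.card_univ, nsmul_eq_mul]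
    rw [← Nat.card_eq_fintype_card, hcard, repCount_eq n.2.1, Nat.cast_mul]
    field_simp
  -- The same fibrewise sum with absolute values yields absolute convergence over all ideals, which
  -- justifies grouping them by norm.
  have hnorm : ∀ n : NormValue b, HasSum (fun I : {I // f I = n} =>
      ‖(Ideal.absNorm I.1.1 : ℂ) ^ (-s) / (2 * repCount b (Ideal.absNorm I.1.1))‖)
      ‖(n.1 : ℂ) ^ (-s) / (2 * Nat.card (IntRing b)ˣ)‖ := fun n => by
    have := Fintype.ofFinite {I // f I = n}
    convert hasSum_fintype _
    have h1 : ∀ I : {I // f I = n}, Ideal.absNorm I.1.1 = n.1 := fun I => congrArg Subtype.val I.2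
    have h2 : (idealCount b n.1 : ℝ) ≠ 0 := Nat.cast_ne_zero.2 (idealCount_ne_zero n)
    simp only [h1, Finset.sum_const, Finset.card_univ, nsmul_eq_mul]
    rw [← Nat.card_eq_fintype_card, hcard, repCount_eq n.2.1, Nat.cast_mul, norm_div, norm_div,
      norm_mul, norm_mul, norm_mul]
    simp only [RCLike.norm_natCast, RCLike.norm_ofNat]
    field_simp
  have hsum : Summable fun n : NormValue b => (n.1 : ℂ) ^ (-s) / (2 * Nat.card (IntRing b)ˣ) :=
    Summable.div_const (zetaSummable_normValue hs) _
  have hS : Summable fun x : Σ n : NormValue b, {I // f I = n} =>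
      (Ideal.absNorm x.2.1.1 : ℂ) ^ (-s) / (2 * repCount b (Ideal.absNorm x.2.1.1)) := by
    refine Summable.of_norm ((summable_sigma_of_nonneg fun _ => norm_nonneg _).2
      ⟨fun n => (hnorm n).summable, ?_⟩)
    exact hsum.norm.congr fun n => (hnorm n).tsum_eq.symm
  have key := hS.hasSum
  have h3 : ∑' n : NormValue b, (n.1 : ℂ) ^ (-s) / (2 * Nat.card (IntRing b)ˣ) =
      normZeta b s / (2 * Nat.card (IntRing b)ˣ) := tsum_div_const
  rw [Summable.tsum_sigma hS, tsum_congr fun n => (hterm n).tsum_eq, h3] at key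
  exact (Equiv.sigmaFiberEquiv f).hasSum_iff.1 key

theorem hasSum_invariantPair [Fintype (IntRing b)ˣ] {s : ℂ}
    (h : ∀ u : (IntRing b)ˣ, ZetaSummable (fun K : {K : PrimitiveSublattice b //
      twist (u : IntRing b) true K.1 = K.1} => K.1.1.index) s) :
    HasSum (fun x : InvariantPair b => (x.2.1.1.index : ℂ) ^ (-s)) (invariantZeta b s) := by
  have hP := zetaSummable_sigma (g := fun x : InvariantPair b => x.2.1.1.index) h
  have hZ := zetaSeries_sigma (g := fun x : InvariantPair b => x.2.1.1.index) h
  have h1 : HasSum (fun x : InvariantPair b => (x.2.1.1.index : ℂ) ^ (-s))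
    (zetaSeries (fun x : InvariantPair b => x.2.1.1.index) s) := hP.hasSum
  rw [hZ] at h1
  exact h1

theorem hasSum_of_bijective {X Y : Type*} {f : X → Y} (hf : f.Bijective) {F : Y → ℂ} {G : X → ℂ}
    {z : ℂ} (h : HasSum G z) (H : ∀ x, F (f x) = G x) : HasSum F z := by
  obtain rfl : F ∘ f = G := funext H
  exact (Equiv.ofBijective f hf).hasSum_iff.1 h

theorem hasSum_mul {X Y : Type*} {f : X → ℂ} {g : Y → ℂ} {z w : ℂ} (hf : HasSum f z)
    (hg : HasSum g w) : HasSum (fun p : X × Y => f p.1 * g p.2) (z * w) :=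
  hf.mul hg (summable_mul_of_summable_norm hf.summable.norm hg.summable.norm)

theorem NormModel.summand_reflParam (M : NormModel b Q L) (s : ℂ)
    (p : NonzeroIdeal (IntRing b) × InvariantPair b) :
    summand Q L s (M.reflParam p).2.1 =
      (Ideal.absNorm p.1.1 : ℂ) ^ (-s) / (2 * repCount b (Ideal.absNorm p.1.1)) *
        (p.2.2.1.1.index : ℂ) ^ (-s) := by
  have h1 := M.summand_lat_scale (gen_ne_zero p.1) p.2.2.1 s
  rw [nrm_gen] at h1
  exact h1

theorem NormModel.hasSum_summand (M : NormModel b Q L) {s z : ℂ} (hs : 1 < s.re)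
    (hP : HasSum (fun x : InvariantPair b => (x.2.1.1.index : ℂ) ^ (-s)) z) :
    HasSum (fun x : Σ ρ : reflections Q, InvariantSublattice L ρ.1 => summand Q L s x.2.1)
      (normZeta b s / (2 * Nat.card (IntRing b)ˣ) * z) := by
  exact hasSum_of_bijective M.reflParam_bijective
    (F := fun x : Σ ρ : reflections Q, InvariantSublattice L ρ.1 => summand Q L s x.2.1)
    (hasSum_mul (hasSum_ideals (b := b) hs) hP) (M.summand_reflParam s)

theorem refl_eq_tsum {s z : ℂ}
    (h : HasSum (fun x : Σ ρ : reflections Q, InvariantSublattice L ρ.1 => summand Q L s x.2.1) z) :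
    Refl Q L s = z := by
  have h1 := Summable.tsum_sigma h.summable
  rw [h.tsum_eq] at h1
  exact h1.symm

/-- Under `reflParam` the summand factors into a part that depends only on the ideal and a part that
depends only on the invariant pair. -/
theorem NormModel.refl_eq (M : NormModel b Q L) [Fintype (IntRing b)ˣ] {s : ℂ} (hs : 1 < s.re)
    (h : ∀ u : (IntRing b)ˣ, ZetaSummable (fun K : {K : PrimitiveSublattice b //
      twist (u : IntRing b) true K.1 = K.1} => K.1.1.index) s) :
    ReflSummable Q L s ∧
      Refl Q L s = normZeta b s / (2 * Fintype.card (IntRing b)ˣ) * invariantZeta b s := by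
  have hX := M.hasSum_summand hs (hasSum_invariantPair h)
  rw [Nat.card_eq_fintype_card] at hX
  exact ⟨hX.summable, refl_eq_tsum hX⟩

end Reflections

end SubformZeta

namespace SubformZeta

/-! ### Sublattices spanned by two elements -/

section Pairs

variable {b : ℤ}

/-- The sublattice spanned by `v` and `w`. -/
abbrev pairLat (v w : IntRing b) : AddSubgroup (IntRing b) := AddSubgroup.closure {v, w}

theorem mem_pairLat {v w z : IntRing b} :
    z ∈ pairLat v w ↔ ∃ k l : ℤ, (k : IntRing b) * v + (l : IntRing b) * w = z := by
  simp only [pairLat, AddSubgroup.mem_closure_pair, zsmul_eq_mul]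

theorem idealSpan_pairLat_eq_top {v w : IntRing b} :
    idealSpan (pairLat v w) = ⊤ ↔ IsCoprime v w := by
  have : idealSpan (pairLat v w) = Ideal.span {v, w} := by
    apply le_antisymm
    · refine Ideal.span_le.2 fun z hz => ?_
      obtain ⟨k, l, rfl⟩ := mem_pairLat.1 hz
      exact Ideal.mem_span_pair.2 ⟨k, l, rfl⟩
    · exact Ideal.span_mono AddSubgroup.subset_closure
  rw [this, Ideal.eq_top_iff_one, Ideal.mem_span_pair]
  rfl

/-- The sublattice is the range of the endomorphism sending the basis `1`, `ω` to `v`, `w`; its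
index is the absolute value of the determinant. -/
theorem index_pairLat {v w : IntRing b} (h : v.re * w.im - v.im * w.re ≠ 0) :
    (pairLat v w).index = (v.re * w.im - v.im * w.re).natAbs := by
  let f : IntRing b →ₗ[ℤ] IntRing b :=
    (QuadraticAlgebra.basis (-1 : ℤ) b).constr ℤ ![v, w]
  have hf : ∀ z, f z = (z.re : IntRing b) * v + (z.im : IntRing b) * w := fun z => by
    rw [Module.Basis.constr_apply_fintype, Fin.sum_univ_two]
    simp [Module.Basis.equivFun_apply, QuadraticAlgebra.basis_repr_apply, zsmul_eq_mul]
  have hdet : LinearMap.det f = v.re * w.im - v.im * w.re := by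
    rw [← LinearMap.det_toMatrix (QuadraticAlgebra.basis (-1 : ℤ) b), Matrix.det_fin_two]
    simp [f, LinearMap.toMatrix_apply, QuadraticAlgebra.basis_repr_apply]
    ring
  have hinj : Function.Injective f := by
    apply LinearMap.ker_eq_bot.1
    by_contra hk
    exact h (hdet ▸ LinearMap.det_eq_zero_iff_ker_ne_bot.2 hk)
  have hrange : pairLat v w = (LinearMap.range f).toAddSubgroup := by
    ext z
    rw [mem_pairLat]
    constructor
    · rintro ⟨k, l, rfl⟩
      exact ⟨⟨k, l⟩, hf _⟩
    · rintro ⟨x, rfl⟩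
      exact ⟨x.re, x.im, (hf x).symm⟩
  have := Submodule.natAbs_det_equiv (LinearMap.range f) (LinearEquiv.ofInjective f hinj)
  rw [hrange, ← hdet]
  exact this.symm

end Pairs

/-! ### Sublattices invariant under a reflection -/

section Axes

variable {b : ℤ}

/-- The reflection `z ↦ u conj(z)` has axes spanned by `e₁` and `e₂`. -/
structure Axes (u e₁ e₂ : IntRing b) : Prop where
  unit : u * star u = 1
  left_ne : e₁ ≠ 0
  right_ne : e₂ ≠ 0
  left_iff : ∀ z, u * star z = z ↔ ∃ k : ℤ, (k : IntRing b) * e₁ = z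
  right_iff : ∀ z, u * star z = -z ↔ ∃ k : ℤ, (k : IntRing b) * e₂ = z

/-- The sublattice generated by `a e₁`, `c e₂` and, if `r` holds, the halves
of `x a e₁ + y c e₂` with `x` and `y` odd. -/
def axisLat (e₁ e₂ : IntRing b) (r : Bool) (a c : ℕ+) : AddSubgroup (IntRing b) where
  carrier := {z | ∃ x y : ℤ, 2 ∣ x - y ∧ (r = false → 2 ∣ x) ∧
    2 * z = (x * a : ℤ) * e₁ + (y * c : ℤ) * e₂}
  zero_mem' := ⟨0, 0, by simp, by simp, by simp⟩
  add_mem' := by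
    rintro z w ⟨x, y, h1, h2, h3⟩ ⟨x', y', h1', h2', h3'⟩
    refine ⟨x + x', y + y', by omega, fun h => dvd_add (h2 h) (h2' h), ?_⟩
    push_cast at *
    linear_combination h3 + h3'
  neg_mem' := by
    rintro z ⟨x, y, h1, h2, h3⟩
    refine ⟨-x, -y, by omega, fun h => (dvd_neg).2 (h2 h), ?_⟩
    push_cast at *
    linear_combination -h3

variable {u e₁ e₂ : IntRing b}

theorem mem_axisLat {r : Bool} {a c : ℕ+} {z : IntRing b} :
    z ∈ axisLat e₁ e₂ r a c ↔ ∃ x y : ℤ, 2 ∣ x - y ∧ (r = false → 2 ∣ x) ∧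
      2 * z = (x * a : ℤ) * e₁ + (y * c : ℤ) * e₂ := Iff.rfl

theorem two_mul_cancel [Fact (b = 0 ∨ b = 1)] {z w : IntRing b} (h : 2 * z = 2 * w) : z = w := by
  have h2 : (2 : IntRing b) ≠ 0 := by
    have : ((2 : ℤ) : IntRing b) ≠ 0 := by rw [Ne, Int.cast_eq_zero]; norm_num
    exact_mod_cast this
  exact mul_left_cancel₀ h2 h

theorem half_mem {a c : ℕ+} {z : IntRing b} (hz : 2 * z = (a : IntRing b) * e₁ + (c : IntRing b) * e₂) :
    z ∈ axisLat e₁ e₂ true a c := ⟨1, 1, by simp, by simp, by simpa using hz⟩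

namespace Axes


theorem left_eq (hA : Axes u e₁ e₂) : u * star e₁ = e₁ := (hA.left_iff _).2 ⟨1, by simp⟩

theorem right_eq (hA : Axes u e₁ e₂) : u * star e₂ = -e₂ := (hA.right_iff _).2 ⟨1, by simp⟩

/-- The reflection fixes `e₁` and negates `e₂`. Applying it to a relation and then adding and
subtracting isolates each term. -/
theorem independent [Fact (b = 0 ∨ b = 1)] (hA : Axes u e₁ e₂) {m n : ℤ} (h : (m : IntRing b) * e₁ + (n : IntRing b) * e₂ = 0) :
    m = 0 ∧ n = 0 := by
  have h1 := congrArg (fun z => u * star z) h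
  simp only [star_add, star_mul, star_intCast, star_zero, mul_zero] at h1
  have h2 : (m : IntRing b) * e₁ - (n : IntRing b) * e₂ = 0 := by
    rw [← h1]
    linear_combination -(m : IntRing b) * hA.left_eq - (n : IntRing b) * hA.right_eq
  have hm : ((2 * m : ℤ) : IntRing b) * e₁ = 0 := by push_cast; linear_combination h + h2
  have hn : ((2 * n : ℤ) : IntRing b) * e₂ = 0 := by push_cast; linear_combination h - h2
  have hm' := (mul_eq_zero.1 hm).resolve_right hA.left_ne
  have hn' := (mul_eq_zero.1 hn).resolve_right hA.right_ne
  rw [Int.cast_eq_zero] at hm' hn'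
  omega

theorem coeff_eq [Fact (b = 0 ∨ b = 1)] (hA : Axes u e₁ e₂) {m n m' n' : ℤ} (h : (m : IntRing b) * e₁ + (n : IntRing b) * e₂ =
    (m' : IntRing b) * e₁ + (n' : IntRing b) * e₂) : m = m' ∧ n = n' := by
  have := hA.independent (m := m - m') (n := n - n') (by push_cast; linear_combination h)
  omega

/-- If `2z` lies on the axis then `z` is fixed by the reflection, and the integral fixed vectors are
the multiples of `e₁`. -/
theorem left_of_two_mul [Fact (b = 0 ∨ b = 1)] (hA : Axes u e₁ e₂) {z : IntRing b} {n : ℤ} (h : 2 * z = (n : IntRing b) * e₁) :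
    ∃ k : ℤ, (k : IntRing b) * e₁ = z := by
  refine (hA.left_iff z).1 (two_mul_cancel ?_)
  have h1 := congrArg (fun z => u * star z) h
  simp only [star_mul, star_intCast, star_ofNat] at h1
  linear_combination h1 - h + (n : IntRing b) * hA.left_eq

theorem right_of_two_mul [Fact (b = 0 ∨ b = 1)] (hA : Axes u e₁ e₂) {z : IntRing b} {n : ℤ} (h : 2 * z = (n : IntRing b) * e₂) :
    ∃ k : ℤ, (k : IntRing b) * e₂ = z := by
  refine (hA.right_iff z).1 (two_mul_cancel ?_)
  have h1 := congrArg (fun z => u * star z) h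
  simp only [star_mul, star_intCast, star_ofNat] at h1
  linear_combination h1 + h + (n : IntRing b) * hA.right_eq

theorem left_mem_axisLat [Fact (b = 0 ∨ b = 1)] (hA : Axes u e₁ e₂) {r : Bool} {a c : ℕ+} {n : ℤ} :
    (n : IntRing b) * e₁ ∈ axisLat e₁ e₂ r a c ↔ (a : ℤ) ∣ n := by
  rw [mem_axisLat]
  constructor
  · rintro ⟨x, y, h1, -, h3⟩
    obtain ⟨h4, h5⟩ := hA.coeff_eq (m := 2 * n) (n := 0) (m' := x * a) (n' := y * c)
      (by push_cast at *; linear_combination h3)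
    have hy : y = 0 := (mul_eq_zero.1 h5.symm).resolve_right (by exact_mod_cast c.ne_zero)
    obtain ⟨k, rfl⟩ : 2 ∣ x := by omega
    exact ⟨k, by linarith⟩
  · rintro ⟨k, rfl⟩
    exact ⟨2 * k, 0, by omega, fun _ => by omega, by push_cast; ring⟩

theorem right_mem_axisLat [Fact (b = 0 ∨ b = 1)] (hA : Axes u e₁ e₂) {r : Bool} {a c : ℕ+} {n : ℤ} :
    (n : IntRing b) * e₂ ∈ axisLat e₁ e₂ r a c ↔ (c : ℤ) ∣ n := by
  rw [mem_axisLat]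
  constructor
  · rintro ⟨x, y, h1, -, h3⟩
    obtain ⟨h4, h5⟩ := hA.coeff_eq (m := 0) (n := 2 * n) (m' := x * a) (n' := y * c)
      (by push_cast at *; linear_combination h3)
    have hy : x = 0 := (mul_eq_zero.1 h4.symm).resolve_right (by exact_mod_cast a.ne_zero)
    obtain ⟨k, rfl⟩ : 2 ∣ y := by omega
    exact ⟨k, by linarith⟩
  · rintro ⟨k, rfl⟩
    exact ⟨0, 2 * k, by omega, fun _ => by omega, by push_cast; ring⟩

theorem half_notMem [Fact (b = 0 ∨ b = 1)] (hA : Axes u e₁ e₂) {a c : ℕ+} {z : IntRing b} (hz : 2 * z = (a : IntRing b) * e₁ + (c : IntRing b) * e₂) :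
    z ∉ axisLat e₁ e₂ false a c := by
  rintro ⟨x, y, h1, h2, h3⟩
  obtain ⟨h4, h5⟩ := hA.coeff_eq (m := a) (n := c) (m' := x * a) (n' := y * c)
      (by push_cast at *; linear_combination h3 - hz)
  have : x = 1 := mul_right_cancel₀ (b := (a : ℤ)) (by exact_mod_cast a.ne_zero)
    (by linarith)
  have := h2 rfl
  omega

/-- `axisLat` determines its parameters. -/
theorem axisLat_inj [Fact (b = 0 ∨ b = 1)] (hA : Axes u e₁ e₂) {r r' : Bool} {a c a' c' : ℕ+}
    (hr : r = true → ∃ z, 2 * z = (a : IntRing b) * e₁ + (c : IntRing b) * e₂)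
    (hr' : r' = true → ∃ z, 2 * z = (a' : IntRing b) * e₁ + (c' : IntRing b) * e₂)
    (h : axisLat e₁ e₂ r a c = axisLat e₁ e₂ r' a' c') : r = r' ∧ a = a' ∧ c = c' := by
  have ha : a = a' := by
    apply PNat.coe_injective
    apply Nat.dvd_antisymm
    · rw [← Int.natCast_dvd_natCast]
      exact hA.left_mem_axisLat.1 (h.symm ▸ hA.left_mem_axisLat.2 dvd_rfl)
    · rw [← Int.natCast_dvd_natCast]
      exact hA.left_mem_axisLat.1 (h ▸ hA.left_mem_axisLat.2 dvd_rfl)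
  have hc : c = c' := by
    apply PNat.coe_injective
    apply Nat.dvd_antisymm
    · rw [← Int.natCast_dvd_natCast]
      exact hA.right_mem_axisLat.1 (h.symm ▸ hA.right_mem_axisLat.2 dvd_rfl)
    · rw [← Int.natCast_dvd_natCast]
      exact hA.right_mem_axisLat.1 (h ▸ hA.right_mem_axisLat.2 dvd_rfl)
  subst ha hc
  refine ⟨?_, rfl, rfl⟩
  cases r <;> cases r'
  · rfl
  · obtain ⟨z, hz⟩ := hr' rfl
    exact absurd (h ▸ half_mem hz) (hA.half_notMem hz)
  · obtain ⟨z, hz⟩ := hr rfl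
    exact absurd (h ▸ half_mem hz) (hA.half_notMem hz)
  · rfl

theorem _root_.SubformZeta.axisLat_false [Fact (b = 0 ∨ b = 1)] (a c : ℕ+) :
    axisLat e₁ e₂ false a c = pairLat ((a : IntRing b) * e₁) ((c : IntRing b) * e₂) := by
  ext z
  rw [mem_axisLat, mem_pairLat]
  constructor
  · rintro ⟨x, y, h1, h2, h3⟩
    obtain ⟨k, rfl⟩ := h2 rfl
    obtain ⟨l, rfl⟩ : 2 ∣ y := by omega
    refine ⟨k, l, two_mul_cancel ?_⟩
    rw [h3]
    push_cast
    ring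
  · rintro ⟨k, l, rfl⟩
    exact ⟨2 * k, 2 * l, by omega, fun _ => by omega, by push_cast; ring⟩

theorem _root_.SubformZeta.axisLat_true [Fact (b = 0 ∨ b = 1)] {a c : ℕ+} {z : IntRing b}
    (hz : 2 * z = (a : IntRing b) * e₁ + (c : IntRing b) * e₂) :
    axisLat e₁ e₂ true a c = pairLat z (z - (c : IntRing b) * e₂) := by
  ext w
  rw [mem_axisLat, mem_pairLat]
  constructor
  · rintro ⟨x, y, ⟨l, h1⟩, -, h3⟩
    refine ⟨x - l, l, two_mul_cancel ?_⟩
    obtain rfl : y = x - 2 * l := by omega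
    rw [h3]
    push_cast
    linear_combination (x : IntRing b) * hz
  · rintro ⟨k, l, rfl⟩
    refine ⟨k + l, k - l, by omega, by simp, ?_⟩
    push_cast
    linear_combination (k + l : IntRing b) * hz

theorem twist_axisLat [Fact (b = 0 ∨ b = 1)] (hA : Axes u e₁ e₂) (r : Bool) (a c : ℕ+) :
    twist u true (axisLat e₁ e₂ r a c) = axisLat e₁ e₂ r a c := by
  have h : ∀ z ∈ axisLat e₁ e₂ r a c, u * star z ∈ axisLat e₁ e₂ r a c := by
    rintro z ⟨x, y, h1, h2, h3⟩
    refine ⟨x, -y, by omega, h2, ?_⟩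
    have h4 := congrArg (fun z => u * star z) h3
    simp only [star_add, star_mul, star_intCast, star_ofNat] at h4
    push_cast at *
    linear_combination h4 + (x * a : IntRing b) * hA.left_eq + (y * c : IntRing b) * hA.right_eq
  ext z
  rw [mem_twist]
  constructor
  · rintro ⟨k, hk, rfl⟩
    exact h k hk
  · intro hz
    refine ⟨_, h z hz, ?_⟩
    rw [tw_true, star_mul, star_star]
    linear_combination z * hA.unit

/-- Let `a e₁` and `c e₂` generate the intersections of `K` with the axes. For `z` in `K` the sum
and the difference of `z` and its reflection lie on the axes, so `2z = x a e₁ + y c e₂`. The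
integers `x`, `y` have equal parity, and `K` is larger than the span of `a e₁`, `c e₂` exactly when
some `z` has both odd. -/
theorem exists_eq_axisLat [Fact (b = 0 ∨ b = 1)] (hA : Axes u e₁ e₂) {K : AddSubgroup (IntRing b)} (hK : K.index ≠ 0)
    (hu : twist u true K = K) :
    ∃ (r : Bool) (a c : ℕ+), K = axisLat e₁ e₂ r a c ∧
      (r = true → ∃ z, 2 * z = (a : IntRing b) * e₁ + (c : IntRing b) * e₂) := by
  have hσ : ∀ z ∈ K, u * star z ∈ K := fun z hz => by
    rw [← hu]
    exact ⟨z, hz, rfl⟩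
  obtain ⟨n, hn, hn'⟩ := exists_pos_smul_mem hK
  have hcomap : ∀ e : IntRing b, ∃ a : ℕ+, ∀ x : ℤ, (x : IntRing b) * e ∈ K ↔ (a : ℤ) ∣ x :=
    fun e => exists_eq_zmultiples (K.comap ((AddMonoidHom.mulRight e).comp
      (Int.castAddHom (IntRing b)))) (n := n) (by simpa using hn' e) (by exact_mod_cast hn)
  obtain ⟨a, ha⟩ := hcomap e₁
  obtain ⟨c, hc⟩ := hcomap e₂
  have hcoord : ∀ z ∈ K, ∃ x y : ℤ, 2 * z = (x * a : ℤ) * e₁ + (y * c : ℤ) * e₂ := by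
    intro z hz
    have hinv : u * star (u * star z) = z := by
      rw [star_mul, star_star]; linear_combination z * hA.unit
    obtain ⟨p, hp⟩ := (hA.left_iff (z + u * star z)).1 (by
      rw [star_add, mul_add, hinv, add_comm])
    obtain ⟨q, hq⟩ := (hA.right_iff (z - u * star z)).1 (by
      rw [star_sub, mul_sub, hinv]; ring)
    obtain ⟨x, rfl⟩ := (ha p).1 (hp ▸ K.add_mem hz (hσ z hz))
    obtain ⟨y, rfl⟩ := (hc q).1 (hq ▸ K.sub_mem hz (hσ z hz))
    refine ⟨x, y, ?_⟩
    push_cast at *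
    linear_combination -hp - hq
  have hax : ∀ k : ℤ, ((k * a : ℤ) : IntRing b) * e₁ ∈ K := fun k => (ha _).2 (dvd_mul_left _ _)
  have hcy : ∀ k : ℤ, ((k * c : ℤ) : IntRing b) * e₂ ∈ K := fun k => (hc _).2 (dvd_mul_left _ _)
  -- If just one of `x`, `y` were odd, subtracting the even part would put an odd multiple of half
  -- an axis generator into `K`, against the choice of `a` or `c`.
  have hpar : ∀ z ∈ K, ∀ x y : ℤ, 2 * z = (x * a : ℤ) * e₁ + (y * c : ℤ) * e₂ → 2 ∣ x - y := by
    intro z hz x y hxy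
    by_contra hne
    rcases Int.even_or_odd' x with ⟨k, rfl | rfl⟩
    · have h1 := K.sub_mem hz (hax k)
      obtain ⟨l, hl⟩ := hA.right_of_two_mul (z := z - ((k * a : ℤ) : IntRing b) * e₁) (n := y * c)
        (by push_cast at *; linear_combination hxy)
      rw [← hl] at h1
      obtain ⟨m, rfl⟩ := (hc _).1 h1
      have := (hA.coeff_eq (m := 2 * k * a) (n := y * c) (m' := 2 * k * a) (n' := 2 * (c * m))
        (by push_cast at *; linear_combination -hxy - 2 * hl)).2
      have : y = 2 * m := mul_right_cancel₀ (b := (c : ℤ)) (by exact_mod_cast c.ne_zero)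
        (by linarith)
      omega
    · obtain ⟨k', rfl⟩ : 2 ∣ y := by omega
      have h1 := K.sub_mem hz (hcy k')
      obtain ⟨l, hl⟩ := hA.left_of_two_mul (z := z - ((k' * c : ℤ) : IntRing b) * e₂)
        (n := (2 * k + 1) * a) (by push_cast at *; linear_combination hxy)
      rw [← hl] at h1
      obtain ⟨m, rfl⟩ := (ha _).1 h1
      have := (hA.coeff_eq (m := (2 * k + 1) * a) (n := 2 * k' * c) (m' := 2 * (a * m))
        (n' := 2 * k' * c) (by push_cast at *; linear_combination -hxy - 2 * hl)).1
      have : 2 * k + 1 = 2 * m := mul_right_cancel₀ (b := (a : ℤ)) (by exact_mod_cast a.ne_zero)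
        (by linarith)
      omega
  by_cases hγ : ∃ z ∈ K, 2 * z = (a : IntRing b) * e₁ + (c : IntRing b) * e₂
  · obtain ⟨z, hz, hz2⟩ := hγ
    refine ⟨true, a, c, ?_, fun _ => ⟨z, hz2⟩⟩
    rw [axisLat_true hz2]
    apply le_antisymm
    · intro w hw
      obtain ⟨x, y, h⟩ := hcoord w hw
      rw [← axisLat_true hz2]
      exact ⟨x, y, hpar w hw x y h, by simp, h⟩
    · rw [AddSubgroup.closure_le]
      rintro w (rfl | rfl)
      · exact hz
      · exact K.sub_mem hz (by simpa using hcy 1)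
  · refine ⟨false, a, c, ?_, by simp⟩
    apply le_antisymm
    · intro w hw
      obtain ⟨x, y, h⟩ := hcoord w hw
      refine ⟨x, y, hpar w hw x y h, fun _ => ?_, h⟩
      by_contra hx
      have := hpar w hw x y h
      obtain ⟨k, rfl⟩ : ∃ k, x = 2 * k + 1 := ⟨x / 2, by omega⟩
      obtain ⟨l, rfl⟩ : ∃ l, y = 2 * l + 1 := ⟨y / 2, by omega⟩
      -- From an element with `x = 2k + 1` and `y = 2l + 1`, subtracting `k a e₁` and `l c e₂`
      -- leaves half of `a e₁ + c e₂`.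
      refine hγ ⟨_, K.sub_mem (K.sub_mem hw (hax k)) (hcy l), ?_⟩
      push_cast at *
      linear_combination h
    · rw [axisLat_false, AddSubgroup.closure_le]
      rintro w (rfl | rfl)
      · simpa using hax 1
      · simpa using hcy 1

end Axes

end Axes

end SubformZeta

namespace SubformZeta

/-! ### The zeta function of the primitive sublattices invariant under a reflection with given axes.
-/

section InvariantZeta

variable {b : ℤ} {T₁ T₂ T₃ : ℕ → ℕ → Prop} {u e₁ e₂ : IntRing b}

/-- The parameters of the three kinds of invariant sublattices. -/
def axisParam (p : CoprimePair T₁ ⊕ CoprimePair T₂ ⊕ CoprimePair T₃) : Bool × ℕ+ × ℕ+ :=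
  Sum.elim (fun q => (false, q.1)) (Sum.elim (fun q => (true, q.1))
    fun q => (true, 2 * q.1.1, 2 * q.1.2)) p

theorem not_two_dvd_of_coprime {a c : ℕ} (h : a.Coprime c) : ¬ (2 ∣ a ∧ 2 ∣ c) := fun h2 =>
  Nat.not_coprime_of_dvd_of_dvd (by norm_num) h2.1 h2.2 h

/-- The second and third kinds are disjoint because coprime integers are not both even. -/
theorem axisParam_injective : Function.Injective (axisParam (T₁ := T₁) (T₂ := T₂) (T₃ := T₃)) := by
  rintro (⟨⟨a, c⟩, h⟩ | ⟨⟨a, c⟩, h⟩ | ⟨⟨a, c⟩, h⟩) (⟨⟨a', c'⟩, h'⟩ | ⟨⟨a', c'⟩, h'⟩ | ⟨⟨a', c'⟩, h'⟩) H <;>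
    simp only [axisParam, Sum.elim_inl, Sum.elim_inr, Prod.mk.injEq, Bool.false_eq_true,
      Bool.true_eq_false, false_and, true_and] at H
  · obtain ⟨rfl, rfl⟩ := H
    rfl
  · obtain ⟨rfl, rfl⟩ := H
    rfl
  · obtain ⟨rfl, rfl⟩ := H
    exact absurd ⟨Dvd.intro _ rfl, Dvd.intro _ rfl⟩ (not_two_dvd_of_coprime h.1)
  · obtain ⟨rfl, rfl⟩ := H
    exact absurd ⟨Dvd.intro _ rfl, Dvd.intro _ rfl⟩ (not_two_dvd_of_coprime h'.1)
  · obtain ⟨h1, h2⟩ := H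
    obtain rfl := mul_left_cancel h1
    obtain rfl := mul_left_cancel h2
    rfl

theorem exists_two_mul {a : ℕ+} (h : 2 ∣ (a : ℕ)) : ∃ a' : ℕ+, a = 2 * a' := by
  obtain ⟨k, hk⟩ := h
  exact ⟨Nat.toPNat k (by have := a.pos; omega), PNat.coe_injective hk⟩

/-- Three families occur: the span of `a e₁`, `c e₂`; the half type with `a`, `c` not both even; and
the half type with parameters `2a`, `2c`, spanned by `a e₁ ± c e₂`. In each, primitivity means
coprimality of `a`, `c` plus a congruence condition `Tᵢ`, and the index is `Dᵢ a c`. Condition `T₂`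
also ensures that the half vector is integral (`H₄`). -/
theorem Axes.fixedZeta_eq [Fact (b = 0 ∨ b = 1)] (hA : Axes u e₁ e₂) {D₁ D₂ D₃ : ℕ} (hD₁ : D₁ ≠ 0) (hD₂ : D₂ ≠ 0)
    (hD₃ : D₃ ≠ 0)
    (H₁ : ∀ a c, idealSpan (axisLat e₁ e₂ false a c) = ⊤ ↔ (a : ℕ).Coprime c ∧ T₁ a c)
    (H₂ : ∀ (a c : ℕ+) (z : IntRing b), 2 * z = (a : IntRing b) * e₁ + (c : IntRing b) * e₂ →
      ¬ (2 ∣ (a : ℕ) ∧ 2 ∣ (c : ℕ)) → (idealSpan (pairLat z (z - (c : IntRing b) * e₂)) = ⊤ ↔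
        (a : ℕ).Coprime c ∧ T₂ a c))
    (H₃ : ∀ a c, idealSpan (axisLat e₁ e₂ true (2 * a) (2 * c)) = ⊤ ↔ (a : ℕ).Coprime c ∧ T₃ a c)
    (H₄ : ∀ a c : ℕ+, T₂ a c → ∃ z, 2 * z = (a : IntRing b) * e₁ + (c : IntRing b) * e₂)
    (I₁ : ∀ a c, (axisLat e₁ e₂ false a c).index = D₁ * (a * c))
    (I₂ : ∀ (a c : ℕ+) (z : IntRing b), T₂ a c → 2 * z = (a : IntRing b) * e₁ + (c : IntRing b) * e₂ →
      (pairLat z (z - (c : IntRing b) * e₂)).index = D₂ * (a * c))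
    (I₃ : ∀ a c, (axisLat e₁ e₂ true (2 * a) (2 * c)).index = D₃ * (a * c)) {s : ℂ}
    (hs : 1 < s.re) :
    ZetaSummable (fun K : {K : PrimitiveSublattice b // twist u true K.1 = K.1} => K.1.1.index) s ∧
    fixedZeta u true s = (D₁ : ℂ) ^ (-s) * coprimeZeta T₁ s +
      ((D₂ : ℂ) ^ (-s) * coprimeZeta T₂ s + (D₃ : ℂ) ^ (-s) * coprimeZeta T₃ s) := by
  let g : CoprimePair T₁ ⊕ CoprimePair T₂ ⊕ CoprimePair T₃ → ℕ :=
    Sum.elim (fun q => D₁ * (q.1.1 * q.1.2)) (Sum.elim (fun q => D₂ * (q.1.1 * q.1.2))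
      fun q => D₃ * (q.1.1 * q.1.2))
  let F : CoprimePair T₁ ⊕ CoprimePair T₂ ⊕ CoprimePair T₃ → AddSubgroup (IntRing b) := fun p =>
    axisLat e₁ e₂ (axisParam p).1 (axisParam p).2.1 (axisParam p).2.2
  have hhalf : ∀ p : CoprimePair T₁ ⊕ CoprimePair T₂ ⊕ CoprimePair T₃, (axisParam p).1 = true →
      ∃ z, 2 * z = ((axisParam p).2.1 : IntRing b) * e₁ + ((axisParam p).2.2 : IntRing b) * e₂ := by
    rintro (q | q | q) h
    · exact Bool.noConfusion h
    · exact H₄ _ _ q.2.2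
    · exact ⟨(q.1.1 : IntRing b) * e₁ + (q.1.2 : IntRing b) * e₂, by simp [axisParam]; ring⟩
  have hindex : ∀ p, (F p).index = g p := by
    rintro (q | q | q)
    · exact I₁ _ _
    · obtain ⟨z, hz⟩ := H₄ _ _ q.2.2
      change (axisLat e₁ e₂ true q.1.1 q.1.2).index = D₂ * (q.1.1 * q.1.2)
      rw [axisLat_true hz]
      exact I₂ _ _ z q.2.2 hz
    · exact I₃ _ _
  have hprim : ∀ p, idealSpan (F p) = ⊤ := by
    rintro (q | q | q)
    · exact (H₁ _ _).2 q.2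
    · obtain ⟨z, hz⟩ := H₄ _ _ q.2.2
      change idealSpan (axisLat e₁ e₂ true q.1.1 q.1.2) = ⊤
      rw [axisLat_true hz]
      exact (H₂ _ _ z hz (not_two_dvd_of_coprime q.2.1)).2 q.2
    · exact (H₃ _ _).2 q.2
  have hg : ∀ p, g p ≠ 0 := by
    rintro (q | q | q)
    all_goals simp [g, hD₁, hD₂, hD₃]
  let f : CoprimePair T₁ ⊕ CoprimePair T₂ ⊕ CoprimePair T₃ →
      {K : PrimitiveSublattice b // twist u true K.1 = K.1} := fun p =>
    ⟨⟨F p, by rw [hindex]; exact hg p, hprim p⟩, hA.twist_axisLat _ _ _⟩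
  have hf : f.Bijective := by
    constructor
    · intro p q h
      have h1 : F p = F q := congrArg (fun K => K.1.1) h
      obtain ⟨h2, h3, h4⟩ := hA.axisLat_inj (hhalf p) (hhalf q) h1
      exact axisParam_injective (Prod.ext h2 (Prod.ext h3 h4))
    · rintro ⟨⟨K, hK, hK'⟩, hu⟩
      obtain ⟨r, a, c, rfl, hr⟩ := hA.exists_eq_axisLat hK hu
      cases r
      · exact ⟨Sum.inl ⟨(a, c), (H₁ a c).1 hK'⟩, rfl⟩
      · obtain ⟨z, hz⟩ := hr rfl
        by_cases h2 : 2 ∣ (a : ℕ) ∧ 2 ∣ (c : ℕ)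
        · obtain ⟨a, rfl⟩ := exists_two_mul h2.1
          obtain ⟨c, rfl⟩ := exists_two_mul h2.2
          exact ⟨Sum.inr (Sum.inr ⟨(a, c), (H₃ a c).1 hK'⟩), rfl⟩
        · refine ⟨Sum.inr (Sum.inl ⟨(a, c), (H₂ a c z hz h2).1 ?_⟩), rfl⟩
          rw [← axisLat_true hz]
          exact hK'
  have s1 := (zetaSummable_coprimePair T₁ hs).smul D₁
  have s2 := (zetaSummable_coprimePair T₂ hs).smul D₂
  have s3 := (zetaSummable_coprimePair T₃ hs).smul D₃
  have s23 := zetaSummable_sum s2 s3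
  have hS : ZetaSummable g s := zetaSummable_sum s1 s23
  have hZ : zetaSeries g s = (D₁ : ℂ) ^ (-s) * coprimeZeta T₁ s +
      ((D₂ : ℂ) ^ (-s) * coprimeZeta T₂ s + (D₃ : ℂ) ^ (-s) * coprimeZeta T₃ s) := by
    refine (zetaSeries_sum s1 s23).trans ?_
    rw [zetaSeries_sum s2 s3, zetaSeries_smul, zetaSeries_smul, zetaSeries_smul]
    rfl
  have hfi : ∀ p, (Equiv.ofBijective f hf p).1.1.index = g p := hindex
  constructor
  · exact (zetaSummable_congr (g := g)
      (h := fun K : {K : PrimitiveSublattice b // twist u true K.1 = K.1} => K.1.1.index)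
      (Equiv.ofBijective f hf) hfi s).1 hS
  · rw [← hZ]
    exact (zetaSeries_congr (g := g)
      (h := fun K : {K : PrimitiveSublattice b // twist u true K.1 = K.1} => K.1.1.index)
      (Equiv.ofBijective f hf) hfi s).symm

end InvariantZeta

end SubformZeta

namespace SubformZeta

/-! ### The reflection-invariant primitive sublattices of `ℤ[i]` and `ℤ[ω]` -/

section Coprimality

variable {b : ℤ}

theorem isCoprime_natCast {m n : ℕ} : IsCoprime (m : IntRing b) (n : IntRing b) ↔ m.Coprime n := by
  constructor
  · rintro ⟨x, y, h⟩
    have h1 := congrArg QuadraticAlgebra.re h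
    rw [← Nat.isCoprime_iff_coprime]
    exact ⟨x.re, y.re, by simpa [QuadraticAlgebra.re_one] using h1⟩
  · exact fun h => h.cast

theorem not_isCoprime_of_dvd {v w d : IntRing b} (hd : nrm d ≠ 1) (hv : d ∣ v) (hw : d ∣ w) :
    ¬ IsCoprime v w := fun h => hd (isUnit_iff_nrm.1 (h.isUnit_of_dvd' hv hw))

theorem isCoprime_of_add_sub {α β : IntRing b} (h : IsCoprime (α + β) (α - β)) : IsCoprime α β := by
  obtain ⟨x, y, h⟩ := h
  exact ⟨x + y, x - y, by linear_combination h⟩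

/-- The sum `α + β` is coprime to 2, because one summand is even and the other is coprime to it, and
it is coprime to `β`. Hence it is coprime to `2β = (α + β) - (α - β)`. -/
theorem isCoprime_add_sub {α β : IntRing b} (h : IsCoprime α β) (h2 : (2 : IntRing b) ∣ α ∨ (2 : IntRing b) ∣ β) :
    IsCoprime (α + β) (α - β) := by
  have h3 : IsCoprime (α + β) 2 := by
    rcases h2 with ⟨m, rfl⟩ | ⟨m, rfl⟩
    · obtain ⟨x, y, h⟩ := h
      exact ⟨y, (x - y) * m, by linear_combination h⟩
    · obtain ⟨x, y, h⟩ := h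
      exact ⟨x, (y - x) * m, by linear_combination h⟩
  have h4 : IsCoprime (α + β) β := by
    obtain ⟨x, y, h⟩ := h
    exact ⟨x, y - x, by linear_combination h⟩
  obtain ⟨x, y, h⟩ := h3.mul_right h4
  exact ⟨x + y, -y, by linear_combination h⟩

theorem two_dvd_natCast_mul {a : ℕ} (h : 2 ∣ a) (e : IntRing b) : (2 : IntRing b) ∣ (a : IntRing b) * e := by
  obtain ⟨k, rfl⟩ := h
  exact ⟨k * e, by push_cast; ring⟩

variable [Fact (b = 0 ∨ b = 1)] {e₁ e₂ : IntRing b}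

theorem idealSpan_axisLat_false (a c : ℕ+) : idealSpan (axisLat e₁ e₂ false a c) = ⊤ ↔
    IsCoprime ((a : IntRing b) * e₁) ((c : IntRing b) * e₂) := by
  rw [axisLat_false, idealSpan_pairLat_eq_top]

theorem axisLat_two_mul (a c : ℕ+) : axisLat e₁ e₂ true (2 * a) (2 * c) =
    pairLat ((a : IntRing b) * e₁ + (c : IntRing b) * e₂) ((a : IntRing b) * e₁ - (c : IntRing b) * e₂) := by
  rw [axisLat_true (z := (a : IntRing b) * e₁ + (c : IntRing b) * e₂) (by push_cast; ring)]
  have h : (((2 * c : ℕ+) : ℕ) : IntRing b) = 2 * c := by push_cast; ring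
  have h2 : ((a : IntRing b) * e₁ + (c : IntRing b) * e₂) - (((2 * c : ℕ+) : ℕ) : IntRing b) * e₂ =
    (a : IntRing b) * e₁ - (c : IntRing b) * e₂ := by rw [h]; ring
  rw [h2]

theorem idealSpan_axisLat_two_mul (a c : ℕ+) (h : 2 ∣ (a : ℕ) ∨ 2 ∣ (c : ℕ)) :
    idealSpan (axisLat e₁ e₂ true (2 * a) (2 * c)) = ⊤ ↔
      IsCoprime ((a : IntRing b) * e₁) ((c : IntRing b) * e₂) := by
  rw [axisLat_two_mul, idealSpan_pairLat_eq_top]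
  exact ⟨isCoprime_of_add_sub, fun h2 => isCoprime_add_sub h2
    (h.imp (fun h => two_dvd_natCast_mul h _) fun h => two_dvd_natCast_mul h _)⟩

theorem index_axisLat_false (a c : ℕ+) {d : ℤ} (hd : d ≠ 0) (h : e₁.re * e₂.im - e₁.im * e₂.re = d) :
    (axisLat e₁ e₂ false a c).index = d.natAbs * (a * c) := by
  have ha : (a : ℤ) ≠ 0 := by exact_mod_cast a.ne_zero
  have hc : (c : ℤ) ≠ 0 := by exact_mod_cast c.ne_zero
  have h1 : ((a : IntRing b) * e₁).re * ((c : IntRing b) * e₂).im -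
      ((a : IntRing b) * e₁).im * ((c : IntRing b) * e₂).re = d * (a * c) := by
    simp
    linear_combination (a * c : ℤ) * h
  rw [axisLat_false, index_pairLat (by rw [h1]; positivity), h1]
  simp [Int.natAbs_mul]

theorem index_axisLat_two_mul (a c : ℕ+) {d : ℤ} (hd : d ≠ 0)
    (h : e₁.re * e₂.im - e₁.im * e₂.re = d) :
    (axisLat e₁ e₂ true (2 * a) (2 * c)).index = (2 * d.natAbs) * (a * c) := by
  have ha : (a : ℤ) ≠ 0 := by exact_mod_cast a.ne_zero
  have hc : (c : ℤ) ≠ 0 := by exact_mod_cast c.ne_zero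
  have h1 : ((a : IntRing b) * e₁ + (c : IntRing b) * e₂).re *
      ((a : IntRing b) * e₁ - (c : IntRing b) * e₂).im -
      ((a : IntRing b) * e₁ + (c : IntRing b) * e₂).im *
      ((a : IntRing b) * e₁ - (c : IntRing b) * e₂).re = -(2 * (d * (a * c))) := by
    simp
    linear_combination -2 * (a * c : ℤ) * h
  rw [axisLat_two_mul, index_pairLat (by rw [h1, neg_ne_zero]; positivity), h1]
  simp [Int.natAbs_mul, mul_assoc]

end Coprimality

/-! ### Explicit axes and primitivity conditions for the reflections of both rings. -/

section Swap

variable {b : ℤ}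

theorem swap_eq (z : IntRing b) : (⟨0, 1⟩ : IntRing b) * star z = ⟨z.im, z.re⟩ := by
  ext <;> simp

theorem intCast_mul_eq (k : ℤ) (e : IntRing b) : (k : IntRing b) * e = ⟨k * e.re, k * e.im⟩ := by
  ext <;> simp

theorem natCast_mul_eq (k : ℕ) (e : IntRing b) : (k : IntRing b) * e = ⟨k * e.re, k * e.im⟩ := by
  ext <;> simp

/-- The reflection `z ↦ ω conj(z)` exchanges `1` and `ω` in both rings, so its axes are spanned by
`1 + ω` and `1 - ω`. -/
theorem axes_swap : Axes (⟨0, 1⟩ : IntRing b) ⟨1, 1⟩ ⟨1, -1⟩ where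
  unit := by rw [swap_eq]; rfl
  left_ne h := by simpa using congrArg QuadraticAlgebra.re h
  right_ne h := by simpa using congrArg QuadraticAlgebra.re h
  left_iff z := by
    simp only [swap_eq, intCast_mul_eq, QuadraticAlgebra.ext_iff]
    exact ⟨fun h => ⟨z.re, by simp [h.2]⟩, fun ⟨k, h⟩ => by constructor <;> linarith [h.1, h.2]⟩
  right_iff z := by
    simp only [swap_eq, intCast_mul_eq, QuadraticAlgebra.ext_iff, QuadraticAlgebra.re_neg, QuadraticAlgebra.im_neg]
    exact ⟨fun h => ⟨z.re, by constructor <;> linarith [h.1, h.2]⟩,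
      fun ⟨k, h⟩ => by constructor <;> linarith [h.1, h.2]⟩

theorem axes_conj : Axes (1 : IntRing 0) 1 ⟨0, 1⟩ where
  unit := by simp
  left_ne := one_ne_zero
  right_ne h := by simpa using congrArg QuadraticAlgebra.im h
  left_iff z := by
    simp only [one_mul, intCast_mul_eq, QuadraticAlgebra.ext_iff, QuadraticAlgebra.re_star,
      QuadraticAlgebra.im_star, QuadraticAlgebra.re_one, QuadraticAlgebra.im_one]
    exact ⟨fun h => ⟨z.re, by constructor <;> linarith [h.1, h.2]⟩,
      fun ⟨k, h⟩ => by constructor <;> linarith [h.1, h.2]⟩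
  right_iff z := by
    simp only [one_mul, intCast_mul_eq, QuadraticAlgebra.ext_iff, QuadraticAlgebra.re_star,
      QuadraticAlgebra.im_star, QuadraticAlgebra.re_neg, QuadraticAlgebra.im_neg]
    refine ⟨fun h => ⟨z.im, by constructor <;> linarith [h.1, h.2]⟩,
      fun ⟨k, h⟩ => ⟨by linarith [h.1], trivial⟩⟩

theorem half_swap {a c : ℕ+} {z : IntRing b}
    (hz : 2 * z = (a : IntRing b) * ⟨1, 1⟩ + (c : IntRing b) * ⟨1, -1⟩) :
    2 * z.re = a + c ∧ 2 * z.im = a - c := by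
  have h1 := congrArg QuadraticAlgebra.re hz
  have h2 := congrArg QuadraticAlgebra.im hz
  rw [two_mul] at h1 h2
  simp at h1 h2
  constructor <;> linarith

theorem exists_half_swap {a c : ℕ+} (ha : ¬ 2 ∣ (a : ℕ)) (hc : ¬ 2 ∣ (c : ℕ)) :
    ∃ z : IntRing b, 2 * z = (a : IntRing b) * ⟨1, 1⟩ + (c : IntRing b) * ⟨1, -1⟩ := by
  refine ⟨⟨(a + c) / 2, (a - c) / 2⟩, ?_⟩
  rw [two_mul]
  ext
  · simp
    omega
  · simp
    omega

theorem index_half_swap {a c : ℕ+} {z : IntRing b}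
    (hz : 2 * z = (a : IntRing b) * ⟨1, 1⟩ + (c : IntRing b) * ⟨1, -1⟩) :
    (pairLat z (z - (c : IntRing b) * ⟨1, -1⟩)).index = 1 * (a * c) := by
  obtain ⟨h1, h2⟩ := half_swap hz
  have ha : (a : ℤ) ≠ 0 := by exact_mod_cast a.ne_zero
  have hc : (c : ℤ) ≠ 0 := by exact_mod_cast c.ne_zero
  have h : z.re * (z - (c : IntRing b) * ⟨1, -1⟩).im - z.im * (z - (c : IntRing b) * ⟨1, -1⟩).re =
      a * c := by
    simp
    have : z.re + z.im = a := by linarith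
    linear_combination (c : ℤ) * this
  rw [index_pairLat (by rw [h]; positivity), h]
  simp [Int.natAbs_mul]

theorem isUnit_of_nrm [Fact (b = 0 ∨ b = 1)] {x : IntRing b} (h : x.norm = 1) : IsUnit x :=
  isUnit_iff_nrm.2 (by rw [nrm, h]; rfl)

theorem isUnit_one_neg_one : IsUnit (⟨1, -1⟩ : IntRing 1) := isUnit_of_nrm rfl

/-- In `ℤ[ω]` the element `1 - ω` is a unit and `(1 + ω)² = 3ω`, so `1 + ω` generates the prime
above 3; coprimality of `1 + ω` and `c` means `3 ∤ c`. -/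
theorem isCoprime_swap_one {a c : ℕ} :
    IsCoprime ((a : IntRing 1) * ⟨1, 1⟩) ((c : IntRing 1) * ⟨1, -1⟩) ↔ a.Coprime c ∧ ¬ 3 ∣ c := by
  rw [isCoprime_mul_unit_right_right isUnit_one_neg_one, IsCoprime.mul_left_iff, isCoprime_natCast]
  refine and_congr_right fun _ => ?_
  have h1 : (⟨1, 1⟩ : IntRing 1) ^ 2 = ((3 : ℕ) : IntRing 1) * ⟨0, 1⟩ := by
    rw [natCast_mul_eq, sq]
    rfl
  rw [← IsCoprime.pow_left_iff (m := 2) (by norm_num), h1,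
    isCoprime_mul_unit_right_left (isUnit_of_nrm rfl), isCoprime_natCast]
  exact (Nat.Prime.coprime_iff_not_dvd Nat.prime_three)

theorem two_dvd_add_sub {a c : ℕ} (ha : ¬ 2 ∣ a) (hc : ¬ 2 ∣ c) :
    (2 : IntRing b) ∣ (a : IntRing b) * ⟨1, 1⟩ + (c : IntRing b) * ⟨1, -1⟩ ∧
    (2 : IntRing b) ∣ (a : IntRing b) * ⟨1, 1⟩ - (c : IntRing b) * ⟨1, -1⟩ := by
  constructor
  · refine ⟨⟨(a + c) / 2, (a - c) / 2⟩, ?_⟩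
    rw [two_mul]
    ext
    · simp; omega
    · simp; omega
  · refine ⟨⟨(a - c) / 2, (a + c) / 2⟩, ?_⟩
    rw [two_mul]
    ext
    · simp; omega
    · simp; omega

theorem nrm_two : nrm (2 : IntRing b) = 4 := by
  have : (2 : IntRing b) = ⟨2, 0⟩ := by ext <;> rfl
  rw [this, nrm, QuadraticAlgebra.norm_def]
  simp

/-- Invariant primitive sublattices of `ℤ[ω]` under the reflection exchanging `1` and `ω`. -/
theorem fixedZeta_swap_one {s : ℂ} (hs : 1 < s.re) :
    ZetaSummable (fun K : {K : PrimitiveSublattice 1 // twist (⟨0, 1⟩ : IntRing 1) true K.1 = K.1} =>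
      K.1.1.index) s ∧
    fixedZeta (⟨0, 1⟩ : IntRing 1) true s =
      (2 : ℂ) ^ (-s) * coprimeZeta (fun _ c => ¬ 3 ∣ c) s +
      (coprimeZeta (fun a c => ¬ 3 ∣ c ∧ ¬ 2 ∣ a ∧ ¬ 2 ∣ c) s +
        (2 : ℂ) ^ (-s) * (2 : ℂ) ^ (-s) * coprimeZeta (fun a c => ¬ 3 ∣ c ∧ (2 ∣ a ∨ 2 ∣ c)) s) := by
  have hd : (⟨1, 1⟩ : IntRing 1).re * (⟨1, -1⟩ : IntRing 1).im -
    (⟨1, 1⟩ : IntRing 1).im * (⟨1, -1⟩ : IntRing 1).re = -2 := rfl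
  have key := axes_swap.fixedZeta_eq (b := 1) (D₁ := 2) (D₂ := 1) (D₃ := 2 * 2)
    (T₁ := fun _ c => ¬ 3 ∣ c) (T₂ := fun a c => ¬ 3 ∣ c ∧ ¬ 2 ∣ a ∧ ¬ 2 ∣ c)
    (T₃ := fun a c => ¬ 3 ∣ c ∧ (2 ∣ a ∨ 2 ∣ c)) (by norm_num) (by norm_num) (by norm_num)
    (fun a c => (idealSpan_axisLat_false a c).trans isCoprime_swap_one) ?_ ?_
    (fun a c h => exists_half_swap h.2.1 h.2.2)
    (fun a c => index_axisLat_false a c (by norm_num) hd)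
    (fun a c z _ hz => index_half_swap hz)
    (fun a c => index_axisLat_two_mul a c (by norm_num) hd) hs
  · refine ⟨key.1, key.2.trans ?_⟩
    rw [Nat.cast_mul, Complex.natCast_mul_natCast_cpow, Nat.cast_one, Complex.one_cpow, one_mul, Nat.cast_ofNat]
  · intro a c z hz h2
    obtain ⟨h3, h4⟩ := half_swap hz
    have ha : ¬ 2 ∣ (a : ℕ) := by omega
    have hc : ¬ 2 ∣ (c : ℕ) := by omega
    rw [idealSpan_pairLat_eq_top]
    refine Iff.trans ?_ (isCoprime_swap_one.trans
      (and_congr_right fun _ => (and_iff_left ⟨ha, hc⟩).symm))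
    -- As `c` is odd, 2 is invertible modulo `c e₂`. Hence `z` and `2z = a e₁ + c e₂` generate the
    -- same ideal together with `c e₂`.
    have h5 : IsCoprime (2 : IntRing 1) ((c : IntRing 1) * ⟨1, -1⟩) := by
      rw [isCoprime_mul_unit_right_right isUnit_one_neg_one]
      exact (isCoprime_natCast (m := 2)).2 ((Nat.Prime.coprime_iff_not_dvd Nat.prime_two).2 hc)
    constructor
    · rintro ⟨x, y, h⟩
      obtain ⟨p, q, h5⟩ := h5
      refine ⟨p * (x + y), p * (x - y) + q, ?_⟩
      linear_combination h5 + 2 * p * h - p * (x + y) * hz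
    · rintro ⟨x, y, h⟩
      exact ⟨x + y, x - y, by linear_combination h + x * hz⟩
  · intro a c
    by_cases h : 2 ∣ (a : ℕ) ∨ 2 ∣ (c : ℕ)
    · exact (idealSpan_axisLat_two_mul a c h).trans (isCoprime_swap_one.trans
        (and_congr_right fun _ => (and_iff_left h).symm))
    -- For `a` and `c` both odd, both generators `a e₁ ± c e₂` are divisible by 2.
    · push Not at h
      have h1 := two_dvd_add_sub (b := 1) h.1 h.2
      rw [axisLat_two_mul, idealSpan_pairLat_eq_top]
      refine iff_of_false (not_isCoprime_of_dvd (by rw [nrm_two]; norm_num) h1.1 h1.2) ?_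
      tauto

theorem coprimeZeta_false (s : ℂ) : coprimeZeta (fun _ _ => False) s = 0 := by
  have : IsEmpty (CoprimePair fun _ _ => False) := ⟨fun p => p.2.2⟩
  exact tsum_empty

theorem isUnit_I : IsUnit (⟨0, 1⟩ : IntRing 0) := isUnit_of_nrm rfl

theorem one_one_dvd (z : IntRing 0) (h : 2 ∣ z.re + z.im) : (⟨1, 1⟩ : IntRing 0) ∣ z := by
  refine ⟨⟨(z.re + z.im) / 2, (z.im - z.re) / 2⟩, ?_⟩
  ext
  · simp; omega
  · simp; omega

theorem nrm_one_one_ne : nrm (⟨1, 1⟩ : IntRing 0) ≠ 1 := by decide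

/-- Here 2 and `c (1 - i)` share the factor `1 + i`, so 2 cannot be inverted. A Bézout relation for
the generators only gives `gcd(a, c) ∣ 2`, and oddness of `a` finishes. Conversely, `z ≡ 1` modulo
`1 + i`, and `1 + i` lies in the ideal when `a`, `c` are coprime. -/
theorem isCoprime_half_swap {a c : ℕ+} {z : IntRing 0}
    (hz : 2 * z = (a : IntRing 0) * ⟨1, 1⟩ + (c : IntRing 0) * ⟨1, -1⟩)
    (ha : ¬ 2 ∣ (a : ℕ)) :
    IsCoprime z (z - (c : IntRing 0) * ⟨1, -1⟩) ↔ (a : ℕ).Coprime c := by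
  constructor
  · rintro ⟨x, y, h⟩
    have h1 : (a : IntRing 0) * ((x + y) * ⟨1, 1⟩) + (c : IntRing 0) * ((x - y) * ⟨1, -1⟩) = (2 : ℕ) := by
      push_cast
      linear_combination 2 * h - (x + y) * hz
    have h2 := congrArg QuadraticAlgebra.re h1
    rw [QuadraticAlgebra.re_add, natCast_mul_eq, natCast_mul_eq] at h2
    have h3 : ((Nat.gcd a c : ℕ) : ℤ) ∣ 2 := by
      have : (2 : ℤ) = (((2 : ℕ) : IntRing 0)).re := rfl
      rw [this, ← h2]
      exact dvd_add (Dvd.dvd.mul_right (by exact_mod_cast Nat.gcd_dvd_left _ _) _)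
        (Dvd.dvd.mul_right (by exact_mod_cast Nat.gcd_dvd_right _ _) _)
    have h4 : Nat.gcd a c ∣ 2 := by exact_mod_cast h3
    rcases (Nat.dvd_prime Nat.prime_two).1 h4 with h5 | h5
    · exact h5
    · exact absurd (h5 ▸ Nat.gcd_dvd_left _ _) ha
  · intro h
    obtain ⟨h3, h4⟩ := half_swap hz
    obtain ⟨x, y, h⟩ := isCoprime_natCast (b := 0).2 h
    have hI : (⟨0, 1⟩ : IntRing 0) ^ 2 = -1 := by rw [sq]; rfl
    have e1 : (⟨1, 1⟩ : IntRing 0) = 1 + ⟨0, 1⟩ := rfl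
    have e2 : (⟨1, -1⟩ : IntRing 0) = 1 - ⟨0, 1⟩ := rfl
    -- The sum of the coordinates of `z` is the odd number `a`.
    obtain ⟨k, hk⟩ : ∃ k : ℤ, z.re = 2 * k + 1 - z.im := ⟨(z.re + z.im) / 2, by omega⟩
    have e3 : z = 2 * (k : IntRing 0) + 1 - (z.im : IntRing 0) + (z.im : IntRing 0) * ⟨0, 1⟩ := by
      rw [two_mul]
      ext
      · simp [QuadraticAlgebra.re_one]; omega
      · simp [QuadraticAlgebra.im_one]
    rw [e1, e2] at hz
    rw [e2]
    set I : IntRing 0 := ⟨0, 1⟩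
    set n : IntRing 0 := (z.im : IntRing 0)
    -- With `w` the second generator, `z + w = a (1 + I)` and `I (z - w) = c (1 + I)`, so `xa + yc =
    -- 1` gives `1 + I = (x + yI) z + (x - yI) w`. The coefficients come from inserting this into `1
    -- = z - (nI + k(1 - I))(1 + I)`.
    refine ⟨1 - (n * I + k * (1 - I)) * (x + y * I), -(n * I + k * (1 - I)) * (x - y * I), ?_⟩
    linear_combination e3 - (n * I + k * (1 - I)) * (x * hz + (1 + I) * h - y * c * hI) - (n - k) * hI

/-- Invariant primitive sublattices of `ℤ[i]` under the reflection exchanging `1` and `i`. -/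
theorem fixedZeta_swap_zero {s : ℂ} (hs : 1 < s.re) :
    ZetaSummable (fun K : {K : PrimitiveSublattice 0 // twist (⟨0, 1⟩ : IntRing 0) true K.1 = K.1} =>
      K.1.1.index) s ∧
    fixedZeta (⟨0, 1⟩ : IntRing 0) true s = coprimeZeta (fun a c => ¬ 2 ∣ a ∧ ¬ 2 ∣ c) s := by
  have hd : (⟨1, 1⟩ : IntRing 0).re * (⟨1, -1⟩ : IntRing 0).im -
    (⟨1, 1⟩ : IntRing 0).im * (⟨1, -1⟩ : IntRing 0).re = -2 := rfl
  have hdvd : (⟨1, 1⟩ : IntRing 0) ∣ ⟨1, -1⟩ := one_one_dvd _ (by norm_num)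
  -- Both axis vectors are divisible by `1 + i`, so the first and third families contain no
  -- primitive sublattice and only the half type with `a`, `c` odd remains.
  have key := axes_swap.fixedZeta_eq (b := 0) (D₁ := 2) (D₂ := 1) (D₃ := 2 * 2)
    (T₁ := fun _ _ => False) (T₂ := fun a c => ¬ 2 ∣ a ∧ ¬ 2 ∣ c)
    (T₃ := fun _ _ => False) (by norm_num) (by norm_num) (by norm_num)
    (fun a c => (idealSpan_axisLat_false a c).trans (iff_of_false (not_isCoprime_of_dvd
      nrm_one_one_ne (dvd_mul_left _ _) (hdvd.mul_left _)) (by simp))) ?_ ?_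
    (fun a c h => exists_half_swap h.1 h.2)
    (fun a c => index_axisLat_false a c (by norm_num) hd)
    (fun a c z _ hz => index_half_swap hz)
    (fun a c => index_axisLat_two_mul a c (by norm_num) hd) hs
  · refine ⟨key.1, key.2.trans ?_⟩
    rw [coprimeZeta_false, Nat.cast_one, Complex.one_cpow]
    ring
  · intro a c z hz h2
    obtain ⟨h3, h4⟩ := half_swap hz
    have ha : ¬ 2 ∣ (a : ℕ) := by omega
    have hc : ¬ 2 ∣ (c : ℕ) := by omega
    rw [idealSpan_pairLat_eq_top, isCoprime_half_swap hz ha]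
    exact (and_iff_left ⟨ha, hc⟩).symm
  · intro a c
    rw [axisLat_two_mul, idealSpan_pairLat_eq_top]
    refine iff_of_false (not_isCoprime_of_dvd nrm_one_one_ne ?_ ?_) (by simp)
    · exact dvd_add (dvd_mul_left _ _) (hdvd.mul_left _)
    · exact dvd_sub (dvd_mul_left _ _) (hdvd.mul_left _)

/-- Invariant primitive sublattices of `ℤ[i]` under conjugation. -/
theorem fixedZeta_conj_zero {s : ℂ} (hs : 1 < s.re) :
    ZetaSummable (fun K : {K : PrimitiveSublattice 0 // twist (1 : IntRing 0) true K.1 = K.1} =>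
      K.1.1.index) s ∧
    fixedZeta (1 : IntRing 0) true s = coprimeZeta (fun _ _ => True) s +
      (2 : ℂ) ^ (-s) * coprimeZeta (fun a c => 2 ∣ a ∨ 2 ∣ c) s := by
  have hd : (1 : IntRing 0).re * (⟨0, 1⟩ : IntRing 0).im -
    (1 : IntRing 0).im * (⟨0, 1⟩ : IntRing 0).re = 1 := rfl
  have hcop : ∀ a c : ℕ+, IsCoprime ((a : IntRing 0) * 1) ((c : IntRing 0) * ⟨0, 1⟩) ↔
      (a : ℕ).Coprime c := fun a c => by
    rw [isCoprime_mul_unit_right_right isUnit_I, mul_one, isCoprime_natCast]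
  -- Half of `a + c i` is integral only for even `a` and `c`, so the second family is empty.
  have hhalf : ∀ (a c : ℕ+) (z : IntRing 0),
      2 * z = (a : IntRing 0) * 1 + (c : IntRing 0) * ⟨0, 1⟩ → 2 ∣ (a : ℕ) ∧ 2 ∣ (c : ℕ) := by
    intro a c z hz
    have h1 := congrArg QuadraticAlgebra.re hz
    have h2 := congrArg QuadraticAlgebra.im hz
    rw [two_mul] at h1 h2
    simp at h1 h2
    omega
  have key := axes_conj.fixedZeta_eq (D₁ := 1) (D₂ := 1) (D₃ := 2 * 1)
    (T₁ := fun _ _ => True) (T₂ := fun _ _ => False)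
    (T₃ := fun a c => 2 ∣ a ∨ 2 ∣ c) (by norm_num) (by norm_num) (by norm_num)
    (fun a c => ((idealSpan_axisLat_false a c).trans (hcop a c)).trans (and_true _).to_iff.symm)
    (fun a c z hz h => absurd (hhalf a c z hz) h) ?_
    (fun a c h => h.elim)
    (fun a c => index_axisLat_false a c one_ne_zero hd)
    (fun a c z h => h.elim)
    (fun a c => index_axisLat_two_mul a c one_ne_zero hd) hs
  · refine ⟨key.1, key.2.trans ?_⟩
    rw [coprimeZeta_false, Nat.cast_one, Complex.one_cpow]
    norm_num
  · intro a c
    by_cases h : 2 ∣ (a : ℕ) ∨ 2 ∣ (c : ℕ)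
    · exact (idealSpan_axisLat_two_mul a c h).trans ((hcop a c).trans (and_iff_left h).symm)
    -- For odd `a` and `c`, both generators `a ± c i` are divisible by `1 + i`.
    · rw [axisLat_two_mul, idealSpan_pairLat_eq_top]
      refine iff_of_false (not_isCoprime_of_dvd nrm_one_one_ne (one_one_dvd _ ?_)
        (one_one_dvd _ ?_)) (fun h2 => h h2.2)
      · simp
        omega
      · simp
        omega

end Swap

end SubformZeta

namespace SubformZeta

/-! ### Sums over all reflections -/

section AllReflections

variable {b : ℤ}

/-- Multiplication by the unit `v` exchanges the lattices fixed by `u` and by `v²u`. -/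
theorem fixedZeta_conj {u v : IntRing b} (hv : v * star v = 1) (s : ℂ)
    (h : ZetaSummable (fun K : {K : PrimitiveSublattice b // twist u true K.1 = K.1} =>
      K.1.1.index) s) :
    ZetaSummable (fun K : {K : PrimitiveSublattice b // twist (v ^ 2 * u) true K.1 = K.1} =>
      K.1.1.index) s ∧ fixedZeta (v ^ 2 * u) true s = fixedZeta u true s := by
  have hv' : star v * star (star v) = 1 := by rw [star_star, mul_comm]; exact hv
  -- Conjugating `z ↦ u conj(z)` by multiplication with `v` multiplies `u` by `v / conj(v) = v²`.
  have key : ∀ {u v : IntRing b}, v * star v = 1 → ∀ K : AddSubgroup (IntRing b),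
      twist u true K = K → twist (v ^ 2 * u) true (twist v false K) = twist v false K := by
    intro u v hv K hK
    rw [twist_twist]
    conv_rhs => rw [← hK]
    rw [twist_twist]
    congr 1
    rw [tw_true, tw_false]
    linear_combination v * u * hv
  have hinv : ∀ {v : IntRing b}, v * star v = 1 → ∀ K : AddSubgroup (IntRing b),
      twist v false (twist (star v) false K) = K := fun {v} hv K => by
    rw [twist_twist, tw_false, hv]
    exact twist_one_false K
  have hinv' : ∀ K : AddSubgroup (IntRing b), twist (star v) false (twist v false K) = K := fun K => by
    have := hinv hv' K
    rwa [star_star] at this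
  have hu : IsUnit v := IsUnit.of_mul_eq_one _ hv
  have hu' : IsUnit (star v) := IsUnit.of_mul_eq_one _ hv'
  let e : {K : PrimitiveSublattice b // twist u true K.1 = K.1} ≃
      {K : PrimitiveSublattice b // twist (v ^ 2 * u) true K.1 = K.1} :=
    { toFun := fun K => ⟨symAct hu.unit false K.1, key hv _ K.2⟩
      invFun := fun K => ⟨symAct hu'.unit false K.1, by
        have h1 := key hv' _ K.2
        have h2 : star v ^ 2 * (v ^ 2 * u) = u := by
          linear_combination (v * star v + 1) * u * hv
        rwa [h2] at h1⟩
      left_inv := fun K => Subtype.ext (Subtype.ext (hinv' _))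
      right_inv := fun K => Subtype.ext (Subtype.ext (hinv hv _)) }
  have he : ∀ K, (e K).1.1.index = K.1.1.index := fun K => index_map_addEquiv (symEquiv hu.unit false).toAddEquiv K.1.1
  constructor
  · exact (zetaSummable_congr (g := fun K : {K : PrimitiveSublattice b //
      twist u true K.1 = K.1} => K.1.1.index) (h := fun K : {K : PrimitiveSublattice b //
      twist (v ^ 2 * u) true K.1 = K.1} => K.1.1.index) e he s).1 h
  · exact (zetaSeries_congr (g := fun K : {K : PrimitiveSublattice b //
      twist u true K.1 = K.1} => K.1.1.index) (h := fun K : {K : PrimitiveSublattice b //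
      twist (v ^ 2 * u) true K.1 = K.1} => K.1.1.index) e he s).symm

theorem fixed_neg_iff (u : IntRing b) (K : PrimitiveSublattice b) :
    twist u true K.1 = K.1 ↔ twist (-u) true K.1 = K.1 := by
  rw [twist_neg]

theorem zetaSummable_fixed_neg {u : IntRing b} {s : ℂ}
    (h : ZetaSummable (fun K : {K : PrimitiveSublattice b // twist u true K.1 = K.1} =>
      K.1.1.index) s) :
    ZetaSummable (fun K : {K : PrimitiveSublattice b // twist (-u) true K.1 = K.1} =>
      K.1.1.index) s :=
  (zetaSummable_congr (g := fun K : {K : PrimitiveSublattice b //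
      twist u true K.1 = K.1} => K.1.1.index) (h := fun K : {K : PrimitiveSublattice b //
      twist (-u) true K.1 = K.1} => K.1.1.index) (Equiv.subtypeEquivRight (fixed_neg_iff u))
      (fun _ => rfl) s).1 h

theorem two_cpow_ne {s : ℂ} (hs : 1 < s.re) : 1 + (2 : ℂ) ^ (-s) ≠ 0 := by
  have := one_add_prime_cpow_ne_zero Nat.prime_two hs
  exact_mod_cast this

/-- The four reflections are, up to sign, conjugation and the exchange of `1` and `i`. With `y =
2^{-s}` and the coprime sum as unit, twice the two contributions times `1 + y` is `2(1 + y) + 4y² +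
2(1 - y) = 4(1 + y²)`. -/
theorem invariantZeta_zero [Fintype (IntRing 0)ˣ] {s : ℂ} (hs : 1 < s.re) :
    (∀ u : (IntRing 0)ˣ, ZetaSummable (fun K : {K : PrimitiveSublattice 0 //
      twist (u : IntRing 0) true K.1 = K.1} => K.1.1.index) s) ∧
    (1 + (2 : ℂ) ^ (-s)) * invariantZeta 0 s =
      4 * (1 + ((2 : ℂ) ^ (-s)) ^ 2) * coprimeZeta (fun _ _ => True) s := by
  obtain ⟨c1, c2⟩ := fixedZeta_conj_zero hs
  obtain ⟨w1, w2⟩ := fixedZeta_swap_zero hs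
  have e2 : (⟨-1, 0⟩ : IntRing 0) = -1 := rfl
  have e3 : (⟨0, -1⟩ : IntRing 0) = -⟨0, 1⟩ := rfl
  constructor
  · rintro u
    rcases (nrm_eq_one_iff_zero _).1 (isUnit_iff_nrm.1 u.isUnit) with h | h | h | h <;> rw [h]
    · exact c1
    · rw [e2]
      exact zetaSummable_fixed_neg c1
    · exact w1
    · rw [e3]
      exact zetaSummable_fixed_neg w1
  · have hP := coprimeZeta_not_dvd_right (T := fun _ _ => True) Nat.prime_two (by simp) (by simp) hs
    simp only [true_and, Nat.cast_ofNat] at hP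
    have e1 : (⟨1, 0⟩ : IntRing 0) = 1 := rfl
    rw [invariantZeta, sum_units_zero fun u => fixedZeta u true s, e1, e2, e3, fixedZeta_neg,
      fixedZeta_neg, c2, w2]
    linear_combination 2 * (2 : ℂ) ^ (-s) * hP.2.2 + 2 * hP.2.1

/-- All six reflections are conjugate under units up to sign, so the sum is six times one of them.
The condition at 3 costs a factor `1 + 3^{-s}`, and the conditions at 2 combine through `1 + y² +
2y³ = (1 + y)(1 - y + 2y²)` with `y = 2^{-s}`. -/
theorem invariantZeta_one [Fintype (IntRing 1)ˣ] {s : ℂ} (hs : 1 < s.re) :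
    (∀ u : (IntRing 1)ˣ, ZetaSummable (fun K : {K : PrimitiveSublattice 1 //
      twist (u : IntRing 1) true K.1 = K.1} => K.1.1.index) s) ∧
    (1 + (3 : ℂ) ^ (-s)) * invariantZeta 1 s =
      6 * (1 - (2 : ℂ) ^ (-s) + 2 * ((2 : ℂ) ^ (-s)) ^ 2) * coprimeZeta (fun _ _ => True) s := by
  obtain ⟨w1, w2⟩ := fixedZeta_swap_one hs
  have hω : (⟨0, 1⟩ : IntRing 1) * star ⟨0, 1⟩ = 1 := rfl
  obtain ⟨v1, v2⟩ := fixedZeta_conj hω s w1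
  -- Since `ω³ = -1`, multiplying by `ω²` leads from `ω` to `-1` and then to `-ω² = 1 - ω`, which
  -- represent all units up to sign.
  have e0 : (⟨0, 1⟩ : IntRing 1) ^ 2 * ⟨0, 1⟩ = -1 := by rw [sq]; rfl
  rw [e0] at v1 v2
  obtain ⟨x1, x2⟩ := fixedZeta_conj hω s v1
  have e0' : (⟨0, 1⟩ : IntRing 1) ^ 2 * -1 = -⟨-1, 1⟩ := by rw [sq]; rfl
  rw [e0'] at x1 x2
  have e1 : (⟨1, 0⟩ : IntRing 1) = - -1 := rfl
  have e2 : (⟨-1, 0⟩ : IntRing 1) = -1 := rfl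
  have e3 : (⟨0, -1⟩ : IntRing 1) = -⟨0, 1⟩ := rfl
  have e4 : (⟨1, -1⟩ : IntRing 1) = -⟨-1, 1⟩ := rfl
  have e5 : (⟨-1, 1⟩ : IntRing 1) = - -⟨-1, 1⟩ := rfl
  constructor
  · rintro u
    rcases (nrm_eq_one_iff_one _).1 (isUnit_iff_nrm.1 u.isUnit) with h | h | h | h | h | h <;> rw [h]
    · rw [e1]
      exact zetaSummable_fixed_neg v1
    · exact v1
    · exact w1
    · rw [e3]
      exact zetaSummable_fixed_neg w1
    · exact x1
    · rw [e5]
      exact zetaSummable_fixed_neg x1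
  · have hP := coprimeZeta_not_dvd_right (T := fun _ c => ¬ 3 ∣ c) Nat.prime_two (by simp)
      (fun _ c => not_congr (Nat.Coprime.dvd_mul_left (by norm_num))) hs
    have hQ := (coprimeZeta_not_dvd_right (T := fun _ _ => True) Nat.prime_three (by simp) (by simp) hs).1
    simp only [true_and, Nat.cast_ofNat] at hP hQ
    simp only [fixedZeta_neg] at v2 x2
    have hne := two_cpow_ne hs
    rw [invariantZeta, sum_units_one fun u => fixedZeta u true s, e1, e2, e3, e4]
    simp only [fixedZeta_neg]
    rw [x2, v2, w2]
    apply mul_left_cancel₀ hne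
    linear_combination 6 * (1 + (3 : ℂ) ^ (-s)) * hP.2.1 +
      6 * (1 + (3 : ℂ) ^ (-s)) * (2 : ℂ) ^ (-s) * (2 : ℂ) ^ (-s) * hP.2.2 +
      6 * (1 + (2 : ℂ) ^ (-s)) * (1 - (2 : ℂ) ^ (-s) + 2 * ((2 : ℂ) ^ (-s)) ^ 2) * hQ

end AllReflections

end SubformZeta

namespace SubformZeta

/-! ### Counting ideals of given norm -/

section Ideals

variable {R : Type*} [CommRing R] {A B : Ideal R}

/-- Expand `I = I (B + A)`. With `A = (m)` and `B = (n)` this recovers a factor of norm `m` from a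
product of ideals of coprime norms `m` and `n`. -/
theorem mul_sup_eq_of_le {I J : Ideal R} (h : A ⊔ B = ⊤) (hI : A ≤ I) (hJ : B ≤ J) :
    I * J ⊔ A = I := by
  apply le_antisymm (sup_le Ideal.mul_le_left hI)
  calc I = I * (B ⊔ A) := by rw [sup_comm, h, Ideal.mul_top]
    _ = I * B ⊔ I * A := Ideal.mul_sup _ _ _
    _ ≤ _ := sup_le_sup (Ideal.mul_mono le_rfl hJ) Ideal.mul_le_right

theorem sup_mul_sup_eq {K : Ideal R} (h : A ⊔ B = ⊤) (hK : A * B ≤ K) :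
    (K ⊔ A) * (K ⊔ B) = K := by
  apply le_antisymm
  · rw [Ideal.sup_mul, Ideal.mul_sup A]
    exact sup_le Ideal.mul_le_left (sup_le Ideal.mul_le_right hK)
  · calc K = K * (B ⊔ A) := by rw [sup_comm, h, Ideal.mul_top]
      _ = K * B ⊔ K * A := Ideal.mul_sup _ _ _
      _ ≤ _ := sup_le (Ideal.mul_mono le_sup_left le_sup_right)
        (by rw [mul_comm]; exact Ideal.mul_mono le_sup_right le_sup_left)

end Ideals

/-! ### Multiplicativity of the number of ideals, and its values at prime powers. -/

section Counting

variable {b : ℤ}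

theorem span_natCast_sup_eq_top {m n : ℕ} (h : m.Coprime n) :
    Ideal.span {(m : IntRing b)} ⊔ Ideal.span {(n : IntRing b)} = ⊤ := by
  rw [← Ideal.span_union, Set.singleton_union, Ideal.eq_top_iff_one, Ideal.mem_span_pair]
  exact isCoprime_natCast.2 h

theorem span_natCast_mul_le {K : Ideal (IntRing b)} {m n : ℕ} (h : ((m * n : ℕ) : IntRing b) ∈ K) :
    Ideal.span {(m : IntRing b)} * Ideal.span {(n : IntRing b)} ≤ K := by
  rw [Ideal.span_singleton_mul_span_singleton, Ideal.span_singleton_le_iff_mem, ← Nat.cast_mul]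
  exact h

theorem nrm_pow (z : IntRing b) (k : ℕ) : nrm (z ^ k) = nrm z ^ k := by
  induction k with
  | zero => simp [isUnit_iff_nrm.1 isUnit_one]
  | succ k ih => rw [pow_succ, nrm_mul, ih, pow_succ]

theorem nrm_eq_of_associated {x y : IntRing b} (h : Associated x y) : nrm x = nrm y := by
  obtain ⟨u, rfl⟩ := h
  rw [nrm_mul, isUnit_iff_nrm.1 u.isUnit, mul_one]

theorem nrm_natCast (n : ℕ) : nrm (n : IntRing b) = n ^ 2 := by
  rw [nrm, QuadraticAlgebra.norm_def]
  simp [Int.natAbs_mul, sq]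

variable [Fact (b = 0 ∨ b = 1)]

theorem natCast_mem_of_absNorm_eq {I : Ideal (IntRing b)} {n : ℕ} (h : Ideal.absNorm I = n) :
    (n : IntRing b) ∈ I := h ▸ Ideal.absNorm_mem I

theorem absNorm_dvd_sq {K : Ideal (IntRing b)} {m : ℕ} :
    Ideal.absNorm (K ⊔ Ideal.span {(m : IntRing b)}) ∣ m ^ 2 := by
  have h := Ideal.absNorm_dvd_absNorm_of_le (le_sup_right : Ideal.span {(m : IntRing b)} ≤ K ⊔ _)
  rwa [absNorm_span, nrm_natCast] at h

/-- Multiplication of ideals is a bijection. An ideal `K` of norm `mn` splits as `(K + (m)) (K +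
(n))`, and the first factor is recovered from a product by adding `(m)`. -/
theorem idealCount_mul {m n : ℕ} (h : m.Coprime n) :
    idealCount b (m * n) = idealCount b m * idealCount b n := by
  rw [idealCount, idealCount, idealCount, ← Nat.card_prod]
  refine (Nat.card_congr (Equiv.ofBijective (fun p :
      {I : NonzeroIdeal (IntRing b) // Ideal.absNorm I.1 = m} ×
      {I : NonzeroIdeal (IntRing b) // Ideal.absNorm I.1 = n} =>
    (⟨⟨p.1.1.1 * p.2.1.1, mul_ne_zero p.1.1.2 p.2.1.2⟩, by rw [map_mul, p.1.2, p.2.2]⟩ :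
      {I : NonzeroIdeal (IntRing b) // Ideal.absNorm I.1 = m * n})) ⟨?_, ?_⟩)).symm
  · rintro ⟨⟨⟨I, hI⟩, hm⟩, ⟨⟨J, hJ⟩, hn⟩⟩ ⟨⟨⟨I', hI'⟩, hm'⟩, ⟨⟨J', hJ'⟩, hn'⟩⟩ H
    have H1 : I * J = I' * J' := congrArg (fun x => x.1.1) H
    have e1 := mul_sup_eq_of_le (span_natCast_sup_eq_top h) ((Ideal.span_singleton_le_iff_mem I).2 (natCast_mem_of_absNorm_eq hm))
      ((Ideal.span_singleton_le_iff_mem J).2 (natCast_mem_of_absNorm_eq hn))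
    have e2 := mul_sup_eq_of_le (span_natCast_sup_eq_top h) ((Ideal.span_singleton_le_iff_mem I').2 (natCast_mem_of_absNorm_eq hm'))
      ((Ideal.span_singleton_le_iff_mem J').2 (natCast_mem_of_absNorm_eq hn'))
    obtain rfl : I = I' := by rw [H1] at e1; exact e1.symm.trans e2
    obtain rfl : J = J' := mul_left_cancel₀ hI H1
    rfl
  · rintro ⟨⟨K, hK⟩, hmn⟩
    have e := sup_mul_sup_eq (span_natCast_sup_eq_top h) (span_natCast_mul_le (natCast_mem_of_absNorm_eq hmn))
    have hN := congrArg Ideal.absNorm e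
    have hmn' : Ideal.absNorm K = m * n := hmn
    rw [map_mul, hmn'] at hN
    -- This norm divides `m²`, which is coprime to `n`, and it divides `mn`. Since the two norms
    -- divide `m` and `n` and have product `mn`, they equal `m` and `n`.
    have h1 : Ideal.absNorm (K ⊔ Ideal.span {(m : IntRing b)}) ∣ m :=
      ((h.pow_left 2).coprime_dvd_left absNorm_dvd_sq).dvd_of_dvd_mul_right (hN ▸ dvd_mul_right _ _)
    have h2 : Ideal.absNorm (K ⊔ Ideal.span {(n : IntRing b)}) ∣ n :=
      ((h.symm.pow_left 2).coprime_dvd_left absNorm_dvd_sq).dvd_of_dvd_mul_left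
        (hN ▸ dvd_mul_left _ _)
    have h0 : m * n ≠ 0 := by
      rw [← hmn']
      exact absNorm_ne_zero (⟨K, hK⟩ : NonzeroIdeal (IntRing b))
    have hm0 : 0 < m := Nat.pos_of_ne_zero (left_ne_zero_of_mul h0)
    have hn0 : 0 < n := Nat.pos_of_ne_zero (right_ne_zero_of_mul h0)
    have g1 := Nat.le_of_dvd hm0 h1
    have g2 := Nat.le_of_dvd hn0 h2
    have k1 : Ideal.absNorm (K ⊔ Ideal.span {(m : IntRing b)}) = m := by
      apply le_antisymm g1
      by_contra hlt
      push Not at hlt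
      exact (Nat.mul_lt_mul_of_lt_of_le hlt g2 hn0).ne hN
    have k2 : Ideal.absNorm (K ⊔ Ideal.span {(n : IntRing b)}) = n := by
      rw [k1] at hN
      exact Nat.eq_of_mul_eq_mul_left hm0 hN
    have hne : ∀ x : IntRing b, K ⊔ Ideal.span {x} ≠ ⊥ := fun x hx =>
      hK (le_bot_iff.1 (hx ▸ le_sup_left))
    exact ⟨(⟨⟨_, hne _⟩, k1⟩, ⟨⟨_, hne _⟩, k2⟩), Subtype.ext (Subtype.ext e)⟩

/-- Principal ideals with prescribed generators of norm `n`. -/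
theorem idealCount_eq_card {X : Type*} [Finite X] {n : ℕ} (g : X → IntRing b)
    (hg : ∀ x, nrm (g x) = n) (hn : n ≠ 0) (hinj : ∀ x y, Associated (g x) (g y) → x = y)
    (hsurj : ∀ z, nrm z = n → ∃ x, Associated (g x) z) : idealCount b n = Nat.card X := by
  have h0 : ∀ x, g x ≠ 0 := fun x hx => hn (by rw [← hg x, hx]; exact nrm_eq_zero.2 rfl)
  refine (Nat.card_congr (Equiv.ofBijective (fun x => (⟨⟨Ideal.span {g x}, by simpa using h0 x⟩, by
    rw [absNorm_span, hg]⟩ : {I : NonzeroIdeal (IntRing b) // Ideal.absNorm I.1 = n})) ⟨?_, ?_⟩)).symm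
  · intro x y h
    exact hinj x y (Ideal.span_singleton_eq_span_singleton.1 (congrArg (fun I => I.1.1) h))
  · rintro ⟨I, hI⟩
    obtain ⟨x, hx⟩ := hsurj (gen I) (by rw [nrm_gen, hI])
    refine ⟨x, Subtype.ext (Subtype.ext ?_)⟩
    exact (Ideal.span_singleton_eq_span_singleton.2 hx).trans (span_gen I)

theorem dvd_natCast_of_nrm {z : IntRing b} {n : ℕ} (h : nrm z = n) : z ∣ (n : IntRing b) :=
  ⟨star z, by rw [mul_star_eq, h]⟩

theorem prime_of_nrm {π : IntRing b} (h : (nrm π).Prime) : Prime π := by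
  refine Irreducible.prime ⟨fun hu => h.ne_one (isUnit_iff_nrm.1 hu), fun x y hxy => ?_⟩
  rw [hxy, nrm_mul] at h
  rw [isUnit_iff_nrm, isUnit_iff_nrm]
  rcases Nat.prime_mul_iff.1 h with h | h
  · exact Or.inr h.2
  · exact Or.inl h.2

/-- Ideals of prime power norm at a ramified prime. -/
theorem idealCount_ramified {p : ℕ} (hp : p.Prime) {π : IntRing b} (hπ : nrm π = p)
    (h : Associated (star π) π) (k : ℕ) : idealCount b (p ^ k) = 1 := by
  have hπ' : Prime π := prime_of_nrm (hπ ▸ hp)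
  rw [idealCount_eq_card (X := Unit) (fun _ => π ^ k) (fun _ => by rw [nrm_pow, hπ])
    (pow_ne_zero _ hp.ne_zero) (fun _ _ _ => rfl) fun z hz => ?_]
  · exact Nat.card_unique
  -- At a ramified prime `p` is associated to `π²`, so any element of norm `p^k`, being a divisor of
  -- `p^k`, is a power of `π` up to units.
  · have h1 : Associated ((p : IntRing b) ^ k) (π ^ (2 * k)) := by
      rw [← hπ, ← mul_star_eq, pow_mul, sq]
      exact (h.mul_left π).pow_pow
    have h2 := (dvd_natCast_of_nrm hz).trans ((Nat.cast_pow (α := IntRing b) p k) ▸ h1.dvd)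
    obtain ⟨i, -, hi⟩ := (dvd_prime_pow hπ' _).1 h2
    have h3 := nrm_eq_of_associated hi
    rw [hz, nrm_pow, hπ] at h3
    rw [Nat.pow_right_injective hp.two_le h3]
    exact ⟨(), hi.symm⟩

/-- Since `N(p) = p²`, a proper factor would have norm `p`. -/
theorem prime_natCast_of_inert {p : ℕ} (hp : p.Prime) (h : ∀ z : IntRing b, nrm z ≠ p) :
    Prime (p : IntRing b) := by
  refine Irreducible.prime ⟨fun hu => ?_, fun x y hxy => ?_⟩
  · rw [isUnit_iff_nrm, nrm_natCast] at hu
    exact hp.ne_one (by simpa using hu)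
  · have h1 := congrArg nrm hxy
    rw [nrm_natCast, nrm_mul] at h1
    rw [isUnit_iff_nrm, isUnit_iff_nrm]
    obtain ⟨i, hi, hx⟩ := (Nat.dvd_prime_pow hp).1 (Dvd.intro _ h1.symm)
    interval_cases i
    · exact Or.inl (by simpa using hx)
    · exact absurd (by simpa using hx) (h x)
    · right
      rw [hx] at h1
      exact (mul_right_eq_self₀.1 h1.symm).resolve_right (pow_ne_zero _ hp.ne_zero)

/-- Ideals of prime power norm at an inert prime. -/
theorem idealCount_inert {p : ℕ} (hp : p.Prime) (h : ∀ z : IntRing b, nrm z ≠ p) (k : ℕ) :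
    idealCount b (p ^ k) = if Even k then 1 else 0 := by
  have hp' : Prime (p : IntRing b) := prime_natCast_of_inert hp h
  have key : ∀ z : IntRing b, nrm z = p ^ k → ∃ i, k = 2 * i ∧ Associated ((p : IntRing b) ^ i) z := by
    intro z hz
    have h2 := dvd_natCast_of_nrm hz
    rw [Nat.cast_pow] at h2
    obtain ⟨i, -, hi⟩ := (dvd_prime_pow hp' _).1 h2
    have h3 := nrm_eq_of_associated hi
    rw [hz, nrm_pow, nrm_natCast, ← pow_mul] at h3
    exact ⟨i, Nat.pow_right_injective hp.two_le h3, hi.symm⟩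
  split_ifs with hk
  · obtain ⟨i, rfl⟩ := hk.exists_two_nsmul
    rw [smul_eq_mul] at key ⊢
    rw [idealCount_eq_card (X := Unit) (fun _ => (p : IntRing b) ^ i)
      (fun _ => by rw [nrm_pow, nrm_natCast, pow_mul])
      (pow_ne_zero _ hp.ne_zero) (fun _ _ _ => rfl) fun z hz => ?_]
    · exact Nat.card_unique
    · obtain ⟨j, hj, h⟩ := key z hz
      obtain rfl : i = j := by omega
      exact ⟨(), h⟩
  · rw [idealCount_eq_card (X := Empty) (fun x => x.elim) (fun x => x.elim)
      (pow_ne_zero _ hp.ne_zero) (fun x => x.elim) fun z hz => ?_]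
    · exact Nat.card_of_isEmpty
    · obtain ⟨j, hj, h⟩ := key z hz
      exact absurd ⟨j, by omega⟩ hk

/-- Ideals of prime power norm at a split prime. -/
theorem idealCount_split {p : ℕ} (hp : p.Prime) {π : IntRing b} (hπ : nrm π = p)
    (h : ¬ Associated (star π) π) (k : ℕ) : idealCount b (p ^ k) = k + 1 := by
  have h1 : Prime π := prime_of_nrm (hπ ▸ hp)
  have h2 : Prime (star π) := prime_of_nrm (by rw [nrm_star, hπ]; exact hp)
  have h3 : ¬ π ∣ star π := fun hd => h ((h1.dvd_prime_iff_associated h2).1 hd).symm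
  rw [idealCount_eq_card (X := Fin (k + 1)) (fun i => π ^ (i : ℕ) * star π ^ (k - i))
    (fun i => ?_) (pow_ne_zero _ hp.ne_zero) (fun i j hij => ?_) fun z hz => ?_]
  · exact Nat.card_fin _
  · rw [nrm_mul, nrm_pow, nrm_pow, nrm_star, hπ, ← pow_add]
    congr 1
    omega
  -- As `π` does not divide `star π`, the exponent of `π` is an invariant of the associate class.
  · have key : ∀ i j : Fin (k + 1), Associated (π ^ (i : ℕ) * star π ^ (k - i))
        (π ^ (j : ℕ) * star π ^ (k - j)) → j ≤ i := by
      intro i j hij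
      by_contra hlt
      push Not at hlt
      have hlt' : (i : ℕ) + 1 ≤ j := hlt
      have h4 : π ^ ((i : ℕ) + 1) ∣ π ^ (i : ℕ) * star π ^ (k - i) :=
        ((pow_dvd_pow π hlt').trans (dvd_mul_right _ _)).trans hij.symm.dvd
      rw [pow_succ] at h4
      exact h3 (h1.dvd_of_dvd_pow ((mul_dvd_mul_iff_left (pow_ne_zero _ h1.ne_zero)).1 h4))
    exact le_antisymm (key j i hij.symm) (key i j hij)
  · have h4 := dvd_natCast_of_nrm hz
    rw [Nat.cast_pow, ← hπ, ← mul_star_eq, mul_pow] at h4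
    obtain ⟨x, y, hx, hy, rfl⟩ := exists_dvd_and_dvd_of_dvd_mul h4
    obtain ⟨i, -, hi⟩ := (dvd_prime_pow h1 _).1 hx
    obtain ⟨j, -, hj⟩ := (dvd_prime_pow h2 _).1 hy
    have h5 : nrm (x * y) = p ^ (i + j) := by
      rw [nrm_mul, nrm_eq_of_associated hi, nrm_eq_of_associated hj, nrm_pow, nrm_pow, nrm_star, hπ,
        pow_add]
    obtain rfl : k = i + j := Nat.pow_right_injective hp.two_le (hz.symm.trans h5)
    refine ⟨⟨i, by omega⟩, ?_⟩
    change Associated (π ^ i * star π ^ (i + j - i)) (x * y)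
    rw [Nat.add_sub_cancel_left]
    exact (hi.mul_mul hj).symm

end Counting

end SubformZeta

namespace SubformZeta

/-! ### The decomposition of rational primes -/

/-- The decomposition law: primes `≡ 1` split, primes `≡ i` are inert and `q` is ramified. -/
structure SplitLaw (b : ℤ) [Fact (b = 0 ∨ b = 1)] (n i q : ℕ) : Prop where
  split : ∀ p : ℕ, p.Prime → p ≡ 1 [MOD n] → ∀ k, idealCount b (p ^ k) = k + 1
  inert : ∀ p : ℕ, p.Prime → p ≡ i [MOD n] → ∀ k, idealCount b (p ^ k) = if Even k then 1 else 0
  ramified : ∀ k, idealCount b (q ^ k) = 1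
  prime : q.Prime
  cases : ∀ p : ℕ, p.Prime → p ≡ 1 [MOD n] ∨ p ≡ i [MOD n] ∨ p = q
  one_ne : ¬ 1 ≡ i [MOD n]
  ne_one : ¬ q ≡ 1 [MOD n]
  ne_inert : ¬ q ≡ i [MOD n]

section Decomposition

variable {b : ℤ} [Fact (b = 0 ∨ b = 1)]

/-- If `π` is associated to its conjugate, it divides its own trace; taking norms, `p` divides the
square of the trace. -/
theorem dvd_two_mul_of_associated {p : ℕ} {π : IntRing b} (hp : p.Prime) (hπ : nrm π = p)
    (h : Associated (star π) π) : (p : ℤ) ∣ 2 * π.re + b * π.im := by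
  obtain ⟨n, hn⟩ : ∃ n : ℤ, n = 2 * π.re + b * π.im := ⟨_, rfl⟩
  rw [← hn]
  have h1 : π ∣ (n : IntRing b) := by
    have : (n : IntRing b) = π + star π := by
      ext
      · rw [QuadraticAlgebra.re_add, QuadraticAlgebra.re_star, QuadraticAlgebra.re_intCast, hn, Int.cast_id]
        ring
      · simp
    rw [this]
    exact dvd_add dvd_rfl h.dvd'
  obtain ⟨w, hw⟩ := h1
  have h2 := congrArg QuadraticAlgebra.norm hw
  rw [map_mul, ← coe_nrm π, hπ, QuadraticAlgebra.norm_def] at h2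
  have h3 : (p : ℤ) ∣ n ^ 2 := ⟨w.norm, by rw [← h2]; simp; ring⟩
  exact (Nat.prime_iff_prime_int.1 hp).dvd_of_dvd_pow h3

theorem norm_eq_cast {π : IntRing b} {p : ℕ} (hπ : nrm π = p) :
    π.re ^ 2 + b * π.re * π.im + π.im ^ 2 = p := by
  have := coe_nrm π
  rw [hπ, QuadraticAlgebra.norm_def] at this
  linear_combination -this

theorem not_sq_dvd {p : ℕ} (hp : p.Prime) {π : IntRing b} (hπ : nrm π = p) :
    ¬ ((p : ℤ) ∣ π.re ∧ (p : ℤ) ∣ π.im) := by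
  rintro ⟨⟨x, hx⟩, ⟨y, hy⟩⟩
  have h := norm_eq_cast hπ
  rw [hx, hy] at h
  have hp0 : (p : ℤ) ≠ 0 := by exact_mod_cast hp.ne_zero
  have h1 : (p : ℤ) * (x ^ 2 + b * x * y + y ^ 2) = 1 := by
    apply mul_left_cancel₀ hp0
    linear_combination h
  have h2 : (p : ℤ) ∣ 1 := ⟨_, h1.symm⟩
  exact (Nat.prime_iff_prime_int.1 hp).not_isUnit (isUnit_of_dvd_one h2)

end Decomposition

/-- Otherwise `p` would divide the trace, hence both coordinates of `π`, and `p²` would divide `N(π)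
= p`. -/
theorem not_associated_zero {p : ℕ} (hp : p.Prime) (h2 : p ≠ 2) {π : IntRing 0} (hπ : nrm π = p) :
    ¬ Associated (star π) π := by
  intro h
  have hpi := Nat.prime_iff_prime_int.1 hp
  have h1 := dvd_two_mul_of_associated hp hπ h
  rw [zero_mul, add_zero] at h1
  have hn2 : ¬ (p : ℤ) ∣ 2 := fun hd => h2 ((Nat.prime_dvd_prime_iff_eq hp Nat.prime_two).1
    (by exact_mod_cast hd))
  have hre := (hpi.dvd_or_dvd h1).resolve_left hn2
  have hN := norm_eq_cast hπ
  have him : (p : ℤ) ∣ π.im ^ 2 := by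
    have : π.im ^ 2 = p - π.re * π.re := by linear_combination hN
    rw [this]
    exact dvd_sub dvd_rfl (hre.mul_right _)
  exact not_sq_dvd hp hπ ⟨hre, hpi.dvd_of_dvd_pow him⟩

theorem not_associated_one {p : ℕ} (hp : p.Prime) (h2 : p ≠ 2) (h3 : p ≠ 3) {π : IntRing 1}
    (hπ : nrm π = p) : ¬ Associated (star π) π := by
  intro h
  have hpi := Nat.prime_iff_prime_int.1 hp
  have h1 := dvd_two_mul_of_associated hp hπ h
  have hn2 : ¬ (p : ℤ) ∣ 2 := fun hd => h2 ((Nat.prime_dvd_prime_iff_eq hp Nat.prime_two).1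
    (by exact_mod_cast hd))
  have hn3 : ¬ (p : ℤ) ∣ 3 := fun hd => h3 ((Nat.prime_dvd_prime_iff_eq hp Nat.prime_three).1
    (by exact_mod_cast hd))
  have hN := norm_eq_cast hπ
  have him : (p : ℤ) ∣ 3 * π.im ^ 2 := by
    have : 3 * π.im ^ 2 = 4 * p - (2 * π.re + 1 * π.im) * (2 * π.re + 1 * π.im) := by
      linear_combination 4 * hN
    rw [this]
    exact dvd_sub (dvd_mul_left _ _) (h1.mul_right _)
  have him := hpi.dvd_of_dvd_pow ((hpi.dvd_or_dvd him).resolve_left hn3)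
  have hre : (p : ℤ) ∣ 2 * π.re := by
    have := dvd_sub h1 him
    rwa [show 2 * π.re + 1 * π.im - π.im = 2 * π.re by ring] at this
  exact not_sq_dvd hp hπ ⟨(hpi.dvd_or_dvd hre).resolve_left hn2, him⟩

/-- Primes `1` modulo 4 are sums of two squares, no sum of two squares is `3` modulo 4, and `2 = N(1
+ i)` with `1 + i` associated to its conjugate. -/
theorem splitLaw_zero : SplitLaw 0 4 3 2 where
  split p hp h := by
    have := Fact.mk hp
    have h4 : p % 4 = 1 := h
    obtain ⟨x, y, hxy⟩ := Nat.Prime.sq_add_sq (p := p) (by omega)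
    have hπ : nrm (⟨x, y⟩ : IntRing 0) = p := by
      rw [nrm, QuadraticAlgebra.norm_def, ← hxy]
      simp only [zero_mul, add_zero]
      zify
      rw [abs_of_nonneg (by nlinarith)]
      ring
    exact idealCount_split hp hπ (not_associated_zero hp (by omega) hπ)
  inert p hp h := by
    refine idealCount_inert hp fun z hz => ?_
    have h4 : p % 4 = 3 := h
    have hN := norm_eq_cast hz
    have h5 : (p : ℤ) % 4 = 3 := by omega
    rw [← hN] at h5
    rcases Int.emod_two_eq_zero_or_one z.re with h6 | h6 <;>
      rcases Int.emod_two_eq_zero_or_one z.im with h7 | h7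
    all_goals
      obtain ⟨k, hk⟩ : ∃ k, z.re = 2 * k + z.re % 2 := ⟨z.re / 2, by omega⟩
      obtain ⟨l, hl⟩ : ∃ l, z.im = 2 * l + z.im % 2 := ⟨z.im / 2, by omega⟩
      rw [hk, hl, h6, h7] at h5
      ring_nf at h5
      omega
  ramified := by
    refine idealCount_ramified Nat.prime_two (π := ⟨1, 1⟩) (by decide) ?_
    exact ⟨(isUnit_I).unit, by ext <;> simp⟩
  prime := Nat.prime_two
  cases p hp := by
    rcases hp.eq_two_or_odd with h | h
    · exact Or.inr (Or.inr h)
    · have : p % 4 = 1 ∨ p % 4 = 3 := by omega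
      rcases this with h | h
      · exact Or.inl h
      · exact Or.inr (Or.inl h)
  one_ne := by decide
  ne_one := by decide
  ne_inert := by decide

/-- An element of order 3 modulo `p` yields `t` with `p ∣ t² + t + 1 = (t + ω)(t + conj ω)`. Both
factors have `ω`-coordinate `±1`, so `p` divides neither and is not prime in the ring; hence some
element has norm `p`. -/
theorem exists_nrm_eq_one {p : ℕ} (hp : p.Prime) (h : p % 3 = 1) : ∃ π : IntRing 1, nrm π = p := by
  have := Fact.mk hp
  have h3 : Fact (Nat.Prime 3) := ⟨Nat.prime_three⟩
  have hcard : 3 ∣ Fintype.card (ZMod p)ˣ := by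
    rw [ZMod.card_units]
    omega
  obtain ⟨g, hg⟩ := exists_prime_orderOf_dvd_card 3 hcard
  have hg3 : (g : ZMod p) ^ 3 = 1 := by
    rw [← Units.val_pow_eq_pow_val, ← hg, pow_orderOf_eq_one, Units.val_one]
  have hg1 : (g : ZMod p) - 1 ≠ 0 := fun h0 => by
    have : g = 1 := Units.ext (sub_eq_zero.1 h0)
    rw [this, orderOf_one] at hg
    omega
  have hroot : (g : ZMod p) ^ 2 + g + 1 = 0 := by
    apply mul_left_cancel₀ hg1
    linear_combination hg3
  obtain ⟨t, ht⟩ := ZMod.intCast_surjective (g : ZMod p)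
  have hdvd : (p : ℤ) ∣ t ^ 2 + t + 1 := by
    rw [← ZMod.intCast_zmod_eq_zero_iff_dvd]
    push_cast
    rw [ht]
    exact hroot
  have hnot : ∀ w : IntRing 1, w.im = 1 ∨ w.im = -1 → ¬ (p : IntRing 1) ∣ w := by
    rintro w hw ⟨v, rfl⟩
    rw [natCast_mul_eq] at hw
    have h1 : (p : ℤ) ∣ 1 := by
      rcases hw with hw | hw
      · exact ⟨v.im, hw.symm⟩
      · exact ⟨-v.im, by linarith [show (p : ℤ) * v.im = -1 from hw]⟩
    exact (Nat.prime_iff_prime_int.1 hp).not_isUnit (isUnit_of_dvd_one h1)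
  have hnp : ¬ Prime (p : IntRing 1) := by
    intro hpr
    obtain ⟨k, hk⟩ := hdvd
    have h1 : (p : IntRing 1) ∣ (⟨t, 1⟩ : IntRing 1) * star ⟨t, 1⟩ := by
      refine ⟨(k : IntRing 1), ?_⟩
      rw [natCast_mul_eq]
      ext
      · simp
        linarith
      · simp
    rcases hpr.dvd_or_dvd h1 with h2 | h2
    · exact hnot _ (Or.inl rfl) h2
    · exact hnot _ (Or.inr rfl) h2
  by_contra hne
  push Not at hne
  exact hnp (prime_natCast_of_inert hp hne)

/-- The form `x² + xy + y²` is never `2` modulo 3, and `3 = N(1 + ω)` with `1 + ω` associated to its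
conjugate. -/
theorem splitLaw_one : SplitLaw 1 3 2 3 where
  split p hp h := by
    have h4 : p % 3 = 1 := h
    obtain ⟨π, hπ⟩ := exists_nrm_eq_one hp h4
    exact idealCount_split hp hπ (not_associated_one hp (by omega) (by omega) hπ)
  inert p hp h := by
    refine idealCount_inert hp fun z hz => ?_
    have h4 : p % 3 = 2 := h
    have hN := norm_eq_cast hz
    have h5 : (p : ℤ) % 3 = 2 := by omega
    rw [← hN] at h5
    have h6 : z.re % 3 = 0 ∨ z.re % 3 = 1 ∨ z.re % 3 = 2 := by omega
    have h7 : z.im % 3 = 0 ∨ z.im % 3 = 1 ∨ z.im % 3 = 2 := by omega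
    rcases h6 with h6 | h6 | h6 <;> rcases h7 with h7 | h7 | h7
    all_goals
      obtain ⟨k, hk⟩ : ∃ k, z.re = 3 * k + z.re % 3 := ⟨z.re / 3, by omega⟩
      obtain ⟨l, hl⟩ : ∃ l, z.im = 3 * l + z.im % 3 := ⟨z.im / 3, by omega⟩
      rw [hk, hl, h6, h7] at h5
      ring_nf at h5
      omega
  ramified := by
    refine idealCount_ramified Nat.prime_three (π := ⟨1, 1⟩) (by decide) ?_
    exact ⟨(isUnit_of_nrm (x := (⟨0, 1⟩ : IntRing 1)) rfl).unit, by ext <;> simp⟩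
  prime := Nat.prime_three
  cases p hp := by
    by_cases h0 : p = 3
    · exact Or.inr (Or.inr h0)
    · have h1 : ¬ 3 ∣ p := fun h => h0 ((Nat.prime_dvd_prime_iff_eq Nat.prime_three hp).1 h).symm
      have : p % 3 = 1 ∨ p % 3 = 2 := by omega
      rcases this with h | h
      · exact Or.inl h
      · exact Or.inr (Or.inl h)
  one_ne := by decide
  ne_one := by decide
  ne_inert := by decide

end SubformZeta

namespace SubformZeta

/-! ### Euler products -/

section EulerProducts

theorem norm_prime_cpow_le {p : ℕ} (hp : p.Prime) {s : ℂ} (hs : 1 < s.re) :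
    ‖(p : ℂ) ^ (-s)‖ ≤ 1 / 2 := by
  rw [Complex.norm_natCast_cpow_of_pos hp.pos, Complex.neg_re]
  have h2 : (2 : ℝ) ≤ p := by exact_mod_cast hp.two_le
  calc (p : ℝ) ^ (-s.re) ≤ (p : ℝ) ^ (-1 : ℝ) :=
        Real.rpow_le_rpow_of_exponent_le (by linarith) (by linarith)
    _ = (p : ℝ)⁻¹ := Real.rpow_neg_one _
    _ ≤ 1 / 2 := by
        rw [one_div]
        exact inv_anti₀ (by norm_num) h2

theorem one_sub_prime_cpow_ne_zero {p : ℕ} (hp : p.Prime) {s : ℂ} (hs : 1 < s.re) :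
    1 - (p : ℂ) ^ (-s) ≠ 0 := by
  intro h
  have h1 := norm_prime_cpow_le hp hs
  rw [← sub_eq_zero.1 h, norm_one] at h1
  norm_num at h1

theorem norm_inv_one_add_le {y : ℂ} (h : ‖y‖ ≤ 1 / 2) : ‖(1 + y)⁻¹‖ ≤ 2 := by
  rw [norm_inv]
  have h1 : 1 / 2 ≤ ‖1 + y‖ := by
    have := norm_sub_le (1 + y) y
    rw [add_sub_cancel_right, norm_one] at this
    linarith
  calc ‖1 + y‖⁻¹ ≤ (1 / 2)⁻¹ := inv_anti₀ (by norm_num) h1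
    _ = 2 := by norm_num

theorem summable_norm_prime_cpow (n a : ℕ) {s : ℂ} (hs : 1 < s.re) :
    Summable fun p : PrimesMod n a => ‖(p.1 : ℂ) ^ (-s)‖ :=
  ((zetaSummable_pnat hs).comp (fun p : PrimesMod n a => (⟨p.1, p.2.1.pos⟩ : ℕ+))
    fun _ _ h => Subtype.ext (congrArg PNat.val h)).norm_cpow

theorem multipliable_primesMod (n a : ℕ) {s : ℂ} (hs : 1 < s.re) :
    Multipliable (fun p : PrimesMod n a => 1 - (p.1 : ℂ) ^ (-s)) ∧
    Multipliable (fun p : PrimesMod n a => 1 + (p.1 : ℂ) ^ (-s)) ∧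
    Multipliable (fun p : PrimesMod n a => (1 + (p.1 : ℂ) ^ (-s))⁻¹) := by
  have h := summable_norm_prime_cpow n a hs
  refine ⟨?_, multipliable_one_add_of_summable h, ?_⟩
  · refine (multipliable_congr fun p => sub_eq_add_neg _ _).2 ?_
    exact multipliable_one_add_of_summable (by simpa only [norm_neg] using h)
  -- The form `1 + (small)` needed for multipliability; the bound `|p^{-s}| ≤ 1/2` keeps the
  -- remaining inverse at most 2.
  · have h1 : ∀ p : PrimesMod n a, (1 + (p.1 : ℂ) ^ (-s))⁻¹ =
        1 + -((p.1 : ℂ) ^ (-s) * (1 + (p.1 : ℂ) ^ (-s))⁻¹) := fun p => by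
      have := one_add_prime_cpow_ne_zero p.2.1 hs
      field_simp
      ring
    refine (multipliable_congr h1).2 ?_
    refine multipliable_one_add_of_summable (Summable.of_nonneg_of_le (fun _ => norm_nonneg _)
      (fun p => ?_) (h.mul_right 2))
    rw [norm_neg, norm_mul]
    exact mul_le_mul_of_nonneg_left (norm_inv_one_add_le (norm_prime_cpow_le p.2.1 hs))
      (norm_nonneg _)

/-- Padding with factors 1 makes a product over a residue class comparable, prime by prime, with
Euler products over all primes. -/
theorem hasProd_primesMod {n a : ℕ} {f : ℕ → ℂ} (h : Multipliable fun p : PrimesMod n a => f p.1) :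
    HasProd (fun p : Nat.Primes => if p.1 ≡ a [MOD n] then f p.1 else 1)
      (∏' p : PrimesMod n a, f p.1) := by
  let g : PrimesMod n a → Nat.Primes := fun p => ⟨p.1, p.2.1⟩
  have hg : Function.Injective g := fun p q hpq => Subtype.ext (congrArg (fun x : Nat.Primes => x.1) hpq)
  refine (hg.hasProd_iff fun p hp => if_neg fun h => hp ⟨⟨p.1, p.2, h⟩, rfl⟩).1 ?_
  convert h.hasProd using 1
  funext p
  exact if_pos p.2.2

theorem natCast_pow_cpow (n e : ℕ) (z : ℂ) : ((n ^ e : ℕ) : ℂ) ^ z = ((n : ℂ) ^ z) ^ e := by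
  induction e with
  | zero => simp
  | succ e ih => rw [pow_succ, Nat.cast_mul, Complex.natCast_mul_natCast_cpow, ih, pow_succ]

theorem hasProd_LSeries {a : ℕ → ℂ} {s : ℂ} (h1 : a 1 = 1)
    (hmul : ∀ m n : ℕ, m.Coprime n → a (m * n) = a m * a n) (hs : LSeriesSummable a s)
    {F : Nat.Primes → ℂ}
    (hF : ∀ p : Nat.Primes, HasSum (fun e : ℕ => a (p.1 ^ e) * ((p.1 : ℂ) ^ (-s)) ^ e) (F p)) :
    HasProd F (LSeries a s) := by
  have hterm : ∀ n : ℕ, n ≠ 0 → LSeries.term a s n = a n * (n : ℂ) ^ (-s) := fun n hn => by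
    rw [LSeries.term_of_ne_zero hn, Complex.cpow_neg, div_eq_mul_inv]
  have key := EulerProduct.eulerProduct_hasProd (f := LSeries.term a s)
    (by rw [hterm 1 one_ne_zero, h1]; simp) (fun {m n} hmn => ?_) hs.norm (LSeries.term_zero a s)
  · rw [LSeries]
    convert key using 1
    funext p
    refine ((hF p).tsum_eq.symm.trans (tsum_congr fun e => ?_))
    rw [hterm _ (pow_ne_zero _ p.2.ne_zero), natCast_pow_cpow]
  · rcases eq_or_ne m 0 with rfl | hm
    · simp
    rcases eq_or_ne n 0 with rfl | hn
    · simp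
    rw [hterm _ (mul_ne_zero hm hn), hterm _ hm, hterm _ hn, hmul m n hmn, Nat.cast_mul,
      Complex.natCast_mul_natCast_cpow]
    ring

theorem hasSum_split {y : ℂ} (hy : ‖y‖ < 1) :
    HasSum (fun e : ℕ => ((e + 1 : ℕ) : ℂ) * y ^ e) (((1 - y) ^ 2)⁻¹) := by
  have := hasSum_choose_mul_geometric_of_norm_lt_one 1 hy
  simpa using this

theorem hasSum_inert {y : ℂ} (hy : ‖y‖ < 1) :
    HasSum (fun e : ℕ => (if Even e then (1 : ℂ) else 0) * y ^ e) ((1 - y ^ 2)⁻¹) := by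
  have h2 : ‖y ^ 2‖ < 1 := by
    rw [norm_pow]
    exact pow_lt_one₀ (norm_nonneg _) hy two_ne_zero
  have hinj : Function.Injective fun e : ℕ => 2 * e := fun _ _ h => by simpa using h
  refine (hinj.hasSum_iff fun e he => ?_).1 ((hasSum_geometric_of_norm_lt_one h2).congr_fun ?_)
  · rw [if_neg, zero_mul]
    rintro ⟨k, rfl⟩
    exact he ⟨k, by ring⟩
  · intro e
    simp [pow_mul]

end EulerProducts

/-! ### Dirichlet series of the ideal count and of the indicator of norms. -/

section IdealSeries

variable {b : ℤ} [Fact (b = 0 ∨ b = 1)] {s : ℂ}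

theorem idealCount_one : idealCount b 1 = 1 := by
  rw [idealCount_eq_card (X := Unit) (fun _ => 1) (fun _ => isUnit_iff_nrm.1 isUnit_one)
    one_ne_zero (fun _ _ _ => rfl) fun z hz => ⟨(), ?_⟩]
  · exact Nat.card_unique
  · exact (associated_one_iff_isUnit.2 (isUnit_iff_nrm.2 hz)).symm

theorem LSeries_idealCount (h : ZetaSummable (fun I : NonzeroIdeal (IntRing b) => Ideal.absNorm I.1) s) :
    LSeriesSummable (fun n => (idealCount b n : ℂ)) s ∧
      LSeries (fun n => (idealCount b n : ℂ)) s = idealZeta b s :=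
  LSeriesHasSum_of_zetaSummable (g := fun I : NonzeroIdeal (IntRing b) => Ideal.absNorm I.1)
    absNorm_ne_zero h fun _ _ => rfl

/-- The indicator function of the norms. -/
noncomputable def normIndicator (b : ℤ) [Fact (b = 0 ∨ b = 1)] (n : ℕ) : ℂ :=
  if idealCount b n = 0 then 0 else 1

/-- As all ideals are principal, a positive integer is the norm of an element exactly when some
ideal has that norm. -/
theorem LSeries_normIndicator (hs : 1 < s.re) :
    LSeriesSummable (normIndicator b) s ∧ LSeries (normIndicator b) s = normZeta b s := by
  refine LSeriesHasSum_of_zetaSummable (g := fun n : NormValue b => n.1) (fun n => n.2.1)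
    (zetaSummable_normValue hs) fun n hn => ?_
  rw [normIndicator]
  split_ifs with h
  · have : IsEmpty {x : NormValue b // x.1 = n} :=
      ⟨fun x => idealCount_ne_zero x.1 (by rw [x.2]; exact h)⟩
    rw [Nat.card_of_isEmpty, Nat.cast_zero]
  · have hne : Nonempty {I : NonzeroIdeal (IntRing b) // Ideal.absNorm I.1 = n} := by
      by_contra hne
      rw [not_nonempty_iff] at hne
      exact h Nat.card_of_isEmpty
    obtain ⟨I, hI⟩ := hne
    let _ : Unique {x : NormValue b // x.1 = n} :=
      { default := ⟨⟨n, hn, gen I, by rw [nrm_gen, hI]⟩, rfl⟩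
        uniq := fun x => Subtype.ext (Subtype.ext x.2) }
    rw [Nat.card_unique, Nat.cast_one]

end IdealSeries

end SubformZeta

namespace SubformZeta

/-! ### Comparison of the Euler products of `normZeta`, `idealZeta` and `riemannZeta`. -/

section Comparison

variable {b : ℤ} [Fact (b = 0 ∨ b = 1)] {s : ℂ} {n i q : ℕ}

theorem norm_prime_cpow_lt_one (p : Nat.Primes) (hs : 1 < s.re) : ‖(p.1 : ℂ) ^ (-s)‖ < 1 :=
  (norm_prime_cpow_le p.2 hs).trans_lt (by norm_num)

/-- Being a norm is detected by `idealCount ≠ 0`, so it inherits multiplicativity on coprime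
arguments from `idealCount`. -/
theorem normIndicator_mul {m k : ℕ} (h : m.Coprime k) :
    normIndicator b (m * k) = normIndicator b m * normIndicator b k := by
  simp only [normIndicator, idealCount_mul h, mul_eq_zero]
  split_ifs <;> simp_all

/-- The local factor of `normZeta`. -/
noncomputable def normFactor (n i : ℕ) (s : ℂ) (p : Nat.Primes) : ℂ :=
  if p.1 ≡ i [MOD n] then (1 - ((p.1 : ℂ) ^ (-s)) ^ 2)⁻¹ else (1 - (p.1 : ℂ) ^ (-s))⁻¹

/-- The local factor of `idealZeta`. -/
noncomputable def idealFactor (n i : ℕ) (s : ℂ) (p : Nat.Primes) : ℂ :=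
  if p.1 ≡ 1 [MOD n] then ((1 - (p.1 : ℂ) ^ (-s)) ^ 2)⁻¹ else normFactor n i s p

namespace SplitLaw

theorem not_inert (h : SplitLaw b n i q) {p : ℕ} (hp : p ≡ 1 [MOD n]) : ¬ p ≡ i [MOD n] :=
  fun h2 => h.one_ne (hp.symm.trans h2)

/-- At an inert prime only even powers are norms; at every other prime all powers are. -/
theorem hasProd_normZeta (h : SplitLaw b n i q) (hs : 1 < s.re) :
    HasProd (normFactor n i s) (normZeta b s) := by
  obtain ⟨h1, h2⟩ := LSeries_normIndicator (b := b) hs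
  rw [← h2]
  refine hasProd_LSeries (by simp [normIndicator, idealCount_one]) (fun m k => normIndicator_mul) h1
    fun p => ?_
  have hy := norm_prime_cpow_lt_one p hs
  rw [normFactor]
  split_ifs with hi
  · refine (hasSum_inert hy).congr_fun fun e => ?_
    rw [normIndicator, h.inert p.1 p.2 hi e]
    split_ifs <;> simp_all
  · refine (hasSum_geometric_of_norm_lt_one hy).congr_fun fun e => ?_
    have : idealCount b (p.1 ^ e) ≠ 0 := by
      rcases h.cases p.1 p.2 with h3 | h3 | h3
      · rw [h.split p.1 p.2 h3]
        omega
      · exact absurd h3 hi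
      · rw [h3, h.ramified]
        exact one_ne_zero
    rw [normIndicator, if_neg this, one_mul]

theorem hasProd_idealZeta (h : SplitLaw b n i q) (hs : 1 < s.re)
    (hI : ZetaSummable (fun I : NonzeroIdeal (IntRing b) => Ideal.absNorm I.1) s) :
    HasProd (idealFactor n i s) (idealZeta b s) := by
  obtain ⟨h1, h2⟩ := LSeries_idealCount hI
  rw [← h2]
  refine hasProd_LSeries (by simp [idealCount_one]) (fun m k hmk => by
    rw [idealCount_mul hmk, Nat.cast_mul]) h1 fun p => ?_
  have hy := norm_prime_cpow_lt_one p hs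
  rw [idealFactor, normFactor]
  split_ifs with h3 hi
  · refine (hasSum_split hy).congr_fun fun e => ?_
    rw [h.split p.1 p.2 h3]
  · refine (hasSum_inert hy).congr_fun fun e => ?_
    rw [h.inert p.1 p.2 hi e, Nat.cast_ite, Nat.cast_one, Nat.cast_zero]
  · refine (hasSum_geometric_of_norm_lt_one hy).congr_fun fun e => ?_
    have hq := ((h.cases p.1 p.2).resolve_left h3).resolve_left hi
    rw [hq, h.ramified, Nat.cast_one, one_mul]

/-- The local factors agree except at split primes, where `idealZeta` has `(1 - p^{-s})^{-2}` and
`normZeta` has `(1 - p^{-s})^{-1}`. -/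
theorem idealZeta_mul_prod (h : SplitLaw b n i q) (hs : 1 < s.re)
    (hI : ZetaSummable (fun I : NonzeroIdeal (IntRing b) => Ideal.absNorm I.1) s) :
    idealZeta b s * ∏' p : PrimesMod n 1, (1 - (p.1 : ℂ) ^ (-s)) = normZeta b s := by
  refine ((h.hasProd_idealZeta hs hI).mul (hasProd_primesMod (f := fun p => 1 - (p : ℂ) ^ (-s))
    (multipliable_primesMod n 1 hs).1)).unique
    ((h.hasProd_normZeta hs).congr_fun fun p => ?_)
  have hne := one_sub_prime_cpow_ne_zero p.2 hs
  rw [idealFactor]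
  split_ifs with h1
  · rw [normFactor, if_neg (h.not_inert h1)]
    field_simp
  · rw [mul_one]

theorem one_sub_sq_ne_zero (p : Nat.Primes) (hs : 1 < s.re) : 1 - ((p.1 : ℂ) ^ (-s)) ^ 2 ≠ 0 := by
  rw [show 1 - ((p.1 : ℂ) ^ (-s)) ^ 2 = (1 - (p.1 : ℂ) ^ (-s)) * (1 + (p.1 : ℂ) ^ (-s)) by ring]
  exact mul_ne_zero (one_sub_prime_cpow_ne_zero p.2 hs) (one_add_prime_cpow_ne_zero p.2 hs)

theorem normZeta_mul_prod (h : SplitLaw b n i q) (hs : 1 < s.re) :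
    normZeta b s * ∏' p : PrimesMod n i, (1 + (p.1 : ℂ) ^ (-s)) = riemannZeta s := by
  refine ((h.hasProd_normZeta hs).mul (hasProd_primesMod (f := fun p => 1 + (p : ℂ) ^ (-s))
    (multipliable_primesMod n i hs).2.1)).unique
    ((riemannZeta_eulerProduct_hasProd hs).congr_fun fun p => ?_)
  have hne := one_sub_prime_cpow_ne_zero p.2 hs
  have hne2 := one_sub_sq_ne_zero p hs
  rw [normFactor]
  split_ifs with h1
  · field_simp
    ring
  · rw [mul_one]

theorem normZeta_eq (h : SplitLaw b n i q) (hs : 1 < s.re) :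
    normZeta b s = riemannZeta s * ∏' p : PrimesMod n i, (1 + (p.1 : ℂ) ^ (-s))⁻¹ := by
  refine (h.hasProd_normZeta hs).unique (((riemannZeta_eulerProduct_hasProd hs).mul
    (hasProd_primesMod (f := fun p => (1 + (p : ℂ) ^ (-s))⁻¹)
    (multipliable_primesMod n i hs).2.2)).congr_fun fun p => ?_)
  have hne := one_sub_prime_cpow_ne_zero p.2 hs
  have hne2 := one_sub_sq_ne_zero p hs
  have hne3 := one_add_prime_cpow_ne_zero p.2 hs
  rw [normFactor]
  split_ifs with h1
  · field_simp
    ring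
  · rw [mul_one]

theorem hasProd_prime (hq : q.Prime) (z : ℂ) :
    HasProd (fun p : Nat.Primes => if p.1 = q then z else 1) z := by
  have := hasProd_single (f := fun p : Nat.Primes => if p.1 = q then z else 1) ⟨q, hq⟩
    fun p hp => if_neg fun h => hp (Subtype.ext h)
  rwa [if_pos rfl] at this

/-- Every prime lies in exactly one of the three classes, so it picks up the factor `1 + p^{-s}`
once, and `(1 - y²)^{-1} (1 + y) = (1 - y)^{-1}`. -/
theorem local_factor (h : SplitLaw b n i q) (hs : 1 < s.re) (p : Nat.Primes) :
    (1 - (p.1 : ℂ) ^ (-(2 * s)))⁻¹ * ((if p.1 = q then 1 + (q : ℂ) ^ (-s) else 1) *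
      ((if p.1 ≡ 1 [MOD n] then 1 + (p.1 : ℂ) ^ (-s) else 1) *
      (if p.1 ≡ i [MOD n] then 1 + (p.1 : ℂ) ^ (-s) else 1))) = (1 - (p.1 : ℂ) ^ (-s))⁻¹ := by
  have hne := one_sub_prime_cpow_ne_zero p.2 hs
  have hne2 := one_sub_sq_ne_zero p hs
  have e : ((p.1 : ℕ) : ℂ) ^ (-(2 * s)) = ((p.1 : ℂ) ^ (-s)) ^ 2 := by
    rw [show -(2 * s) = -s + -s by ring, Complex.cpow_add _ _ (Nat.cast_ne_zero.2 p.2.ne_zero), sq]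
  have key : (1 - ((p.1 : ℂ) ^ (-s)) ^ 2)⁻¹ * (1 + (p.1 : ℂ) ^ (-s)) = (1 - (p.1 : ℂ) ^ (-s))⁻¹ := by
    field_simp
    ring
  rw [e, ← key]
  congr 1
  rcases h.cases p.1 p.2 with h3 | h3 | h3
  · have hpq : p.1 ≠ q := fun h4 => h.ne_one (h4 ▸ h3)
    rw [if_neg hpq, if_pos h3, if_neg (h.not_inert h3), one_mul, mul_one]
  · have hpq : p.1 ≠ q := fun h4 => h.ne_inert (h4 ▸ h3)
    rw [if_neg hpq, if_pos h3, if_neg fun h4 => h.not_inert h4 h3, one_mul, one_mul]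
  · rw [if_pos h3, h3, if_neg h.ne_one, if_neg h.ne_inert, mul_one, mul_one]

theorem riemannZeta_two_mul_mul_prod (h : SplitLaw b n i q) (hs : 1 < s.re) :
    riemannZeta (2 * s) * ((1 + (q : ℂ) ^ (-s)) *
      ((∏' p : PrimesMod n 1, (1 + (p.1 : ℂ) ^ (-s))) *
        ∏' p : PrimesMod n i, (1 + (p.1 : ℂ) ^ (-s)))) = riemannZeta s := by
  have hs2 : 1 < (2 * s).re := by
    simp
    linarith
  have h1 := hasProd_primesMod (f := fun p => 1 + (p : ℂ) ^ (-s)) (multipliable_primesMod n 1 hs).2.1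
  have h2 := hasProd_primesMod (f := fun p => 1 + (p : ℂ) ^ (-s)) (multipliable_primesMod n i hs).2.1
  have h3 := (riemannZeta_eulerProduct_hasProd hs2).mul
    ((hasProd_prime h.prime (1 + (q : ℂ) ^ (-s))).mul (h1.mul h2))
  rw [funext (h.local_factor hs)] at h3
  exact h3.unique (riemannZeta_eulerProduct_hasProd hs)

/-- Let `P₁`, `Pᵢ` be the products of `1 + p^{-s}` over split and inert primes. Then `normZeta =
ζ(s) / Pᵢ`, the coprime sum is `ζ(s)² / ζ(2s)`, and `ζ(s) / ζ(2s) = (1 + q^{-s}) P₁ Pᵢ`, so `Pᵢ`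
cancels. -/
theorem normZeta_mul_coprimeZeta (h : SplitLaw b n i q) (hs : 1 < s.re) :
    normZeta b s * coprimeZeta (fun _ _ => True) s = (1 + (q : ℂ) ^ (-s)) * (riemannZeta s ^ 2 *
      ∏' p : PrimesMod n 1, (1 + (p.1 : ℂ) ^ (-s))) := by
  have h1 := h.normZeta_mul_prod hs
  have h2 := h.riemannZeta_two_mul_mul_prod hs
  have h3 := riemannZeta_two_mul_mul_coprimeZeta hs
  have h0 : riemannZeta s ≠ 0 := riemannZeta_ne_zero_of_one_le_re hs.le
  -- Both denominators divide `ζ(s)`, which does not vanish for `Re s > 1`.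
  have h4 : riemannZeta (2 * s) ≠ 0 := fun h => h0 (by rw [← h2, h, zero_mul])
  have h5 : ∏' p : PrimesMod n i, (1 + (p.1 : ℂ) ^ (-s)) ≠ 0 := fun h => h0 (by rw [← h1, h, mul_zero])
  apply mul_left_cancel₀ (mul_ne_zero h4 h5)
  linear_combination normZeta b s * (∏' p : PrimesMod n i, (1 + (p.1 : ℂ) ^ (-s))) * h3 +
    riemannZeta s ^ 2 * h1 - riemannZeta s ^ 2 * h2

end SplitLaw

end Comparison

end SubformZeta

open scoped QuadraticAlgebra

namespace SubformZeta

/-! ### The rings of integers of `ℚ(√-1)` and `ℚ(√-3)` -/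

section Integers

section Model

variable {b : ℤ}

/-- `ℚ(ω)` as `ℚ(√d)`, with `ω = b / 2 + c √d`. -/
def quadEquiv {d c : ℚ} (hc : c ≠ 0) (h : d * c ^ 2 = b ^ 2 / 4 - 1) : RatField b ≃+* QuadField d where
  -- The hypothesis `h` says that `b / 2 + c √d` has trace `b` and norm 1, the relation that defines
  -- `ω`.
  toFun x := ⟨x.re + b / 2 * x.im, c * x.im⟩
  invFun x := ⟨x.re - b / 2 * (x.im / c), x.im / c⟩
  left_inv x := by
    ext
    · simp [hc]
    · simp [hc]
  right_inv x := by
    ext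
    · simp
    · simp [mul_div_cancel₀, hc]
  map_mul' x y := by
    ext
    · simp
      linear_combination -(x.im * y.im) * h
    · simp
      ring
  map_add' x y := by
    ext
    · simp
      ring
    · simp
      ring

theorem norm_quadEquiv {d c : ℚ} (hc : c ≠ 0) (h : d * c ^ 2 = b ^ 2 / 4 - 1) (x : RatField b) :
    normForm d (quadEquiv hc h x) = x.norm := by
  change QuadraticAlgebra.norm (⟨x.re + b / 2 * x.im, c * x.im⟩ : QuadField d) = _
  rw [QuadraticAlgebra.norm_def, QuadraticAlgebra.norm_def]
  linear_combination -(x.im ^ 2) * h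

end Model

variable {b : ℤ} [Fact (b = 0 ∨ b = 1)]

/-- A principal ideal domain is integrally closed in its fraction field, and `IntRing b` is integral
over `ℤ`. -/
theorem isIntegral_ratField_iff {x : RatField b} : IsIntegral ℤ x ↔ ∃ z, incl b z = x := by
  let _ : Algebra (IntRing b) (RatField b) := (incl b).toAlgebra
  have hinj : Function.Injective (algebraMap (IntRing b) (RatField b)) := incl_injective
  have : FaithfulSMul (IntRing b) (RatField b) := (faithfulSMul_iff_algebraMap_injective _ _).2 hinj
  have hfrac : IsFractionRing (IntRing b) (RatField b) := IsFractionRing.of_field _ _ fun x => by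
    -- The product of the denominators of both coordinates serves as a common denominator.
    refine ⟨⟨x.re.num * x.im.den, x.im.num * x.re.den⟩, (x.re.den * x.im.den : ℕ), ?_⟩
    change x = incl b _ / incl b _
    have h1 : (x.re.den : ℚ) ≠ 0 := Nat.cast_ne_zero.2 x.re.den_ne_zero
    have h2 : (x.im.den : ℚ) ≠ 0 := Nat.cast_ne_zero.2 x.im.den_ne_zero
    rw [map_natCast, eq_div_iff (Nat.cast_ne_zero.2 (mul_ne_zero x.re.den_ne_zero x.im.den_ne_zero))]
    have h3 := Rat.mul_den_eq_num x.re
    have h4 := Rat.mul_den_eq_num x.im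
    ext
    · simp
      linear_combination (x.im.den : ℚ) * h3
    · simp
      linear_combination (x.re.den : ℚ) * h4
  have hfin : Algebra.IsIntegral ℤ (IntRing b) := inferInstance
  constructor
  · intro h
    exact IsIntegrallyClosed.isIntegral_iff.1 (IsIntegral.tower_top (A := IntRing b) h)
  · rintro ⟨z, rfl⟩
    exact (hfin.isIntegral z).map (incl b).toIntAlgHom

section NumberField

variable {d c : ℚ} [Fact (∀ r : ℚ, r ^ 2 ≠ d + 0 * r)]

theorem isIntegral_quadField_iff (hc : c ≠ 0) (h : d * c ^ 2 = b ^ 2 / 4 - 1) {x : QuadField d} :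
    IsIntegral ℤ x ↔ ∃ z, quadEquiv hc h (incl b z) = x := by
  have h1 : IsIntegral ℤ x ↔ IsIntegral ℤ ((quadEquiv hc h).symm x) :=
    ⟨fun hx => hx.map (quadEquiv hc h).symm.toRingHom.toIntAlgHom, fun hx => by
      have := hx.map (quadEquiv hc h).toRingHom.toIntAlgHom
      simpa using this⟩
  rw [h1, isIntegral_ratField_iff]
  exact exists_congr fun z => (RingEquiv.eq_symm_apply _)

theorem mem_integerLattice {F : Type*} [Field F] {x : F} : x ∈ integerLattice F ↔ IsIntegral ℤ x := by
  constructor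
  · rintro ⟨y, rfl⟩
    exact NumberField.RingOfIntegers.isIntegral_coe y
  · intro h
    exact ⟨⟨x, h⟩, rfl⟩

/-- The ring of integers of `ℚ(√d)` as a lattice. -/
noncomputable def normModelQuadField (hc : c ≠ 0) (h : d * c ^ 2 = b ^ 2 / 4 - 1) :
    NormModel b (normForm d) (integerLattice (QuadField d)) where
  equiv := (quadEquiv (b := b) hc h).symm.toAddEquiv.toLinearEquiv fun r x => by
    change (quadEquiv hc h).symm (r • x) = r • (quadEquiv hc h).symm x
    rw [Algebra.smul_def, Algebra.smul_def, map_mul]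
    congr 1
    exact map_ratCast _ r
  norm_equiv x := by
    have := norm_quadEquiv hc h ((quadEquiv (b := b) hc h).symm x)
    rw [RingEquiv.apply_symm_apply] at this
    exact this.symm
  mem_iff x := by
    rw [mem_integerLattice, isIntegral_quadField_iff hc h]
    exact exists_congr fun z => (RingEquiv.eq_symm_apply _).symm

/-- The ring of integers of `ℚ(√d)` is `IntRing b`. -/
noncomputable def integersEquiv (hc : c ≠ 0) (h : d * c ^ 2 = b ^ 2 / 4 - 1) :
    IntRing b ≃+* NumberField.RingOfIntegers (QuadField d) :=
  RingEquiv.ofBijective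
    ({ toFun := fun z => ⟨quadEquiv hc h (incl b z), (isIntegral_quadField_iff hc h).2 ⟨z, rfl⟩⟩
       map_one' := NumberField.RingOfIntegers.ext (by simp only [map_one]; rfl)
       map_zero' := NumberField.RingOfIntegers.ext (by simp only [map_zero]; rfl)
       map_mul' := fun x y => NumberField.RingOfIntegers.ext (by simp only [map_mul]; rfl)
       map_add' := fun x y => NumberField.RingOfIntegers.ext (by simp only [map_add]; rfl) } :
      IntRing b →+* NumberField.RingOfIntegers (QuadField d))
    ⟨fun x y hxy => incl_injective ((quadEquiv hc h).injective
      (congrArg NumberField.RingOfIntegers.val hxy)), fun y => by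
      obtain ⟨z, hz⟩ := (isIntegral_quadField_iff hc h).1 y.2
      exact ⟨z, NumberField.RingOfIntegers.ext hz⟩⟩

end NumberField

/-- Ring isomorphisms preserve the number of ideals of given norm. -/
theorem card_absNorm_eq {R S : Type*} [CommRing R] [CommRing S]
    [IsDedekindDomain R] [IsDedekindDomain S] [Module.Free ℤ R] [Module.Free ℤ S] (e : R ≃+* S)
    (n : ℕ) : Nat.card {I : Ideal R // Ideal.absNorm I = n} =
      Nat.card {I : Ideal S // Ideal.absNorm I = n} := by
  refine Nat.card_congr (e.symm.idealComapOrderIso.toEquiv.subtypeEquiv fun I => ?_)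
  have h : Ideal.absNorm (I.comap e.symm) = Ideal.absNorm I := by
    rw [Ideal.absNorm_apply, Ideal.absNorm_apply, Submodule.cardQuot_apply, Submodule.cardQuot_apply]
    exact Nat.card_congr (Ideal.quotientEquiv _ _ e.symm 
      (Ideal.map_comap_of_surjective (e.symm : S →+* R) e.symm.surjective I).symm).toEquiv
  change _ ↔ Ideal.absNorm (I.comap e.symm) = n
  rw [h]

/-- The zero ideal has `absNorm` equal to 0, so excluding it changes nothing for `n ≠ 0`. -/
theorem idealCount_eq {n : ℕ} (hn : n ≠ 0) :
    idealCount b n = Nat.card {I : Ideal (IntRing b) // Ideal.absNorm I = n} := by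
  refine Nat.card_congr (Equiv.ofBijective
    (fun I => (⟨I.1.1, I.2⟩ : {I : Ideal (IntRing b) // Ideal.absNorm I = n})) ⟨?_, ?_⟩)
  · intro I J h
    exact Subtype.ext (Subtype.ext (by simpa using h))
  · rintro ⟨I, hI⟩
    refine ⟨⟨⟨I, ?_⟩, hI⟩, rfl⟩
    rintro rfl
    exact hn (by rw [← hI, Ideal.absNorm_bot])

theorem dedekindZeta_quadField {d c : ℚ} [Fact (∀ r : ℚ, r ^ 2 ≠ d + 0 * r)] (hc : c ≠ 0)
    (h : d * c ^ 2 = b ^ 2 / 4 - 1) {s : ℂ}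
    (hI : ZetaSummable (fun I : NonzeroIdeal (IntRing b) => Ideal.absNorm I.1) s) :
    NumberField.dedekindZeta (QuadField d) s = idealZeta b s := by
  rw [← (LSeries_idealCount hI).2, NumberField.dedekindZeta]
  refine LSeries_congr (fun {n} hn => ?_) s
  rw [idealCount_eq hn, card_absNorm_eq (integersEquiv hc h)]

end Integers

end SubformZeta

namespace SubformZeta

/-! ### The zeta functions of the square and of the hexagonal lattice -/

section Lattices

variable {b : ℤ} [Fact (b = 0 ∨ b = 1)]

theorem cpow_neg_two_mul (s : ℂ) : (2 : ℂ) ^ (-2 * s) = ((2 : ℂ) ^ (-s)) ^ 2 := by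
  rw [← Complex.cpow_nat_mul]
  congr 1
  push_cast
  ring

/-- The reflection part of the square lattice. -/
theorem normZeta_mul_invariantZeta_zero [Fintype (IntRing 0)ˣ] {s : ℂ} (hs : 1 < s.re) :
    normZeta 0 s * invariantZeta 0 s =
      4 * ((1 + 2 ^ (-2 * s)) * riemannZeta s ^ 2 *
        ∏' p : PrimesMod 4 1, (1 + (p.1 : ℂ) ^ (-s))) := by
  have h1 := (invariantZeta_zero hs).2
  have h2 := splitLaw_zero.normZeta_mul_coprimeZeta hs
  rw [cpow_neg_two_mul]
  refine mul_left_cancel₀ (two_cpow_ne hs) ?_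
  push_cast at h2
  linear_combination normZeta 0 s * h1 + 4 * (1 + ((2 : ℂ) ^ (-s)) ^ 2) * h2

/-- The reflection part of the hexagonal lattice. -/
theorem normZeta_mul_invariantZeta_one [Fintype (IntRing 1)ˣ] {s : ℂ} (hs : 1 < s.re) :
    normZeta 1 s * invariantZeta 1 s =
      6 * ((1 - 2 ^ (-s) + 2 * 2 ^ (-2 * s)) * riemannZeta s ^ 2 *
        ∏' p : PrimesMod 3 1, (1 + (p.1 : ℂ) ^ (-s))) := by
  have h1 := (invariantZeta_one hs).2
  have h2 := splitLaw_one.normZeta_mul_coprimeZeta hs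
  have h3 := one_add_prime_cpow_ne_zero Nat.prime_three hs
  rw [cpow_neg_two_mul]
  push_cast at h2 h3
  refine mul_left_cancel₀ h3 ?_
  linear_combination normZeta 1 s * h1 +
    6 * (1 - (2 : ℂ) ^ (-s) + 2 * ((2 : ℂ) ^ (-s)) ^ 2) * h2

theorem refl_zero {V : Type*} [AddCommGroup V] [Module ℚ V] {Q : QuadraticForm ℚ V}
    {L : AddSubgroup V} (M : NormModel 0 Q L) {s : ℂ} (hs : 1 < s.re) :
    ReflSummable Q L s ∧ Refl Q L s = 1 / 2 * (1 + 2 ^ (-2 * s)) * riemannZeta s ^ 2 *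
      ∏' p : PrimesMod 4 1, (1 + (p.1 : ℂ) ^ (-s)) := by
  have := Fintype.ofFinite (IntRing 0)ˣ
  have h := M.refl_eq hs (invariantZeta_zero hs).1
  refine ⟨h.1, ?_⟩
  rw [h.2, card_units_zero]
  linear_combination 1 / 8 * normZeta_mul_invariantZeta_zero hs

theorem refl_one {V : Type*} [AddCommGroup V] [Module ℚ V] {Q : QuadraticForm ℚ V}
    {L : AddSubgroup V} (M : NormModel 1 Q L) {s : ℂ} (hs : 1 < s.re) :
    ReflSummable Q L s ∧ Refl Q L s = 1 / 2 * (1 - 2 ^ (-s) + 2 * 2 ^ (-2 * s)) *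
      riemannZeta s ^ 2 * ∏' p : PrimesMod 3 1, (1 + (p.1 : ℂ) ^ (-s)) := by
  have := Fintype.ofFinite (IntRing 1)ˣ
  have h := M.refl_eq hs (invariantZeta_one hs).1
  refine ⟨h.1, ?_⟩
  rw [h.2, card_units_one]
  linear_combination 1 / 12 * normZeta_mul_invariantZeta_one hs

theorem NormModel.properZeta_eq {V : Type*} [AddCommGroup V] [Module ℚ V] {Q : QuadraticForm ℚ V}
    {L : AddSubgroup V} (M : NormModel b Q L) {s : ℂ} (hs : 2 < s.re) :
    LSeriesSummable (properCoeff Q L) s ∧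
      properZeta Q L s = normZeta b s * orbitZeta b false s := by
  have := Fintype.ofFinite (IntRing b)ˣ
  exact M.LSeries_classCount false (by linarith) (burnside_primitive false
    (idealZeta_mul_primitiveZeta hs).2.1).1

theorem NormModel.zeta_eq {V : Type*} [AddCommGroup V] [Module ℚ V] {Q : QuadraticForm ℚ V}
    {L : AddSubgroup V} (M : NormModel b Q L) {s : ℂ} (hs : 2 < s.re) :
    LSeriesSummable (coeff Q L) s ∧ zeta Q L s = normZeta b s * orbitZeta b true s := by
  have := Fintype.ofFinite (IntRing b)ˣ
  exact M.LSeries_classCount true (by linarith) (burnside_primitive true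
    (idealZeta_mul_primitiveZeta hs).2.1).1

theorem SplitLaw.normZeta_mul_primitiveZeta {n i q : ℕ} (h : SplitLaw b n i q) {s : ℂ}
    (hs : 2 < s.re) : normZeta b s * primitiveZeta b s =
      riemannZeta s * riemannZeta (s - 1) * ∏' p : PrimesMod n 1, (1 - (p.1 : ℂ) ^ (-s)) := by
  obtain ⟨hI, -, h2⟩ := idealZeta_mul_primitiveZeta (b := b) hs
  rw [← h2, ← h.idealZeta_mul_prod (by linarith) hI]
  ring

theorem SplitLaw.normZeta_eq_dedekindZeta {n i q : ℕ} (h : SplitLaw b n i q) {d c : ℚ}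
    [Fact (∀ r : ℚ, r ^ 2 ≠ d + 0 * r)] (hc : c ≠ 0) (hd : d * c ^ 2 = b ^ 2 / 4 - 1) {s : ℂ}
    (hs : 2 < s.re) : normZeta b s = NumberField.dedekindZeta (QuadField d) s *
      ∏' p : PrimesMod n 1, (1 - (p.1 : ℂ) ^ (-s)) := by
  have hI := (idealZeta_mul_primitiveZeta (b := b) hs).1
  rw [dedekindZeta_quadField hc hd hI, h.idealZeta_mul_prod (by linarith) hI]

end Lattices

end SubformZeta

/-! ### Assembly of the formulas for both lattices. -/

theorem mainTheorem6 :
    -- convergence of the products over primes that occur below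
    (∀ (n a : ℕ) (s : ℂ), 1 < s.re →
      Multipliable (fun p : SubformZeta.PrimesMod n a => 1 - (p.1 : ℂ) ^ (-s)) ∧
      Multipliable (fun p : SubformZeta.PrimesMod n a => 1 + (p.1 : ℂ) ^ (-s)) ∧
      Multipliable (fun p : SubformZeta.PrimesMod n a => (1 + (p.1 : ℂ) ^ (-s))⁻¹)) ∧
    -- reflection terms for the ring of integers of `ℚ(√-3)`
    (∀ s : ℂ, 1 < s.re →
      SubformZeta.ReflSummable (SubformZeta.normForm (-3))
        (SubformZeta.integerLattice (SubformZeta.QuadField (-3))) s ∧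
      SubformZeta.Refl (SubformZeta.normForm (-3))
        (SubformZeta.integerLattice (SubformZeta.QuadField (-3))) s =
        1 / 2 * (1 - 2 ^ (-s) + 2 * 2 ^ (-2 * s)) * riemannZeta s ^ 2 *
          ∏' p : SubformZeta.PrimesMod 3 1, (1 + (p.1 : ℂ) ^ (-s))) ∧
    -- reflection terms for the ring of integers of `ℚ(√-1)`
    (∀ s : ℂ, 1 < s.re →
      SubformZeta.ReflSummable (SubformZeta.normForm (-1))
        (SubformZeta.integerLattice (SubformZeta.QuadField (-1))) s ∧
      SubformZeta.Refl (SubformZeta.normForm (-1))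
        (SubformZeta.integerLattice (SubformZeta.QuadField (-1))) s =
        1 / 2 * (1 + 2 ^ (-2 * s)) * riemannZeta s ^ 2 *
          ∏' p : SubformZeta.PrimesMod 4 1, (1 + (p.1 : ℂ) ^ (-s))) ∧
    -- the hexagonal lattice
    (∀ (V : Type*) [AddCommGroup V] [Module ℚ V] (Q : QuadraticForm ℚ V) (L : AddSubgroup V),
      SubformZeta.IsLatticeOfForm Q L 1 1 1 → ∀ s : ℂ, 2 < s.re →
      LSeriesSummable (SubformZeta.properCoeff Q L) s ∧
      SubformZeta.properZeta Q L s =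
        1 / 3 * riemannZeta s * riemannZeta (s - 1) *
            (∏' p : SubformZeta.PrimesMod 3 1, (1 - (p.1 : ℂ) ^ (-s))) +
          2 / 3 * NumberField.dedekindZeta (SubformZeta.QuadField (-3)) s *
            ∏' p : SubformZeta.PrimesMod 3 1, (1 - (p.1 : ℂ) ^ (-s)) ∧
      SubformZeta.properZeta Q L s =
        1 / 3 * riemannZeta s * riemannZeta (s - 1) *
            (∏' p : SubformZeta.PrimesMod 3 1, (1 - (p.1 : ℂ) ^ (-s))) +
          2 / 3 * riemannZeta s *
            ∏' q : SubformZeta.PrimesMod 3 2, (1 + (q.1 : ℂ) ^ (-s))⁻¹ ∧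
      LSeriesSummable (SubformZeta.coeff Q L) s ∧
      SubformZeta.zeta Q L s =
        1 / 2 * SubformZeta.properZeta Q L s +
          1 / 2 * (1 - 2 ^ (-s) + 2 * 2 ^ (-2 * s)) * riemannZeta s ^ 2 *
            ∏' p : SubformZeta.PrimesMod 3 1, (1 + (p.1 : ℂ) ^ (-s)) ∧
      SubformZeta.zeta Q L s =
        1 / 6 * riemannZeta s * riemannZeta (s - 1) *
            (∏' p : SubformZeta.PrimesMod 3 1, (1 - (p.1 : ℂ) ^ (-s))) +
          1 / 3 * riemannZeta s *
            (∏' q : SubformZeta.PrimesMod 3 2, (1 + (q.1 : ℂ) ^ (-s))⁻¹) +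
          1 / 2 * (1 - 2 ^ (-s) + 2 * 2 ^ (-2 * s)) * riemannZeta s ^ 2 *
            ∏' p : SubformZeta.PrimesMod 3 1, (1 + (p.1 : ℂ) ^ (-s))) ∧
    -- the square lattice
    (∀ (V : Type*) [AddCommGroup V] [Module ℚ V] (Q : QuadraticForm ℚ V) (L : AddSubgroup V),
      SubformZeta.IsLatticeOfForm Q L 1 0 1 → ∀ s : ℂ, 2 < s.re →
      LSeriesSummable (SubformZeta.properCoeff Q L) s ∧
      SubformZeta.properZeta Q L s =
        1 / 2 * riemannZeta s * riemannZeta (s - 1) *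
            (∏' p : SubformZeta.PrimesMod 4 1, (1 - (p.1 : ℂ) ^ (-s))) +
          1 / 2 * NumberField.dedekindZeta (SubformZeta.QuadField (-1)) s *
            ∏' p : SubformZeta.PrimesMod 4 1, (1 - (p.1 : ℂ) ^ (-s)) ∧
      SubformZeta.properZeta Q L s =
        1 / 2 * riemannZeta s * riemannZeta (s - 1) *
            (∏' p : SubformZeta.PrimesMod 4 1, (1 - (p.1 : ℂ) ^ (-s))) +
          1 / 2 * riemannZeta s *
            ∏' q : SubformZeta.PrimesMod 4 3, (1 + (q.1 : ℂ) ^ (-s))⁻¹ ∧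
      LSeriesSummable (SubformZeta.coeff Q L) s ∧
      SubformZeta.zeta Q L s =
        1 / 2 * SubformZeta.properZeta Q L s +
          1 / 2 * (1 + 2 ^ (-2 * s)) * riemannZeta s ^ 2 *
            ∏' p : SubformZeta.PrimesMod 4 1, (1 + (p.1 : ℂ) ^ (-s)) ∧
      SubformZeta.zeta Q L s =
        1 / 4 * riemannZeta s * riemannZeta (s - 1) *
            (∏' p : SubformZeta.PrimesMod 4 1, (1 - (p.1 : ℂ) ^ (-s))) +
          1 / 4 * riemannZeta s *
            (∏' q : SubformZeta.PrimesMod 4 3, (1 + (q.1 : ℂ) ^ (-s))⁻¹) +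
          1 / 2 * (1 + 2 ^ (-2 * s)) * riemannZeta s ^ 2 *
            ∏' p : SubformZeta.PrimesMod 4 1, (1 + (p.1 : ℂ) ^ (-s))) := by
  refine ⟨fun n a s hs => SubformZeta.multipliable_primesMod n a hs,
    fun s hs => SubformZeta.refl_one
      (SubformZeta.normModelQuadField (c := 1 / 2) (by norm_num) (by norm_num)) hs,
    fun s hs => SubformZeta.refl_zero
      (SubformZeta.normModelQuadField (c := 1) (by norm_num) (by norm_num)) hs, ?_, ?_⟩
  · intro V _ _ Q L hL s hs
    have := Fintype.ofFinite (SubformZeta.IntRing 1)ˣ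
    obtain ⟨M⟩ := SubformZeta.IsLatticeOfForm.exists_normModel (b := 1) hL
    have hs1 : 1 < s.re := by linarith
    obtain ⟨hp, hp'⟩ := M.properZeta_eq hs
    obtain ⟨hz, hz'⟩ := M.zeta_eq hs
    have ho := SubformZeta.orbitZeta_one (SubformZeta.idealZeta_mul_primitiveZeta hs).2.1
    have h1 := SubformZeta.splitLaw_one.normZeta_mul_primitiveZeta hs
    have h2 := SubformZeta.splitLaw_one.normZeta_eq_dedekindZeta (d := -3) (c := 1 / 2)
      (by norm_num) (by norm_num) hs
    have h3 := SubformZeta.splitLaw_one.normZeta_eq hs1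
    have h4 := SubformZeta.normZeta_mul_invariantZeta_one hs1
    -- Two of the six rotations fix everything and four fix only the full ring, whence `2/6` and
    -- `4/6`.
    have h5 : SubformZeta.properZeta Q L s =
        1 / 3 * (SubformZeta.normZeta 1 s * SubformZeta.primitiveZeta 1 s) +
          2 / 3 * SubformZeta.normZeta 1 s := by
      rw [hp']
      linear_combination SubformZeta.normZeta 1 s / 6 * ho.1
    have h6 : SubformZeta.zeta Q L s = 1 / 2 * SubformZeta.properZeta Q L s +
        1 / 12 * (SubformZeta.normZeta 1 s * SubformZeta.invariantZeta 1 s) := by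
      rw [hz', h5]
      linear_combination SubformZeta.normZeta 1 s / 12 * ho.2
    rw [h4] at h6
    rw [h1] at h5
    refine ⟨hp, ?_, ?_, hz, ?_, ?_⟩
    · linear_combination h5 + 2 / 3 * h2
    · linear_combination h5 + 2 / 3 * h3
    · linear_combination h6
    · linear_combination h6 + 1 / 2 * h5 + 1 / 3 * h3
  · intro V _ _ Q L hL s hs
    have := Fintype.ofFinite (SubformZeta.IntRing 0)ˣ
    obtain ⟨M⟩ := SubformZeta.IsLatticeOfForm.exists_normModel (b := 0) hL
    have hs1 : 1 < s.re := by linarith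
    obtain ⟨hp, hp'⟩ := M.properZeta_eq hs
    obtain ⟨hz, hz'⟩ := M.zeta_eq hs
    have ho := SubformZeta.orbitZeta_zero (SubformZeta.idealZeta_mul_primitiveZeta hs).2.1
    have h1 := SubformZeta.splitLaw_zero.normZeta_mul_primitiveZeta hs
    have h2 := SubformZeta.splitLaw_zero.normZeta_eq_dedekindZeta (d := -1) (c := 1)
      (by norm_num) (by norm_num) hs
    have h3 := SubformZeta.splitLaw_zero.normZeta_eq hs1
    have h4 := SubformZeta.normZeta_mul_invariantZeta_zero hs1
    -- Two of the four rotations fix everything and two fix only the full ring.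
    have h5 : SubformZeta.properZeta Q L s =
        1 / 2 * (SubformZeta.normZeta 0 s * SubformZeta.primitiveZeta 0 s) +
          1 / 2 * SubformZeta.normZeta 0 s := by
      rw [hp']
      linear_combination SubformZeta.normZeta 0 s / 4 * ho.1
    have h6 : SubformZeta.zeta Q L s = 1 / 2 * SubformZeta.properZeta Q L s +
        1 / 8 * (SubformZeta.normZeta 0 s * SubformZeta.invariantZeta 0 s) := by
      rw [hz', h5]
      linear_combination SubformZeta.normZeta 0 s / 8 * ho.2
    rw [h4] at h6
    rw [h1] at h5
    refine ⟨hp, ?_, ?_, hz, ?_, ?_⟩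
    · linear_combination h5 + 1 / 2 * h2
    · linear_combination h5 + 1 / 2 * h3
    · linear_combination h6
    · linear_combination h6 + 1 / 2 * h5 + 1 / 4 * h3
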